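/- Let $q\in(0,1)$, $c\in[0,\infty)$ and $\lambda_n:=(1-q^{2n})^{1/2}$. A representation of the relations $$YX=q^2XY,\qquad X^*X-q^2XX^*=(1-q^2)(Y^2+c)\qquad(1)$$ on a complex Hilbert space $\mathcal K$ is a pair of a densely defined closed operator $X$ and a self-adjoint operator $Y$ with $\ker Y=\{0\}$ such that, products and sums being taken on their natural domains, $YX\subseteq q^2XY$ and $X^*X=q^2XX^*+(1-q^2)(Y^2+c)$. It is called well-behaved if the self-adjoint operators $Y$ and $X^*X$ strongly commute and if, for the polar decomposition $X=v|X|$, the subspace $\mathcal K^u=\bigcap_{n\ge0}v^n\mathcal K$ (the unitary part in the Wold decomposition of the isometry $v$) reduces $|X|^2=X^*X$. (i) Let $(X,Y)$ be a well-behaved representation of (1) on $\mathcal K$. Then there are a Hilbert space $\mathcal K_0$ and a self-adjoint operator $Y_0$ on $\mathcal K_0$ with $\ker Y_0=\{0\}$ such that, up to unitary equivalence, $\mathcal K=\bigoplus_{n=0}^\infty\mathcal K_n$ with $\mathcal K_n=\mathcal K_0$ for all $n$, and $$X\zeta_n=\lambda_{n+1}(q^{2n}Y_0^2+c)^{1/2}\zeta_{n+1},\qquad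 X^*\zeta_n=\lambda_n(q^{2n-2}Y_0^2+c)^{1/2}\zeta_{n-1},\qquad Y\zeta_n=q^{2n}Y_0\zeta_n,\qquad(2)$$ where $X^*\zeta_0=0$, $\zeta_n$ denotes the vector $\zeta\in\mathcal K_0$ placed in the summand $\mathcal K_n$ of $\mathcal K$, and the operators act summandwise on their maximal domains. (ii) Conversely, let $Y_0$ be a self-adjoint operator with trivial kernel on a Hilbert space $\mathcal K_0$. Then the operators $X$ and $Y$ given by (2) on $\bigoplus_{n=0}^\infty\mathcal K_0$ form a representation of (1), and the adjoint of $X$ is the operator $X^*$ given in (2). Moreover, there is a dense subspace $\mathcal D$, a core for $X$, $X^*$ and $Y$, which $X$, $X^*$ and $Y$ map into itself, which $Y$ maps bijectively onto itself, and on which $YX=q^2XY$, $YX^*=q^{-2}X^*Y$ and $X^*X-q^2XX^*=(1-q^2)(Y^2+c)$ hold; so the operators define a representation on $\mathcal D$ of the $*$-algebra $\mathcal Y_c$ with generators $X,X^*,Y=Y^*,Y^{-1}$ and these relations. -/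

import Mathlib

open scoped LinearPMap InnerProductSpace

universe u

namespace QSphere

noncomputable section

variable {H : Type u} [NormedAddCommGroup H] [InnerProductSpace ℂ H]

/-! ### Unbounded operators -/

/-- The product `S T` of unbounded operators on its natural domain
`{x ∈ D(T) : T x ∈ D(S)}`, given through its graph. -/
def opMul (S T : H →ₗ.[ℂ] H) : H →ₗ.[ℂ] H :=
  Submodule.toLinearPMap
    { carrier := {p | ∃ y, (p.1, y) ∈ T.graph ∧ (y, p.2) ∈ S.graph}
      zero_mem' := ⟨0, T.graph.zero_mem, S.graph.zero_mem⟩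
      add_mem' := by
        rintro a b ⟨y, h1, h2⟩ ⟨z, h3, h4⟩
        exact ⟨y + z, T.graph.add_mem h1 h3, S.graph.add_mem h2 h4⟩
      smul_mem' := by
        rintro k a ⟨y, h1, h2⟩
        exact ⟨k • y, T.graph.smul_mem k h1, S.graph.smul_mem k h2⟩ }

theorem mem_graph_opMul (S T : H →ₗ.[ℂ] H) (x z : H) :
    (x, z) ∈ (opMul S T).graph ↔ ∃ y, (x, y) ∈ T.graph ∧ (y, z) ∈ S.graph := by
  unfold opMul
  rw [Submodule.toLinearPMap_graph_eq]
  · rfl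
  · rintro ⟨a, b⟩ ⟨y, h1, h2⟩ (rfl : a = 0)
    have hy : y = 0 := T.graph_fst_eq_zero_snd h1 rfl
    exact S.graph_fst_eq_zero_snd h2 hy

theorem mem_domain_opMul (S T : H →ₗ.[ℂ] H) (x : H) :
    x ∈ (opMul S T).domain ↔ ∃ h : x ∈ T.domain, T ⟨x, h⟩ ∈ S.domain := by
  rw [LinearPMap.mem_domain_iff]
  constructor
  · rintro ⟨z, hz⟩
    obtain ⟨y, h1, h2⟩ := (mem_graph_opMul S T x z).1 hz
    obtain ⟨a, rfl, rfl⟩ := LinearPMap.mem_graph_iff _ |>.1 h1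
    exact ⟨a.2, LinearPMap.mem_domain_of_mem_graph h2⟩
  · rintro ⟨h, hS⟩
    exact ⟨S ⟨_, hS⟩, (mem_graph_opMul S T x _).2
      ⟨T ⟨x, h⟩, T.mem_graph ⟨x, h⟩, S.mem_graph ⟨_, hS⟩⟩⟩

theorem opMul_apply (S T : H →ₗ.[ℂ] H) (x : (opMul S T).domain) :
    ∃ (h : (x : H) ∈ T.domain) (h' : T ⟨x, h⟩ ∈ S.domain),
      opMul S T x = S ⟨T ⟨x, h⟩, h'⟩ := by
  obtain ⟨h, h'⟩ := (mem_domain_opMul S T x).1 x.2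
  refine ⟨h, h', ?_⟩
  have h1 : ((x : H), S ⟨T ⟨x, h⟩, h'⟩) ∈ (opMul S T).graph :=
    (mem_graph_opMul S T x _).2 ⟨T ⟨x, h⟩, T.mem_graph ⟨x, h⟩, S.mem_graph ⟨_, h'⟩⟩
  exact (LinearPMap.mem_graph_snd_inj _ ((opMul S T).mem_graph x) h1 rfl)

/-- The scalar operator `a I`, defined everywhere. -/
def scalarOp (H : Type u) [NormedAddCommGroup H] [InnerProductSpace ℂ H] (a : ℂ) : H →ₗ.[ℂ] H :=
  (a • (LinearMap.id : H →ₗ[ℂ] H)).toPMap ⊤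

/-- `ker A = {0}`. -/
def HasTrivialKernel (A : H →ₗ.[ℂ] H) : Prop :=
  ∀ x : A.domain, A x = 0 → (x : H) = 0

/-- `B` is a non-negative self-adjoint square root of `A`; there is exactly one if `A` is
self-adjoint and non-negative. -/
structure IsPosSqrt [CompleteSpace H] (A B : H →ₗ.[ℂ] H) : Prop where
  selfAdjoint : IsSelfAdjoint B
  nonneg : ∀ x : B.domain, 0 ≤ (⟪(x : H), B x⟫_ℂ).re
  sq : opMul B B = A

open Classical in
/-- The non-negative self-adjoint square root `A^{1/2}` of a non-negative self-adjoint operator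
(the zero operator if there is none). -/
def posSqrt [CompleteSpace H] (A : H →ₗ.[ℂ] H) : H →ₗ.[ℂ] H :=
  if h : ∃ B, IsPosSqrt A B then h.choose else 0

/-- The modulus `|X| = (X^* X)^{1/2}`. -/
def modulus [CompleteSpace H] (X : H →ₗ.[ℂ] H) : H →ₗ.[ℂ] H :=
  posSqrt (opMul X† X)

/-- `X = v |X|` is the polar decomposition of `X`: the bounded operator `v` is isometric on the
orthogonal complement of `ker X` and vanishes on `ker X`. -/
structure IsPolarDecomposition [CompleteSpace H] (X : H →ₗ.[ℂ] H) (v : H →L[ℂ] H) : Prop where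
  eq : X = (v : H →ₗ[ℂ] H).compPMap (modulus X)
  isometric : ∀ x ∈ ((LinearMap.ker X.toFun).map X.domain.subtype)ᗮ, ‖v x‖ = ‖x‖
  ker : ∀ x : X.domain, X x = 0 → v x = 0

/-- The bounded operator `R` is the resolvent `(A - z)⁻¹`. -/
def IsResolventAt (A : H →ₗ.[ℂ] H) (z : ℂ) (R : H →L[ℂ] H) : Prop :=
  (∀ y, ∃ h : R y ∈ A.domain, A ⟨R y, h⟩ - z • R y = y) ∧
    ∀ x : A.domain, R (A x - z • (x : H)) = x

/-- Strong commutativity of self-adjoint operators: their resolvents at non-real points commute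
(equivalently, their spectral projections commute). -/
def StronglyCommute (A B : H →ₗ.[ℂ] H) : Prop :=
  ∀ (z w : ℂ) (R S : H →L[ℂ] H), z.im ≠ 0 → w.im ≠ 0 →
    IsResolventAt A z R → IsResolventAt B w S → Commute R S

/-- The subspace `M` reduces `A`: `A` is the direct sum of an operator on `M` and one on `Mᗮ`. -/
def Reduces (M : Submodule ℂ H) (A : H →ₗ.[ℂ] H) : Prop :=
  ∀ x : A.domain, ∃ y z : A.domain, (x : H) = y + z ∧
    (y : H) ∈ M ∧ A y ∈ M ∧ (z : H) ∈ Mᗮ ∧ A z ∈ Mᗮ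

/-- The space `⋂ₙ vⁿ H` of the unitary part in the Wold decomposition of an isometry `v`. -/
def unitaryPart (v : H →L[ℂ] H) : Submodule ℂ H :=
  ⨅ n : ℕ, LinearMap.range ((v ^ n : H →L[ℂ] H) : H →ₗ[ℂ] H)

/-! ### The relations -/

/-- A representation by unbounded operators of the relations
`Y X = q² X Y` and `X^* X - q² X X^* = (1 - q²) (Y² + c)`.

Products and sums of operators carry their natural domains. The first relation is
`Y X ⊆ q² X Y`, the second one is the operator equality
`X^* X = q² X X^* + (1 - q²) (Y² + c)`. -/
structure IsRepresentation [CompleteSpace H] (q c : ℝ) (X Y : H →ₗ.[ℂ] H) : Prop where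
  dense : Dense (X.domain : Set H)
  closed : X.IsClosed
  selfAdjoint : IsSelfAdjoint Y
  kernel : HasTrivialKernel Y
  rel_YX : opMul Y X ≤ ((q : ℂ) ^ 2) • opMul X Y
  rel_XX : opMul X† X =
    ((q : ℂ) ^ 2) • opMul X X† + (1 - (q : ℂ) ^ 2) • (opMul Y Y + scalarOp H (c : ℂ))

/-- `Y` and `X^* X` strongly commute, and the unitary part of the isometry in the polar
decomposition of `X` reduces `|X|² = X^* X`. -/
structure IsWellBehaved [CompleteSpace H] (X Y : H →ₗ.[ℂ] H) : Prop where
  strongly_commute : StronglyCommute Y (opMul X† X)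
  reduces : ∀ v : H →L[ℂ] H, IsPolarDecomposition X v →
    Reduces (unitaryPart v) (opMul X† X)

/-- `X`, `X^*`, `Y` and `Y⁻¹` restrict to linear maps of a dense subspace `D` into itself which
satisfy all defining relations of the `*`-algebra generated by `X`, `X^*`, `Y = Y^*`, `Y⁻¹`, and
`D` is a core of `X`, `X^*` and `Y`. -/
def InducesStarRepresentation [CompleteSpace H] (q c : ℝ) (X Y : H →ₗ.[ℂ] H) : Prop :=
  ∃ (D : Submodule ℂ H) (x x' y y' : Module.End ℂ D),
    Dense (D : Set H) ∧ X.HasCore D ∧ X†.HasCore D ∧ Y.HasCore D ∧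
    (∀ d : D, ((d : H), (x d : H)) ∈ X.graph) ∧
    (∀ d : D, ((d : H), (x' d : H)) ∈ X†.graph) ∧
    (∀ d : D, ((d : H), (y d : H)) ∈ Y.graph) ∧
    y * y' = 1 ∧ y' * y = 1 ∧
    y * x = ((q : ℂ) ^ 2) • (x * y) ∧
    y * x' = ((q : ℂ) ^ 2)⁻¹ • (x' * y) ∧
    x' * x - ((q : ℂ) ^ 2) • (x * x') = (1 - (q : ℂ) ^ 2) • (y ^ 2 + (c : ℂ) • 1)

/-! ### The operators on `⨁ₙ K₀` -/

/-- The Hilbert space direct sum `⨁ₙ Kₙ` over `n = 0, 1, 2, …` with all `Kₙ` equal to `K₀`. -/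
abbrev HSum (H : Type u) [NormedAddCommGroup H] [InnerProductSpace ℂ H] : Type u :=
  lp (fun _ : ℕ => H) 2

/-- The operator `ζₙ ↦ Aₙ ζₙ` on `⨁ₙ K₀`, with its maximal domain. -/
def diagOp (A : ℕ → H →ₗ.[ℂ] H) : HSum H →ₗ.[ℂ] HSum H :=
  Submodule.toLinearPMap
    { carrier := {p | ∀ n, (p.1 n, p.2 n) ∈ (A n).graph}
      zero_mem' := fun n => (A n).graph.zero_mem
      add_mem' := fun h1 h2 n => (A n).graph.add_mem (h1 n) (h2 n)
      smul_mem' := fun k _ h n => (A n).graph.smul_mem k (h n) }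

/-- The operator which sends the vector `ζₙ` in the `n`-th summand of `⨁ₙ K₀` to the vector
`Aₙ ζₙ` in summand `n + 1`, with its maximal domain. -/
def raisingOp (A : ℕ → H →ₗ.[ℂ] H) : HSum H →ₗ.[ℂ] HSum H :=
  Submodule.toLinearPMap
    { carrier := {p | p.2 0 = 0 ∧ ∀ n, (p.1 n, p.2 (n + 1)) ∈ (A n).graph}
      zero_mem' := ⟨rfl, fun n => (A n).graph.zero_mem⟩
      add_mem' := by
        rintro a b ⟨h1, h2⟩ ⟨h3, h4⟩
        refine ⟨?_, fun n => (A n).graph.add_mem (h2 n) (h4 n)⟩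
        simp [h1, h3]
      smul_mem' := by
        rintro k a ⟨h1, h2⟩
        refine ⟨?_, fun n => (A n).graph.smul_mem k (h2 n)⟩
        simp [h1] }

/-- The operator which sends the vector `ζₙ` in the `n`-th summand of `⨁ₙ K₀` to the vector
`Aₙ₋₁ ζₙ` in summand `n - 1` if `n ≥ 1`, and to `0` if `n = 0`, with its maximal domain. -/
def loweringOp (A : ℕ → H →ₗ.[ℂ] H) : HSum H →ₗ.[ℂ] HSum H :=
  Submodule.toLinearPMap
    { carrier := {p | ∀ n, (p.1 (n + 1), p.2 n) ∈ (A n).graph}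
      zero_mem' := fun n => (A n).graph.zero_mem
      add_mem' := fun h1 h2 n => (A n).graph.add_mem (h1 n) (h2 n)
      smul_mem' := fun k _ h n => (A n).graph.smul_mem k (h n) }

theorem mem_graph_diagOp (A : ℕ → H →ₗ.[ℂ] H) (ζ η : HSum H) :
    (ζ, η) ∈ (diagOp A).graph ↔ ∀ n, (ζ n, η n) ∈ (A n).graph := by
  unfold diagOp
  rw [Submodule.toLinearPMap_graph_eq]
  · rfl
  · rintro ⟨a, b⟩ h (rfl : a = 0)
    ext n
    exact (A n).graph_fst_eq_zero_snd (h n) rfl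

theorem mem_graph_raisingOp (A : ℕ → H →ₗ.[ℂ] H) (ζ η : HSum H) :
    (ζ, η) ∈ (raisingOp A).graph ↔ η 0 = 0 ∧ ∀ n, (ζ n, η (n + 1)) ∈ (A n).graph := by
  unfold raisingOp
  rw [Submodule.toLinearPMap_graph_eq]
  · rfl
  · rintro ⟨a, b⟩ ⟨h0, h⟩ (rfl : a = 0)
    ext n
    cases n with
    | zero => exact h0
    | succ n => exact (A n).graph_fst_eq_zero_snd (h n) rfl

/-- The description of `loweringOp` needs no condition on the summand `n = 0` of `ζ`. -/
theorem mem_graph_loweringOp (A : ℕ → H →ₗ.[ℂ] H) (ζ η : HSum H) :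
    (ζ, η) ∈ (loweringOp A).graph ↔ ∀ n, (ζ (n + 1), η n) ∈ (A n).graph := by
  unfold loweringOp
  rw [Submodule.toLinearPMap_graph_eq]
  · rfl
  · rintro ⟨a, b⟩ h (rfl : a = 0)
    ext n
    exact (A n).graph_fst_eq_zero_snd (h n) rfl

/-- `λₙ = (1 - q^{2n})^{1/2}`. -/
def lam (q : ℝ) (n : ℕ) : ℝ := Real.sqrt (1 - q ^ (2 * n))

/-- The operator `λₙ₊₁ (q^{2n} Y₀² + c)^{1/2}` on `K₀`. -/
def weight [CompleteSpace H] (q c : ℝ) (Y₀ : H →ₗ.[ℂ] H) (n : ℕ) : H →ₗ.[ℂ] H :=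
  (lam q (n + 1) : ℂ) •
    posSqrt (((q : ℂ) ^ (2 * n)) • opMul Y₀ Y₀ + scalarOp H (c : ℂ))

/-- `X ζₙ = λₙ₊₁ (q^{2n} Y₀² + c)^{1/2} ζₙ₊₁`. -/
def modelX [CompleteSpace H] (q c : ℝ) (Y₀ : H →ₗ.[ℂ] H) : HSum H →ₗ.[ℂ] HSum H :=
  raisingOp (weight q c Y₀)

/-- `X^* ζₙ = λₙ (q^{2n-2} Y₀² + c)^{1/2} ζₙ₋₁`. -/
def modelXstar [CompleteSpace H] (q c : ℝ) (Y₀ : H →ₗ.[ℂ] H) : HSum H →ₗ.[ℂ] HSum H :=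
  loweringOp (weight q c Y₀)

/-- `Y ζₙ = q^{2n} Y₀ ζₙ`. -/
def modelY (q : ℝ) (Y₀ : H →ₗ.[ℂ] H) : HSum H →ₗ.[ℂ] HSum H :=
  diagOp fun n => ((q : ℂ) ^ (2 * n)) • Y₀

/-- The unitary `U` carries the operator `A` to the operator `B`, that is `U A U⁻¹ = B`. -/
def Intertwines {H₁ H₂ : Type u} [NormedAddCommGroup H₁] [InnerProductSpace ℂ H₁]
    [NormedAddCommGroup H₂] [InnerProductSpace ℂ H₂] (U : H₁ ≃ₗᵢ[ℂ] H₂)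
    (A : H₁ →ₗ.[ℂ] H₁) (B : H₂ →ₗ.[ℂ] H₂) : Prop :=
  ∀ x y, (x, y) ∈ A.graph ↔ (U x, U y) ∈ B.graph

end

end QSphere

/-!
A closed operator is studied through bounded ones: with `a = (1 + X* X)^{-1/2}` and `b = |X| a` the
graph of `X` is `{(a u, v b u)}`, where `a² + b² = 1` and `v` is the isometry of the polar
decomposition, and likewise the graph of `Y` is `{(s u, t u)}` with `s² + t² = 1`. For a
well-behaved representation `s`, `t` commute with `a`, `b`, so that `Y X ⊆ q² X Y` becomes
`v Y = q⁻² Y v`. By the second relation `X* X = q² v (X* X) v* + (1 - q²) (Y² + c)`; each iteration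
of this identity on the unitary part of `v` adds at least `(1 - q²) Y²`, so that `X* X` exceeds
every multiple of `Y²` there, and the unitary part vanishes. The Wold decomposition then identifies
the space with a direct sum of copies of the wandering subspace `ker v*`, and the same identity
determines `X* X` on the `n`-th copy by induction on `n`.

For the converse all operators are functions of `Y₀`, and the Mittag-Leffler theorem yields a common
core: if `s` has dense range, then `⋂ₙ sⁿ H` is dense.
-/

namespace QSphere

/-! ### Graphs -/

section Graph

variable {R E F : Type*} [Ring R] [AddCommGroup E] [Module R E] [AddCommGroup F] [Module R F]

theorem le_of_forall_mem_graph {A B : E →ₗ.[R] F}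
    (h : ∀ x y, (x, y) ∈ A.graph → (x, y) ∈ B.graph) : A ≤ B :=
  LinearPMap.le_of_le_graph fun p hp => h p.1 p.2 hp

theorem eq_of_forall_mem_graph_iff {A B : E →ₗ.[R] F}
    (h : ∀ x y, (x, y) ∈ A.graph ↔ (x, y) ∈ B.graph) : A = B :=
  LinearPMap.eq_of_eq_graph (Submodule.ext fun p => h p.1 p.2)

theorem eq_of_mem_graph {A : E →ₗ.[R] F} {x : E} {y z : F} (hy : (x, y) ∈ A.graph)
    (hz : (x, z) ∈ A.graph) : y = z :=
  A.mem_graph_snd_inj hy hz rfl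

theorem mem_graph_smul {M : Type*} [Monoid M] [DistribMulAction M F] [SMulCommClass R M F]
    (k : M) (A : E →ₗ.[R] F) (x : E) (z : F) :
    (x, z) ∈ (k • A).graph ↔ ∃ y, (x, y) ∈ A.graph ∧ z = k • y := by
  simp only [LinearPMap.mem_graph_iff]
  constructor
  · rintro ⟨d, rfl, rfl⟩
    exact ⟨A ⟨d, d.2⟩, ⟨⟨d, d.2⟩, rfl, rfl⟩, rfl⟩
  · rintro ⟨_, ⟨d, rfl, rfl⟩, rfl⟩
    exact ⟨⟨d, d.2⟩, rfl, rfl⟩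

theorem mem_graph_add (A B : E →ₗ.[R] F) (x : E) (z : F) :
    (x, z) ∈ (A + B).graph ↔ ∃ y y', (x, y) ∈ A.graph ∧ (x, y') ∈ B.graph ∧ z = y + y' := by
  simp only [LinearPMap.mem_graph_iff]
  constructor
  · rintro ⟨d, rfl, rfl⟩
    exact ⟨A ⟨d, d.2.1⟩, B ⟨d, d.2.2⟩, ⟨⟨d, d.2.1⟩, rfl, rfl⟩, ⟨⟨d, d.2.2⟩, rfl, rfl⟩, rfl⟩
  · rintro ⟨_, _, ⟨d, rfl, rfl⟩, ⟨⟨_, he⟩, rfl, rfl⟩, rfl⟩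
    exact ⟨⟨d, d.2, he⟩, rfl, rfl⟩

theorem mem_graph_domRestrict {A : E →ₗ.[R] F} {D : Submodule R E} {x : E} {y : F} :
    (x, y) ∈ (A.domRestrict D).graph ↔ x ∈ D ∧ (x, y) ∈ A.graph := by
  simp only [LinearPMap.mem_graph_iff]
  constructor
  · rintro ⟨d, rfl, rfl⟩
    exact ⟨d.2.1, ⟨d, d.2.2⟩, rfl, rfl⟩
  · rintro ⟨hx, d, rfl, rfl⟩
    exact ⟨⟨d, hx, d.2⟩, rfl, rfl⟩

end Graph

theorem hasCore_iff_of_isClosed {R E F : Type*} [CommRing R] [AddCommGroup E] [Module R E]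
    [AddCommGroup F] [Module R F] [TopologicalSpace E] [TopologicalSpace F] [ContinuousAdd E]
    [ContinuousAdd F] [TopologicalSpace R] [ContinuousSMul R E] [ContinuousSMul R F]
    {A : E →ₗ.[R] F} (hA : A.IsClosed) {D : Submodule R E} :
    A.HasCore D ↔ D ≤ A.domain ∧ A.graph ≤ (A.domRestrict D).graph.topologicalClosure := by
  have hle : A.domRestrict D ≤ A := LinearPMap.domRestrict_le
  have hgraph := (hA.isClosable.leIsClosable hle).graph_closure_eq_closure_graph
  constructor
  · exact fun h => ⟨h.le_domain, by rw [hgraph, h.closure_eq]⟩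
  · refine fun h => ⟨h.1, LinearPMap.eq_of_eq_graph ?_⟩
    rw [← hgraph]
    exact le_antisymm
      (Submodule.topologicalClosure_minimal _ (LinearPMap.le_graph_of_le hle) hA) h.2

section Operators

variable {H : Type u} [NormedAddCommGroup H] [InnerProductSpace ℂ H]

theorem mem_graph_scalarOp (a : ℂ) (x z : H) : (x, z) ∈ (scalarOp H a).graph ↔ z = a • x := by
  simp only [LinearPMap.mem_graph_iff]
  constructor
  · rintro ⟨d, rfl, rfl⟩
    rfl
  · rintro rfl
    exact ⟨⟨x, trivial⟩, rfl, rfl⟩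

theorem hasTrivialKernel_iff (A : H →ₗ.[ℂ] H) :
    HasTrivialKernel A ↔ ∀ x, (x, (0 : H)) ∈ A.graph → x = 0 := by
  constructor
  · intro h x hx
    obtain ⟨d, rfl, hd⟩ := (LinearPMap.mem_graph_iff _).1 hx
    exact h d hd
  · intro h x hx
    exact h x (by rw [← hx]; exact A.mem_graph x)

end Operators

section Adjoint

variable {𝕜 E F : Type*} [RCLike 𝕜] [NormedAddCommGroup E] [InnerProductSpace 𝕜 E]
  [CompleteSpace E] [NormedAddCommGroup F] [InnerProductSpace 𝕜 F]

theorem mem_graph_adjoint {A : E →ₗ.[𝕜] F} (hA : Dense (A.domain : Set E)) (y : F) (z : E) :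
    (y, z) ∈ A†.graph ↔ ∀ a b, (a, b) ∈ A.graph → ⟪b, y⟫_𝕜 = ⟪a, z⟫_𝕜 := by
  rw [LinearPMap.adjoint_graph_eq_graph_adjoint hA, Submodule.mem_adjoint_iff]
  simp only [sub_eq_zero]

theorem mem_graph_iff_of_isSelfAdjoint {A : E →ₗ.[𝕜] E} (hA : IsSelfAdjoint A) (y z : E) :
    (y, z) ∈ A.graph ↔ ∀ a b, (a, b) ∈ A.graph → ⟪b, y⟫_𝕜 = ⟪a, z⟫_𝕜 := by
  have := mem_graph_adjoint hA.dense_domain y z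
  rwa [LinearPMap.isSelfAdjoint_def.1 hA] at this

theorem isSelfAdjoint_of_forall_mem_graph_iff {A : E →ₗ.[𝕜] E} (hA : Dense (A.domain : Set E))
    (h : ∀ y z, (y, z) ∈ A.graph ↔ ∀ a b, (a, b) ∈ A.graph → ⟪b, y⟫_𝕜 = ⟪a, z⟫_𝕜) :
    IsSelfAdjoint A :=
  LinearPMap.isSelfAdjoint_def.2 <| eq_of_forall_mem_graph_iff fun y z => by
    rw [mem_graph_adjoint hA, h]

end Adjoint

/-! ### Bounded operators -/

theorem commute_apply {R M : Type*} [Semiring R] [TopologicalSpace M] [AddCommMonoid M] [Module R M]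
    {a b : M →L[R] M} (h : Commute a b) (x : M) : a (b x) = b (a x) :=
  DFunLike.congr_fun h.eq x

theorem eq_of_mul_eq_mul_of_denseRange {R M : Type*} [Semiring R] [TopologicalSpace M] [T2Space M]
    [AddCommMonoid M] [Module R M] {a b c : M →L[R] M} (hc : DenseRange c) (h : a * c = b * c) :
    a = b :=
  DFunLike.coe_injective <| hc.equalizer a.continuous b.continuous <| funext fun x =>
    DFunLike.congr_fun h x

section Bounded

variable {𝕜 H : Type*} [RCLike 𝕜] [NormedAddCommGroup H] [InnerProductSpace 𝕜 H] [CompleteSpace H]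

theorem denseRange_of_injective {a : H →L[𝕜] H} (ha : IsSelfAdjoint a)
    (hinj : Function.Injective a) : DenseRange a := by
  change Dense (a.range : Set H)
  rw [Submodule.dense_iff_topologicalClosure_eq_top, Submodule.topologicalClosure_eq_top_iff,
    ContinuousLinearMap.IsStarNormal.orthogonal_range ha.isStarNormal]
  exact LinearMap.ker_eq_bot.2 hinj

theorem inner_apply_left {a : H →L[𝕜] H} (ha : IsSelfAdjoint a) (x y : H) :
    ⟪a x, y⟫_𝕜 = ⟪x, a y⟫_𝕜 :=
  ha.isSymmetric x y

theorem norm_apply_eq_of_star_mul_self_eq {a b : H →L[𝕜] H} (h : star a * a = star b * b) (x : H) :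
    ‖a x‖ = ‖b x‖ := by
  rw [← sq_eq_sq₀ (norm_nonneg _) (norm_nonneg _), a.apply_norm_sq_eq_inner_adjoint_left,
    b.apply_norm_sq_eq_inner_adjoint_left]
  exact congrArg (fun c : H →L[𝕜] H => RCLike.re ⟪c x, x⟫_𝕜) h

/-- A simple case of Douglas' factorization lemma. -/
theorem exists_mul_eq_of_norm_le {a b : H →L[𝕜] H} (ha : DenseRange a)
    (h : ∀ x, ‖b x‖ ≤ ‖a x‖) : ∃ w : H →L[𝕜] H, w * a = b :=
  ⟨(b : H →ₗ[𝕜] H).extendOfNorm (a : H →ₗ[𝕜] H), ContinuousLinearMap.ext <|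
    LinearMap.extendOfNorm_eq (f := (b : H →ₗ[𝕜] H)) (e := (a : H →ₗ[𝕜] H)) ha
      ⟨1, fun x => by simpa using h x⟩⟩

end Bounded

section Positive

variable {H : Type*} [NormedAddCommGroup H] [InnerProductSpace ℂ H] [CompleteSpace H]
  {a b : H →L[ℂ] H}

theorem nonneg_iff_re_inner_nonneg (ha : IsSelfAdjoint a) : 0 ≤ a ↔ ∀ x, 0 ≤ (⟪x, a x⟫_ℂ).re := by
  rw [ContinuousLinearMap.nonneg_iff_isPositive, ContinuousLinearMap.isPositive_def']
  refine (and_iff_right ha).trans (forall_congr' fun x => ?_)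
  rw [a.reApplyInnerSelf_apply, ← inner_re_symm]
  rfl

theorem commute_sqrt (h : Commute a b) : Commute (CFC.sqrt a) b := by
  rw [CFC.sqrt_eq_cfc]
  exact h.cfc_nnreal _

theorem commute_of_mul_self_commute (ha : 0 ≤ a) (h : Commute (a * a) b) : Commute a b := by
  rw [← CFC.sqrt_mul_self a]
  exact commute_sqrt h

theorem eq_of_mul_self_eq_mul_self (ha : 0 ≤ a) (hb : 0 ≤ b) (h : a * a = b * b) : a = b := by
  rw [← CFC.sqrt_mul_self a, h, CFC.sqrt_mul_self b]

end Positive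

/-! ### Quotients of bounded operators -/

section Quotient

variable {𝕜 H : Type*} [RCLike 𝕜] [NormedAddCommGroup H] [InnerProductSpace 𝕜 H]
  {A B : H →ₗ.[𝕜] H} {a g r : H →L[𝕜] H}

/-- The operator `A` is the quotient `g a⁻¹` of bounded operators: its graph consists of the pairs
`(a u, g u)`. -/
def IsQuotient (A : H →ₗ.[𝕜] H) (a g : H →L[𝕜] H) : Prop :=
  ∀ x y, (x, y) ∈ A.graph ↔ ∃ u, a u = x ∧ g u = y

/-- The quotient `g a⁻¹` of bounded operators, for injective `a`. -/
noncomputable def quotient (a g : H →L[𝕜] H) : H →ₗ.[𝕜] H :=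
  (LinearMap.range ((a.prod g : H →L[𝕜] H × H) : H →ₗ[𝕜] H × H)).toLinearPMap

theorem isQuotient_quotient (ha : Function.Injective a) (g : H →L[𝕜] H) :
    IsQuotient (quotient a g) a g := by
  intro x y
  unfold quotient
  rw [Submodule.toLinearPMap_graph_eq]
  · simp [LinearMap.mem_range, Prod.ext_iff]
  · rintro ⟨x, y⟩ ⟨u, hu⟩ (rfl : x = 0)
    have hau : a u = 0 := congrArg Prod.fst hu
    have hgu : g u = y := congrArg Prod.snd hu
    rw [← hgu, (map_eq_zero_iff a ha).1 hau, map_zero]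

namespace IsQuotient

theorem mem_graph (h : IsQuotient A a g) (u : H) : (a u, g u) ∈ A.graph :=
  (h _ _).2 ⟨u, rfl, rfl⟩

theorem eq (hA : IsQuotient A a g) (hB : IsQuotient B a g) : A = B :=
  eq_of_forall_mem_graph_iff fun x y => by rw [hA, hB]

theorem smul (h : IsQuotient A a g) (k : 𝕜) : IsQuotient (k • A) a (k • g) := by
  intro x z
  rw [mem_graph_smul]
  constructor
  · rintro ⟨y, hy, rfl⟩
    obtain ⟨u, rfl, rfl⟩ := (h _ _).1 hy
    exact ⟨u, rfl, rfl⟩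
  · rintro ⟨u, rfl, rfl⟩
    exact ⟨_, h.mem_graph u, rfl⟩

theorem dense_domain (h : IsQuotient A a g) (ha : DenseRange a) : Dense (A.domain : Set H) :=
  ha.mono (by rintro _ ⟨u, rfl⟩; exact LinearPMap.mem_domain_of_mem_graph (h.mem_graph u))

theorem map_mem_graph (h : IsQuotient A a g) (ha : Commute r a) (hg : Commute r g) {x y : H}
    (hxy : (x, y) ∈ A.graph) : (r x, r y) ∈ A.graph := by
  obtain ⟨u, rfl, rfl⟩ := (h _ _).1 hxy
  rw [commute_apply ha, commute_apply hg]
  exact h.mem_graph (r u)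

theorem hasCore (h : IsQuotient A a g) (hA : A.IsClosed) {D : Submodule 𝕜 H}
    (hD : Dense (D : Set H)) (hmap : D.map (a : H →ₗ[𝕜] H) = D) : A.HasCore D := by
  refine (hasCore_iff_of_isClosed hA).2 ⟨fun x hx => ?_, fun p hp => ?_⟩
  · obtain ⟨u, -, rfl⟩ := hmap.ge hx
    exact LinearPMap.mem_domain_of_mem_graph (h.mem_graph u)
  · obtain ⟨u, hau, hgu⟩ := (h _ _).1 hp
    obtain rfl : (a u, g u) = p := Prod.ext hau hgu
    refine map_mem_closure (f := fun u => (a u, g u)) (by fun_prop) (hD u) fun d hd => ?_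
    exact mem_graph_domRestrict.2 ⟨hmap.le ⟨d, hd, rfl⟩, h.mem_graph d⟩

theorem eq_of_add_eq_one {a' g' : H →L[𝕜] H} (h : IsQuotient A a g) (h' : IsQuotient A a' g')
    (hadd : a + g = 1) (hadd' : a' + g' = 1) : a = a' ∧ g = g' := by
  have key : ∀ u, a u = a' u ∧ g u = g' u := fun u => by
    obtain ⟨t, hat, hgt⟩ := (h' _ _).1 (h.mem_graph u)
    have htu : t = u :=
      calc t = a' t + g' t := (DFunLike.congr_fun hadd' t).symm
        _ = a u + g u := by rw [hat, hgt]
        _ = u := DFunLike.congr_fun hadd u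
    subst htu
    exact ⟨hat.symm, hgt.symm⟩
  exact ⟨ContinuousLinearMap.ext fun u => (key u).1, ContinuousLinearMap.ext fun u => (key u).2⟩

end IsQuotient

/-- A commuting pair of bounded self-adjoint operators, `a` injective, for which `g a⁻¹` is equal to
`a⁻¹ g`, that is `a u = x`, `g u = y` is solvable whenever `g x = a y`; this makes the quotient
self-adjoint. -/
structure IsQuotientPair [CompleteSpace H] (a g : H →L[𝕜] H) : Prop where
  left : IsSelfAdjoint a
  right : IsSelfAdjoint g
  commute : Commute a g
  injective : Function.Injective a
  exists_of_eq : ∀ {x y}, g x = a y → ∃ u, a u = x ∧ g u = y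

namespace IsQuotientPair

variable [CompleteSpace H]

theorem of_isUnit (ha : IsSelfAdjoint a) (hg : IsSelfAdjoint g) (hag : Commute a g)
    (hinj : Function.Injective a) (hunit : IsUnit (a * a + g * g)) : IsQuotientPair a g := by
  refine ⟨ha, hg, hag, hinj, fun {x y} hxy => ?_⟩
  obtain ⟨k, hk⟩ := hunit
  have hka : Commute (k : H →L[𝕜] H) a := by
    rw [hk]
    exact ((Commute.refl a).mul_left (Commute.refl a)).add_left (hag.symm.mul_left hag.symm)
  have hkg : Commute (k : H →L[𝕜] H) g := by
    rw [hk]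
    exact (hag.mul_left hag).add_left ((Commute.refl g).mul_left (Commute.refl g))
  have hcancel : ∀ z, (↑k⁻¹ : H →L[𝕜] H) (a (a z) + g (g z)) = z := fun z =>
    DFunLike.congr_fun (show (↑k⁻¹ : H →L[𝕜] H) * (a * a + g * g) = 1 by rw [← hk, k.inv_mul]) z
  refine ⟨(↑k⁻¹ : H →L[𝕜] H) (a x + g y), ?_, ?_⟩
  · rw [← commute_apply hka.units_inv_left, map_add, commute_apply hag, ← hxy, hcancel]
  · rw [← commute_apply hkg.units_inv_left, map_add, ← commute_apply hag, hxy, hcancel]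

theorem of_sq_add_sq (ha : IsSelfAdjoint a) (hg : IsSelfAdjoint g) (hag : Commute a g)
    (hinj : Function.Injective a) (h : a * a + g * g = 1) : IsQuotientPair a g :=
  .of_isUnit ha hg hag hinj (h ▸ isUnit_one)

theorem of_add_eq_one (ha : IsSelfAdjoint a) (hinj : Function.Injective a) (h : a + g = 1) :
    IsQuotientPair a g := by
  obtain rfl : g = 1 - a := eq_sub_of_add_eq' h
  refine ⟨ha, (IsSelfAdjoint.one _).sub ha, (Commute.one_right a).sub_right (Commute.refl a), hinj,
    fun {x y} hxy => ⟨x + y, ?_, ?_⟩⟩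
  · rw [map_add, ← hxy]
    exact DFunLike.congr_fun h x
  · rw [map_add, hxy]
    exact DFunLike.congr_fun h y

end IsQuotientPair

variable [CompleteSpace H]

theorem IsQuotient.mem_graph_iff (h : IsQuotient A a g) (hp : IsQuotientPair a g) (x y : H) :
    (x, y) ∈ A.graph ↔ g x = a y := by
  rw [h]
  refine ⟨?_, hp.exists_of_eq⟩
  rintro ⟨u, rfl, rfl⟩
  exact (commute_apply hp.commute u).symm

theorem IsQuotient.mem_graph_adjoint_iff (h : IsQuotient A a g) (ha : DenseRange a) (y z : H) :
    (y, z) ∈ A†.graph ↔ star g y = star a z := by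
  rw [mem_graph_adjoint (h.dense_domain ha)]
  simp only [ContinuousLinearMap.star_eq_adjoint]
  constructor
  · refine fun hyz => ext_inner_left 𝕜 fun u => ?_
    rw [ContinuousLinearMap.adjoint_inner_right, ContinuousLinearMap.adjoint_inner_right]
    exact hyz _ _ (h.mem_graph u)
  · intro hyz x m hxm
    obtain ⟨u, rfl, rfl⟩ := (h _ _).1 hxm
    rw [← ContinuousLinearMap.adjoint_inner_right, hyz, ContinuousLinearMap.adjoint_inner_right]

theorem IsQuotient.isSelfAdjoint (h : IsQuotient A a g) (hp : IsQuotientPair a g) :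
    IsSelfAdjoint A :=
  LinearPMap.isSelfAdjoint_def.2 <| eq_of_forall_mem_graph_iff fun y z => by
    rw [h.mem_graph_adjoint_iff (denseRange_of_injective hp.left hp.injective), hp.left.star_eq,
      hp.right.star_eq, h.mem_graph_iff hp]

end Quotient

section ProductsOfQuotients

variable {H : Type u} [NormedAddCommGroup H] [InnerProductSpace ℂ H] {A B : H →ₗ.[ℂ] H}
  {a g g' : H →L[ℂ] H}

theorem IsQuotient.add_scalarOp (h : IsQuotient A a g) (k : ℂ) :
    IsQuotient (A + scalarOp H k) a (g + k • a) := by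
  intro x z
  rw [mem_graph_add]
  constructor
  · rintro ⟨y, y', hy, hy', rfl⟩
    obtain ⟨u, rfl, rfl⟩ := (h _ _).1 hy
    rw [(mem_graph_scalarOp _ _ _).1 hy']
    exact ⟨u, rfl, rfl⟩
  · rintro ⟨u, rfl, rfl⟩
    exact ⟨_, _, h.mem_graph u, (mem_graph_scalarOp _ _ _).2 rfl, rfl⟩

variable [CompleteSpace H]

theorem IsQuotient.opMul (hA : IsQuotient A a g) (hB : IsQuotient B a g')
    (hp : IsQuotientPair a g) : IsQuotient (opMul B A) (a * a) (g' * g) := by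
  intro x y
  rw [mem_graph_opMul]
  constructor
  · rintro ⟨m, hxm, hmy⟩
    obtain ⟨u, rfl, rfl⟩ := (hA _ _).1 hxm
    obtain ⟨u', hu', rfl⟩ := (hB _ _).1 hmy
    obtain ⟨p, rfl, rfl⟩ := hp.exists_of_eq hu'.symm
    exact ⟨p, rfl, rfl⟩
  · rintro ⟨u, rfl, rfl⟩
    refine ⟨g (a u), hA.mem_graph (a u), ?_⟩
    rw [← commute_apply hp.commute]
    exact hB.mem_graph (g u)

theorem IsQuotient.re_inner_nonneg (h : IsQuotient A a g) (ha : 0 ≤ a) (hg : 0 ≤ g)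
    (hag : Commute a g) (x : A.domain) : 0 ≤ (⟪(x : H), A x⟫_ℂ).re := by
  obtain ⟨u, hau, hgu⟩ := (h _ _).1 (A.mem_graph x)
  have hmul : 0 ≤ a * g := hag.mul_nonneg ha hg
  rw [← hau, ← hgu, inner_apply_left (.of_nonneg ha)]
  exact (nonneg_iff_re_inner_nonneg (.of_nonneg hmul)).1 hmul u

theorem IsQuotient.isPosSqrt (h : IsQuotient B a g) (hp : IsQuotientPair a g) (ha : 0 ≤ a)
    (hg : 0 ≤ g) (hA : IsQuotient A (a * a) (g * g)) : IsPosSqrt A B :=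
  ⟨h.isSelfAdjoint hp, h.re_inner_nonneg ha hg hp.commute, (h.opMul h hp).eq hA⟩

end ProductsOfQuotients

/-! ### The bounded transform -/

section BoundedTransform

variable {H : Type u} [NormedAddCommGroup H] [InnerProductSpace ℂ H] [CompleteSpace H]
  {X : H →ₗ.[ℂ] H} {T S a w : H →L[ℂ] H}

/-- The pair `T = (1 + X* X)⁻¹`, `S = X T` of von Neumann's theorem, described through the graphs of
`X` and `X*`. -/
structure IsResolventPair (X : H →ₗ.[ℂ] H) (T S : H →L[ℂ] H) : Prop where
  mem_graph : ∀ u, (T u, S u) ∈ X.graph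
  adjoint_mem_graph : ∀ u, (S u, u - T u) ∈ X†.graph

/-- `(T u, S u)` is the orthogonal projection of `(u, 0)` onto the graph of `X`. -/
theorem exists_isResolventPair (hd : Dense (X.domain : Set H)) (hX : X.IsClosed) :
    ∃ T S : H →L[ℂ] H, IsResolventPair X T S := by
  let e := WithLp.prodContinuousLinearEquiv 2 ℂ H H
  let G : Submodule ℂ (WithLp 2 (H × H)) := X.graph.comap (e : WithLp 2 (H × H) →ₗ[ℂ] H × H)
  have hG : IsClosed (G : Set (WithLp 2 (H × H))) := hX.preimage e.continuous
  have : CompleteSpace G := hG.completeSpace_coe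
  let P : H →L[ℂ] H × H := (e : WithLp 2 (H × H) →L[ℂ] H × H) ∘L G.starProjection ∘L
    (e.symm : H × H →L[ℂ] WithLp 2 (H × H)) ∘L ContinuousLinearMap.inl ℂ H H
  refine ⟨ContinuousLinearMap.fst ℂ H H ∘L P, ContinuousLinearMap.snd ℂ H H ∘L P,
    fun u => Submodule.starProjection_apply_mem G _, fun u => ?_⟩
  refine (mem_graph_adjoint hd _ _).2 fun x y hxy => ?_
  have horth : ⟪x, u - (P u).1⟫_ℂ + ⟪y, 0 - (P u).2⟫_ℂ = 0 := by
    have hxyG : e.symm (x, y) ∈ G := by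
      change e (e.symm (x, y)) ∈ X.graph
      rwa [e.apply_symm_apply]
    exact (WithLp.prod_inner_apply _ _).symm.trans <| (Submodule.mem_orthogonal _ _).1
      (Submodule.sub_starProjection_mem_orthogonal (K := G) (e.symm (u, 0))) _ hxyG
  rw [zero_sub, inner_neg_right] at horth
  exact (add_neg_eq_zero.1 horth).symm

namespace IsResolventPair

theorem inner_eq (h : IsResolventPair X T S) (hd : Dense (X.domain : Set H)) {x y : H}
    (hxy : (x, y) ∈ X.graph) (u : H) : ⟪y, S u⟫_ℂ = ⟪x, u⟫_ℂ - ⟪x, T u⟫_ℂ := by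
  rw [(mem_graph_adjoint hd _ _).1 (h.adjoint_mem_graph u) x y hxy, inner_sub_right]

theorem star_mul_self_add (h : IsResolventPair X T S) (hd : Dense (X.domain : Set H)) :
    star T * T + star S * S = star T := by
  refine ContinuousLinearMap.ext fun u => ext_inner_left ℂ fun v => ?_
  simp only [ContinuousLinearMap.star_eq_adjoint, add_apply, mul_apply_eq_comp, inner_add_right,
    ContinuousLinearMap.adjoint_inner_right, h.inner_eq hd (h.mem_graph v), add_sub_cancel]

theorem nonneg (h : IsResolventPair X T S) (hd : Dense (X.domain : Set H)) : 0 ≤ T := by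
  have hstar : 0 ≤ star T := by
    rw [← h.star_mul_self_add hd]
    exact add_nonneg (star_mul_self_nonneg _) (star_mul_self_nonneg _)
  have hself : IsSelfAdjoint (star T) := .of_nonneg hstar
  rwa [← hself.star_eq, star_star] at hstar

theorem star_mul_self (h : IsResolventPair X T S) (hd : Dense (X.domain : Set H)) :
    star S * S = T * (1 - T) := by
  have hadd := h.star_mul_self_add hd
  rw [(IsSelfAdjoint.of_nonneg (h.nonneg hd)).star_eq] at hadd
  rw [mul_sub, mul_one, eq_sub_iff_add_eq', hadd]

theorem injective (h : IsResolventPair X T S) : Function.Injective T := by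
  refine (injective_iff_map_eq_zero T).2 fun u hu => ?_
  have hS : S u = 0 := eq_of_mem_graph (hu ▸ h.mem_graph u) X.graph.zero_mem
  have hadj := h.adjoint_mem_graph u
  rw [hu, hS, sub_zero] at hadj
  exact eq_of_mem_graph hadj X†.graph.zero_mem

end IsResolventPair

/-- The operators `a = (1 + X* X)^{-1/2}` and `w = X a` attached to a closed operator `X`; the
latter is the bounded transform of `X`. -/
structure IsBoundedTransform (X : H →ₗ.[ℂ] H) (a w : H →L[ℂ] H) : Prop where
  nonneg : 0 ≤ a
  injective : Function.Injective a
  sq_add : a * a + star w * w = 1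
  isQuotient : IsQuotient X a w

theorem IsResolventPair.exists_factor (h : IsResolventPair X (a * a) S)
    (hd : Dense (X.domain : Set H)) (ha : 0 ≤ a) (hinj : Function.Injective a) :
    ∃ w : H →L[ℂ] H, w * a = S ∧ a * a + star w * w = 1 := by
  have has : IsSelfAdjoint a := .of_nonneg ha
  have hda : DenseRange a := denseRange_of_injective has hinj
  have hnorm : ∀ u, ‖S u‖ ≤ ‖a u‖ := fun u => by
    have hsq := congrArg RCLike.re (h.inner_eq hd (h.mem_graph u) u)
    rw [map_sub, inner_self_eq_norm_sq, inner_self_eq_norm_sq, mul_apply_eq_comp,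
      inner_apply_left has (a u) u, inner_self_eq_norm_sq] at hsq
    exact (sq_le_sq₀ (norm_nonneg _) (norm_nonneg _)).1 (hsq ▸ sub_le_self _ (sq_nonneg _))
  obtain ⟨w, rfl⟩ := exists_mul_eq_of_norm_le hda hnorm
  refine ⟨w, rfl, ?_⟩
  have hmul : a * (star w * w) = a * (1 - a * a) := by
    refine eq_of_mul_eq_mul_of_denseRange hda ?_
    have hSS := h.star_mul_self hd
    rw [star_mul, has.star_eq] at hSS
    simpa only [mul_assoc, mul_sub, sub_mul, mul_one, one_mul] using hSS
  rw [← eq_sub_iff_add_eq']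
  exact ContinuousLinearMap.ext fun x => hinj (DFunLike.congr_fun hmul x)

theorem IsResolventPair.eq_zero_of_mem_graph (h : IsResolventPair X (a * a) (w * a))
    (hd : Dense (X.domain : Set H)) (ha : IsSelfAdjoint a) {x y : H} (hxy : (x, y) ∈ X.graph)
    (horth : a x + star w y = 0) : x = 0 := by
  refine ext_inner_right ℂ fun u => ?_
  have hwy : ⟪y, w (a u)⟫_ℂ = -⟪x, a (a u)⟫_ℂ := by
    rw [← ContinuousLinearMap.adjoint_inner_left, ← ContinuousLinearMap.star_eq_adjoint,
      eq_neg_of_add_eq_zero_right horth, inner_neg_left, inner_apply_left ha]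
  have hinner := h.inner_eq hd hxy u
  rw [mul_apply_eq_comp, hwy, mul_apply_eq_comp] at hinner
  rw [inner_zero_left]
  linear_combination -hinner

theorem exists_isBoundedTransform (hd : Dense (X.domain : Set H)) (hX : X.IsClosed) :
    ∃ a w : H →L[ℂ] H, IsBoundedTransform X a w := by
  obtain ⟨T, S, h⟩ := exists_isResolventPair hd hX
  obtain ⟨a, ha, rfl⟩ : ∃ a : H →L[ℂ] H, 0 ≤ a ∧ a * a = T :=
    ⟨_, CFC.sqrt_nonneg T, CFC.sqrt_mul_sqrt_self T (h.nonneg hd)⟩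
  have hinj : Function.Injective a := .of_comp (f := a) h.injective
  obtain ⟨w, rfl, hone⟩ := h.exists_factor hd ha hinj
  have hmem : ∀ u, (a u, w u) ∈ X.graph := fun u =>
    (denseRange_of_injective (.of_nonneg ha) hinj).induction_on
      (p := fun u => (a u, w u) ∈ X.graph) u
      (hX.preimage (by fun_prop : Continuous fun u => (a u, w u))) h.mem_graph
  refine ⟨a, w, ha, hinj, hone, fun x y => ⟨fun hxy => ?_, ?_⟩⟩
  · set u := a x + star w y
    have hsub := X.graph.sub_mem hxy (hmem u)
    have horth : a (x - a u) + star w (y - w u) = 0 := by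
      have : a (a u) + star w (w u) = u := DFunLike.congr_fun hone u
      rw [map_sub, map_sub, sub_add_sub_comm, this, sub_self]
    have hx : x - a u = 0 := h.eq_zero_of_mem_graph hd (.of_nonneg ha) hsub horth
    have hy : y - w u = 0 := X.graph_fst_eq_zero_snd hsub hx
    exact ⟨u, (sub_eq_zero.1 hx).symm, (sub_eq_zero.1 hy).symm⟩
  · rintro ⟨u, rfl, rfl⟩
    exact hmem u

namespace IsBoundedTransform

theorem isSelfAdjoint (h : IsBoundedTransform X a w) : IsSelfAdjoint a :=
  .of_nonneg h.nonneg

theorem denseRange (h : IsBoundedTransform X a w) : DenseRange a :=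
  denseRange_of_injective h.isSelfAdjoint h.injective

theorem isQuotient_adjoint_mul_self (h : IsBoundedTransform X a w) :
    IsQuotient (QSphere.opMul X† X) (a * a) (star w * w) := by
  have hadj := h.isQuotient.mem_graph_adjoint_iff h.denseRange
  have hone : ∀ u, a (a u) + star w (w u) = u := fun u => DFunLike.congr_fun h.sq_add u
  intro x z
  rw [mem_graph_opMul]
  constructor
  · rintro ⟨y, hxy, hyz⟩
    obtain ⟨u, rfl, rfl⟩ := (h.isQuotient _ _).1 hxy
    have hwu : star w (w u) = a z := by rw [(hadj _ _).1 hyz, h.isSelfAdjoint.star_eq]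
    have hu : a (a u + z) = u := by rw [map_add, ← hwu, hone]
    refine ⟨a u + z, congrArg a hu, ?_⟩
    have hone' := hone (a u + z)
    rw [hu] at hone'
    exact add_left_cancel hone'
  · rintro ⟨u, rfl, rfl⟩
    refine ⟨w (a u), h.isQuotient.mem_graph _, (hadj _ _).2 ?_⟩
    have h1 := hone (a u)
    have h2 := congrArg a (hone u)
    rw [h.isSelfAdjoint.star_eq]
    rw [map_add] at h2
    exact add_left_cancel (h1.trans h2.symm)

end IsBoundedTransform

end BoundedTransform

section SelfAdjoint

variable {H : Type u} [NormedAddCommGroup H] [InnerProductSpace ℂ H] [CompleteSpace H]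
  {Y : H →ₗ.[ℂ] H} {a w : H →L[ℂ] H}

namespace IsBoundedTransform

theorem star_mul_eq_mul (h : IsBoundedTransform Y a w) (hY : IsSelfAdjoint Y) :
    star w * a = a * w := by
  refine ContinuousLinearMap.ext fun u => ?_
  have hadj : (a u, w u) ∈ Y†.graph := by
    rw [LinearPMap.isSelfAdjoint_def.1 hY]
    exact h.isQuotient.mem_graph u
  rw [h.isQuotient.mem_graph_adjoint_iff h.denseRange, h.isSelfAdjoint.star_eq] at hadj
  exact hadj

/-- The operators `1 - a² - w w*` and `a w* - w a` are shown to be of the form `a p`, `w p` with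
`p = 0`. -/
theorem mul_star_eq_mul (h : IsBoundedTransform Y a w) (hY : IsSelfAdjoint Y) :
    a * star w = w * a := by
  have hww : star w * w = 1 - a * a := eq_sub_of_add_eq' h.sq_add
  have hsa := h.star_mul_eq_mul hY
  have hadj : star w * (1 - a * a - w * star w) = a * (a * star w - w * a) :=
    calc star w * (1 - a * a - w * star w)
        = star w - star w * a * a - star w * w * star w := by noncomm_ring
      _ = a * (a * star w - w * a) := by rw [hsa, hww]; noncomm_ring
  have hzero : a * (1 - a * a - w * star w) + star w * (a * star w - w * a) = 0 :=
    calc a * (1 - a * a - w * star w) + star w * (a * star w - w * a)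
        = a - a * a * a - a * w * star w + star w * a * star w - star w * w * a := by
          noncomm_ring
      _ = 0 := by rw [hsa, hww]; noncomm_ring
  rw [← sub_eq_zero]
  refine ContinuousLinearMap.ext fun x => ?_
  have hmem : ((1 - a * a - w * star w) x, (a * star w - w * a) x) ∈ Y.graph := by
    rw [← LinearPMap.isSelfAdjoint_def.1 hY, h.isQuotient.mem_graph_adjoint_iff h.denseRange,
      h.isSelfAdjoint.star_eq]
    exact DFunLike.congr_fun hadj x
  obtain ⟨p, hap, hwp⟩ := (h.isQuotient _ _).1 hmem
  have hp : p = 0 :=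
    calc p = a (a p) + star w (w p) := (DFunLike.congr_fun h.sq_add p).symm
      _ = 0 := by rw [hap, hwp]; exact DFunLike.congr_fun hzero x
  rw [← hwp, hp, map_zero, zero_apply]

theorem isQuotientPair (h : IsBoundedTransform Y a w) (hY : IsSelfAdjoint Y) :
    IsQuotientPair a w := by
  have hsa := h.star_mul_eq_mul hY
  have has := h.mul_star_eq_mul hY
  have haw : Commute a w := commute_of_mul_self_commute h.nonneg <|
    show a * a * w = w * (a * a) by rw [mul_assoc, ← hsa, ← mul_assoc, has, mul_assoc]
  have hw : IsSelfAdjoint w :=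
    eq_of_mul_eq_mul_of_denseRange h.denseRange (hsa.trans haw.eq)
  refine .of_sq_add_sq h.isSelfAdjoint hw haw h.injective ?_
  have := h.sq_add
  rwa [hw.star_eq] at this

end IsBoundedTransform

theorem exists_isBoundedTransform_of_isSelfAdjoint (hY : IsSelfAdjoint Y) :
    ∃ a w : H →L[ℂ] H, IsBoundedTransform Y a w ∧ IsQuotientPair a w := by
  obtain ⟨a, w, h⟩ := exists_isBoundedTransform hY.dense_domain hY.isClosed
  exact ⟨a, w, h, h.isQuotientPair hY⟩

end SelfAdjoint

/-! ### Square roots and polar decompositions -/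

section SquareRoot

variable {H : Type u} [NormedAddCommGroup H] [InnerProductSpace ℂ H] [CompleteSpace H]
  {A B X : H →ₗ.[ℂ] H} {a b v w : H →L[ℂ] H}

/-- The bounded operators `a = (1 + P²)^{-1/2}` and `b = P (1 + P²)^{-1/2}` of a non-negative
self-adjoint operator `P = b a⁻¹`. -/
structure IsModulusPair (a b : H →L[ℂ] H) : Prop where
  nonneg_left : 0 ≤ a
  nonneg_right : 0 ≤ b
  commute : Commute a b
  sq_add_sq : a * a + b * b = 1
  injective : Function.Injective a

namespace IsModulusPair

theorem isSelfAdjoint_left (h : IsModulusPair a b) : IsSelfAdjoint a := .of_nonneg h.nonneg_left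

theorem isSelfAdjoint_right (h : IsModulusPair a b) : IsSelfAdjoint b := .of_nonneg h.nonneg_right

theorem denseRange (h : IsModulusPair a b) : DenseRange a :=
  denseRange_of_injective h.isSelfAdjoint_left h.injective

theorem isQuotientPair (h : IsModulusPair a b) : IsQuotientPair a b :=
  .of_sq_add_sq h.isSelfAdjoint_left h.isSelfAdjoint_right h.commute h.injective h.sq_add_sq

theorem isPosSqrt (h : IsModulusPair a b) (hB : IsQuotient B a b)
    (hA : IsQuotient A (a * a) (b * b)) : IsPosSqrt A B :=
  hB.isPosSqrt h.isQuotientPair h.nonneg_left h.nonneg_right hA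

end IsModulusPair

theorem IsPosSqrt.re_inner_nonneg (h : IsPosSqrt A B) {x y : H} (hxy : (x, y) ∈ B.graph) :
    0 ≤ (⟪x, y⟫_ℂ).re := by
  obtain ⟨d, rfl, rfl⟩ := (LinearPMap.mem_graph_iff _).1 hxy
  exact h.nonneg d

theorem IsPosSqrt.exists_isModulusPair (h : IsPosSqrt A B) :
    ∃ a b : H →L[ℂ] H, IsModulusPair a b ∧ IsQuotient B a b := by
  obtain ⟨a, g, hB, hp⟩ := exists_isBoundedTransform_of_isSelfAdjoint h.selfAdjoint
  refine ⟨a, g, ⟨hB.nonneg, ?_, hp.commute, ?_, hp.injective⟩, hB.isQuotient⟩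
  · obtain ⟨r, hr, rfl⟩ : ∃ r : H →L[ℂ] H, 0 ≤ r ∧ r * r = a :=
      ⟨_, CFC.sqrt_nonneg a, CFC.sqrt_mul_sqrt_self a hB.nonneg⟩
    have hrs : IsSelfAdjoint r := .of_nonneg hr
    have hrg : Commute r g := commute_of_mul_self_commute hr hp.commute
    refine (nonneg_iff_re_inner_nonneg hp.right).2 fun x =>
      (denseRange_of_injective hrs (.of_comp (f := r) hp.injective)).induction_on
        (p := fun x => 0 ≤ (⟪x, g x⟫_ℂ).re) x ?_ fun u => ?_
    · exact isClosed_le continuous_const (Complex.continuous_re.comp (by fun_prop))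
    · rw [← commute_apply hrg, ← inner_apply_left hrs]
      exact h.re_inner_nonneg (hB.isQuotient.mem_graph u)
  · have := hB.sq_add
    rwa [hp.right.star_eq] at this

theorem IsPosSqrt.isQuotient (h : IsPosSqrt A B) (hab : IsModulusPair a b)
    (hB : IsQuotient B a b) : IsQuotient A (a * a) (b * b) := by
  rw [← h.sq]
  exact hB.opMul hB hab.isQuotientPair

theorem IsPosSqrt.isSelfAdjoint (h : IsPosSqrt A B) : IsSelfAdjoint A := by
  obtain ⟨a, b, hab, hB⟩ := h.exists_isModulusPair
  have ha := hab.isSelfAdjoint_left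
  exact (h.isQuotient hab hB).isSelfAdjoint <| .of_add_eq_one
    ((ha.commute_iff ha).1 (Commute.refl a)) (hab.injective.comp hab.injective) hab.sq_add_sq

/-- The operators `a = (1 + X* X)^{-1/2}` and `b = |X| a`, and the isometry `v` of the polar
decomposition `X = v |X|`, of an injective operator `X`. -/
structure IsPolarTransform (X : H →ₗ.[ℂ] H) (a b v : H →L[ℂ] H) : Prop
    extends IsModulusPair a b where
  injective_right : Function.Injective b
  isometry : star v * v = 1
  isQuotient : IsQuotient X a (v * b)

theorem IsBoundedTransform.exists_isPolarTransform (h : IsBoundedTransform X a w)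
    (hw : Function.Injective w) : ∃ b v : H →L[ℂ] H, IsPolarTransform X a b v := by
  obtain ⟨b, hb, hbb⟩ : ∃ b : H →L[ℂ] H, 0 ≤ b ∧ b * b = star w * w :=
    ⟨_, CFC.sqrt_nonneg _, CFC.sqrt_mul_sqrt_self _ (star_mul_self_nonneg w)⟩
  have hbs : IsSelfAdjoint b := .of_nonneg hb
  have hnorm : ∀ x, ‖w x‖ = ‖b x‖ :=
    norm_apply_eq_of_star_mul_self_eq (by rw [hbs.star_eq, hbb])
  have hinj : Function.Injective b := (injective_iff_map_eq_zero b).2 fun x hx => by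
    rwa [← norm_eq_zero, ← hnorm, norm_eq_zero, map_eq_zero_iff w hw] at hx
  have hdense : DenseRange b := denseRange_of_injective hbs hinj
  obtain ⟨v, rfl⟩ := exists_mul_eq_of_norm_le hdense fun x => (hnorm x).le
  have hba : Commute a b := by
    refine (commute_of_mul_self_commute hb ?_).symm
    rw [hbb, eq_sub_of_add_eq' h.sq_add]
    exact (Commute.one_left a).sub_left ((Commute.refl a).mul_left (Commute.refl a))
  refine ⟨b, v, ⟨h.nonneg, hb, hba, by rw [hbb]; exact h.sq_add, h.injective⟩, hinj, ?_,
    h.isQuotient⟩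
  refine (ContinuousLinearMap.norm_map_iff_adjoint_comp_self v).1 fun x => ?_
  exact hdense.induction_on (p := fun x => ‖v x‖ = ‖x‖) x
    (isClosed_eq (by fun_prop) (by fun_prop)) hnorm

theorem exists_isPolarTransform (hd : Dense (X.domain : Set H)) (hX : X.IsClosed)
    (hker : HasTrivialKernel X) : ∃ a b v : H →L[ℂ] H, IsPolarTransform X a b v := by
  obtain ⟨a, w, h⟩ := exists_isBoundedTransform hd hX
  refine ⟨a, h.exists_isPolarTransform <| (injective_iff_map_eq_zero w).2 fun x hx => ?_⟩
  have hax := (hasTrivialKernel_iff X).1 hker (a x) (hx ▸ h.isQuotient.mem_graph x)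
  rwa [map_eq_zero_iff a h.injective] at hax

theorem IsPosSqrt.unique {B' : H →ₗ.[ℂ] H} (h : IsPosSqrt A B) (h' : IsPosSqrt A B') :
    B = B' := by
  obtain ⟨a, b, hab, hB⟩ := h.exists_isModulusPair
  obtain ⟨a', b', hab', hB'⟩ := h'.exists_isModulusPair
  obtain ⟨haa, hbb⟩ := (h.isQuotient hab hB).eq_of_add_eq_one (h'.isQuotient hab' hB')
    hab.sq_add_sq hab'.sq_add_sq
  obtain rfl := eq_of_mul_self_eq_mul_self hab.nonneg_left hab'.nonneg_left haa
  obtain rfl := eq_of_mul_self_eq_mul_self hab.nonneg_right hab'.nonneg_right hbb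
  exact hB.eq hB'

theorem IsPosSqrt.posSqrt_eq (h : IsPosSqrt A B) : posSqrt A = B := by
  have hex : ∃ B, IsPosSqrt A B := ⟨B, h⟩
  unfold posSqrt
  rw [dif_pos hex]
  exact hex.choose_spec.unique h

namespace IsPolarTransform

theorem isSelfAdjoint_left (h : IsPolarTransform X a b v) : IsSelfAdjoint a :=
  h.toIsModulusPair.isSelfAdjoint_left

theorem isSelfAdjoint_right (h : IsPolarTransform X a b v) : IsSelfAdjoint b :=
  h.toIsModulusPair.isSelfAdjoint_right

theorem isQuotientPair (h : IsPolarTransform X a b v) : IsQuotientPair a b :=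
  h.toIsModulusPair.isQuotientPair

theorem star_apply_apply (h : IsPolarTransform X a b v) (x : H) : star v (v x) = x :=
  DFunLike.congr_fun h.isometry x

theorem norm_apply (h : IsPolarTransform X a b v) (x : H) : ‖v x‖ = ‖x‖ :=
  (ContinuousLinearMap.norm_map_iff_adjoint_comp_self v).2 h.isometry x

theorem mem_graph_adjoint_iff (h : IsPolarTransform X a b v) (y z : H) :
    (y, z) ∈ X†.graph ↔ b (star v y) = a z := by
  rw [h.isQuotient.mem_graph_adjoint_iff h.denseRange, star_mul, h.isSelfAdjoint_left.star_eq,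
    h.isSelfAdjoint_right.star_eq, mul_apply_eq_comp]

theorem isQuotient_adjoint_mul_self (h : IsPolarTransform X a b v) :
    IsQuotient (QSphere.opMul X† X) (a * a) (b * b) := by
  have hww : star (v * b) * (v * b) = b * b := by
    rw [star_mul, h.isSelfAdjoint_right.star_eq, mul_assoc, ← mul_assoc (star v), h.isometry,
      one_mul]
  rw [← hww]
  exact IsBoundedTransform.isQuotient_adjoint_mul_self
    ⟨h.nonneg_left, h.injective, by rw [hww]; exact h.sq_add_sq, h.isQuotient⟩

theorem isQuotient_modulus (h : IsPolarTransform X a b v) : IsQuotient (modulus X) a b := by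
  have hquot := isQuotient_quotient h.injective b
  unfold modulus
  rwa [(h.toIsModulusPair.isPosSqrt hquot h.isQuotient_adjoint_mul_self).posSqrt_eq]

theorem isPolarDecomposition (h : IsPolarTransform X a b v) : IsPolarDecomposition X v where
  eq := eq_of_forall_mem_graph_iff fun x y => by
    constructor
    · intro hxy
      obtain ⟨u, rfl, rfl⟩ := (h.isQuotient _ _).1 hxy
      obtain ⟨d, hd, hd'⟩ := (LinearPMap.mem_graph_iff _).1 (h.isQuotient_modulus.mem_graph u)
      exact (LinearPMap.mem_graph_iff _).2 ⟨d, hd, congrArg v hd'⟩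
    · intro hxy
      obtain ⟨d, rfl, rfl⟩ := (LinearPMap.mem_graph_iff _).1 hxy
      obtain ⟨u, hau, hbu⟩ := (h.isQuotient_modulus _ _).1 ((modulus X).mem_graph d)
      exact (h.isQuotient _ _).2 ⟨u, hau, congrArg v hbu⟩
  isometric x _ := h.norm_apply x
  ker x hx := by
    obtain ⟨u, hau, hbu⟩ := (h.isQuotient _ _).1 (X.mem_graph x)
    have hu : b u = 0 := by
      rw [← norm_eq_zero, ← h.norm_apply, norm_eq_zero]
      exact hbu.trans hx
    rw [← hau, (map_eq_zero_iff b h.injective_right).1 hu, map_zero, map_zero]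

end IsPolarTransform

end SquareRoot

/-! ### Unitary equivalence -/

section Intertwines

variable {K L : Type u} [NormedAddCommGroup K] [InnerProductSpace ℂ K] [CompleteSpace K]
  [NormedAddCommGroup L] [InnerProductSpace ℂ L] [CompleteSpace L] {U : K ≃ₗᵢ[ℂ] L}
  {A R : K →ₗ.[ℂ] K} {B S : L →ₗ.[ℂ] L} {a g : K →L[ℂ] K}

theorem intertwines_iff_isQuotient (hA : IsQuotient A a g) :
    Intertwines U A B ↔ IsQuotient B (U.conjStarAlgEquiv a) (U.conjStarAlgEquiv g) := by
  simp only [Intertwines, IsQuotient, U.surjective.forall, U.surjective.exists, hA _ _,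
    LinearIsometryEquiv.conjStarAlgEquiv_apply_apply, U.symm_apply_apply, U.injective.eq_iff]
  exact forall₂_congr fun _ _ => Iff.comm

theorem intertwines_of_isSelfAdjoint (hA : IsSelfAdjoint A) (hB : IsSelfAdjoint B)
    (h : ∀ x y, (x, y) ∈ A.graph → (U x, U y) ∈ B.graph) : Intertwines U A B := by
  refine fun x y => ⟨h x y, fun hxy => ?_⟩
  rw [mem_graph_iff_of_isSelfAdjoint hA]
  intro p r hpr
  have := (mem_graph_iff_of_isSelfAdjoint hB _ _).1 hxy _ _ (h p r hpr)
  rwa [U.inner_map_map, U.inner_map_map] at this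

theorem Intertwines.adjoint (h : Intertwines U A B) (hA : Dense (A.domain : Set K))
    (hB : Dense (B.domain : Set L)) : Intertwines U A† B† := by
  intro x y
  simp only [mem_graph_adjoint hA, mem_graph_adjoint hB, h _ _, U.surjective.forall,
    U.inner_map_map]

theorem Intertwines.isPosSqrt (h : Intertwines U A B) (hR : IsPosSqrt A R) (hS : IsPosSqrt B S) :
    Intertwines U R S := by
  obtain ⟨a, b, hab, hRq⟩ := hR.exists_isModulusPair
  obtain ⟨a', b', hab', hSq⟩ := hS.exists_isModulusPair
  let φ := U.conjStarAlgEquiv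
  have hB := (intertwines_iff_isQuotient (hR.isQuotient hab hRq)).1 h
  obtain ⟨haa, hbb⟩ := hB.eq_of_add_eq_one (hS.isQuotient hab' hSq)
    (by rw [← map_add, hab.sq_add_sq, map_one]) hab'.sq_add_sq
  rw [map_mul] at haa hbb
  rw [intertwines_iff_isQuotient hRq,
    eq_of_mul_self_eq_mul_self (map_nonneg φ hab.nonneg_left) hab'.nonneg_left haa,
    eq_of_mul_self_eq_mul_self (map_nonneg φ hab.nonneg_right) hab'.nonneg_right hbb]
  exact hSq

end Intertwines

/-! ### Direct sums -/

section DirectSum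

variable {H : Type u} [NormedAddCommGroup H] [InnerProductSpace ℂ H]

theorem summable_norm_sq (x : HSum H) : Summable fun n => ‖x n‖ ^ 2 := by
  simpa using (memℓp_gen_iff (p := 2) (by norm_num)).1 (lp.memℓp x)

theorem exists_hSum_of_summable {f : ℕ → H} (hf : Summable fun n => ‖f n‖ ^ 2) :
    ∃ x : HSum H, ∀ n, x n = f n :=
  ⟨⟨f, (memℓp_gen_iff (p := 2) (by norm_num)).2 (by simpa using hf)⟩, fun _ => rfl⟩

theorem exists_hSum_cons (x : HSum H) : ∃ y : HSum H, y 0 = 0 ∧ ∀ n, y (n + 1) = x n := by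
  let f : ℕ → H
    | 0 => 0
    | n + 1 => x n
  obtain ⟨y, hy⟩ := exists_hSum_of_summable (f := f)
    ((summable_nat_add_iff (f := fun n => ‖f n‖ ^ 2) 1).1 (summable_norm_sq x))
  exact ⟨y, hy 0, fun n => hy (n + 1)⟩

theorem exists_hSum_tail (x : HSum H) : ∃ y : HSum H, ∀ n, y n = x (n + 1) :=
  exists_hSum_of_summable
    ((summable_nat_add_iff (f := fun n => ‖x n‖ ^ 2) 1).2 (summable_norm_sq x))

theorem exists_hSum_of_norm_le {f : ℕ → H} (x : HSum H) (C : ℝ) (h : ∀ n, ‖f n‖ ≤ C * ‖x n‖) :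
    ∃ y : HSum H, ∀ n, y n = f n := by
  refine exists_hSum_of_summable (Summable.of_nonneg_of_le (fun n => by positivity) (fun n => ?_)
    ((summable_norm_sq x).mul_left (C ^ 2)))
  rw [← mul_pow]
  exact pow_le_pow_left₀ (norm_nonneg _) (h n) 2

theorem exists_hSum_of_inner_self_eq {f : ℕ → H} (x y : HSum H)
    (h : ∀ n, ⟪f n, f n⟫_ℂ = ⟪x n, y n⟫_ℂ) : ∃ z : HSum H, ∀ n, z n = f n := by
  refine exists_hSum_of_summable (Summable.of_nonneg_of_le (fun n => by positivity) (fun n => ?_)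
    ((summable_norm_sq x).add (summable_norm_sq y)))
  have hle : ‖f n‖ ^ 2 ≤ ‖x n‖ * ‖y n‖ := by
    simpa [← h n, inner_self_eq_norm_sq_to_K] using norm_inner_le_norm (𝕜 := ℂ) (x n) (y n)
  nlinarith [sq_nonneg (‖x n‖ - ‖y n‖), sq_nonneg ‖x n‖, sq_nonneg ‖y n‖]

theorem continuous_hSum_apply (n : ℕ) : Continuous fun x : HSum H => x n :=
  (lp.lipschitzWith_one_eval 2 n).continuous

theorem hasSum_single (x : HSum H) : HasSum (fun n => (lp.single 2 n (x n) : HSum H)) x :=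
  lp.hasSum_single (by norm_num) x

theorem hasSum_single_succ (x : HSum H) :
    HasSum (fun n => (lp.single 2 (n + 1) (x (n + 1)) : HSum H)) (x - lp.single 2 0 (x 0)) := by
  rw [hasSum_nat_add_iff (f := fun n => (lp.single 2 n (x n) : HSum H)) 1]
  simpa using hasSum_single x

theorem mem_of_hasSum {ι E : Type*} [AddCommGroup E] [TopologicalSpace E] [Module ℂ E]
    {M : Submodule ℂ E} (hM : IsClosed (M : Set E)) {f : ι → E} {x : E} (hf : HasSum f x)
    (h : ∀ i, f i ∈ M) : x ∈ M :=
  hM.mem_of_tendsto hf (.of_forall fun _ => Submodule.sum_mem _ fun i _ => h i)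

theorem dense_of_single_mem {M : Submodule ℂ (HSum H)} {D : ℕ → Set H} (hD : ∀ n, Dense (D n))
    (h : ∀ n, ∀ x ∈ D n, lp.single 2 n x ∈ M) : Dense (M : Set (HSum H)) := by
  intro x
  refine mem_of_hasSum M.isClosed_topologicalClosure (hasSum_single x) fun n => ?_
  exact map_mem_closure (f := fun y => (lp.single 2 n y : HSum H))
    (lp.singleContinuousLinearMap ℂ (fun _ : ℕ => H) 2 n).continuous (hD n (x n)) (h n)

/-! ### Operators on direct sums -/

variable {A : ℕ → H →ₗ.[ℂ] H}

theorem single_mem_graph_diagOp {n : ℕ} {x y : H} (h : (x, y) ∈ (A n).graph) :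
    (lp.single 2 n x, lp.single 2 n y) ∈ (diagOp A).graph := by
  refine (mem_graph_diagOp _ _ _).2 fun k => ?_
  rcases eq_or_ne k n with rfl | hk
  · simpa using h
  · rw [lp.single_apply_ne _ _ _ hk, lp.single_apply_ne _ _ _ hk]
    exact (A k).graph.zero_mem

theorem single_mem_graph_raisingOp {n : ℕ} {x y : H} (h : (x, y) ∈ (A n).graph) :
    (lp.single 2 n x, lp.single 2 (n + 1) y) ∈ (raisingOp A).graph := by
  refine (mem_graph_raisingOp _ _ _).2 ⟨lp.single_apply_ne _ _ _ (by simp), fun k => ?_⟩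
  rcases eq_or_ne k n with rfl | hk
  · simpa using h
  · rw [lp.single_apply_ne _ _ _ hk, lp.single_apply_ne _ _ _ (by simpa using hk)]
    exact (A k).graph.zero_mem

theorem single_succ_mem_graph_loweringOp {n : ℕ} {x y : H} (h : (x, y) ∈ (A n).graph) :
    (lp.single 2 (n + 1) x, lp.single 2 n y) ∈ (loweringOp A).graph := by
  refine (mem_graph_loweringOp _ _ _).2 fun k => ?_
  rcases eq_or_ne k n with rfl | hk
  · simpa using h
  · rw [lp.single_apply_ne _ _ _ hk, lp.single_apply_ne _ _ _ (by simpa using hk)]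
    exact (A k).graph.zero_mem

theorem single_zero_mem_graph_loweringOp (x : H) :
    (lp.single 2 0 x, 0) ∈ (loweringOp A).graph := by
  refine (mem_graph_loweringOp _ _ _).2 fun k => ?_
  rw [lp.single_apply_ne _ _ _ (by simp)]
  exact (A k).graph.zero_mem

theorem dense_domain_diagOp (hA : ∀ n, Dense ((A n).domain : Set H)) :
    Dense ((diagOp A).domain : Set (HSum H)) :=
  dense_of_single_mem hA fun _ _ hx =>
    (LinearPMap.mem_domain_iff.1 hx).elim fun _ h =>
      LinearPMap.mem_domain_of_mem_graph (single_mem_graph_diagOp h)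

theorem dense_domain_raisingOp (hA : ∀ n, Dense ((A n).domain : Set H)) :
    Dense ((raisingOp A).domain : Set (HSum H)) :=
  dense_of_single_mem hA fun _ _ hx =>
    (LinearPMap.mem_domain_iff.1 hx).elim fun _ h =>
      LinearPMap.mem_domain_of_mem_graph (single_mem_graph_raisingOp h)

theorem isClosed_setOf_mem_graph {A : H →ₗ.[ℂ] H} (hA : A.IsClosed) (m n : ℕ) :
    IsClosed {p : HSum H × HSum H | (p.1 m, p.2 n) ∈ A.graph} :=
  hA.preimage (((continuous_hSum_apply m).comp continuous_fst).prodMk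
    ((continuous_hSum_apply n).comp continuous_snd))

theorem isClosed_diagOp (hA : ∀ n, (A n).IsClosed) : (diagOp A).IsClosed := by
  have hgraph : ((diagOp A).graph : Set (HSum H × HSum H)) =
      ⋂ n, {p | (p.1 n, p.2 n) ∈ (A n).graph} := by
    ext ⟨x, y⟩
    simpa using mem_graph_diagOp A x y
  rw [LinearPMap.IsClosed, hgraph]
  exact isClosed_iInter fun n => isClosed_setOf_mem_graph (hA n) n n

theorem isClosed_raisingOp (hA : ∀ n, (A n).IsClosed) : (raisingOp A).IsClosed := by
  have hgraph : ((raisingOp A).graph : Set (HSum H × HSum H)) = {p | p.2 0 = 0} ∩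
      ⋂ n, {p | (p.1 n, p.2 (n + 1)) ∈ (A n).graph} := by
    ext ⟨x, y⟩
    simpa using mem_graph_raisingOp A x y
  rw [LinearPMap.IsClosed, hgraph]
  exact (isClosed_eq ((continuous_hSum_apply 0).comp continuous_snd) continuous_const).inter
    (isClosed_iInter fun n => isClosed_setOf_mem_graph (hA n) n (n + 1))

theorem isClosed_loweringOp (hA : ∀ n, (A n).IsClosed) : (loweringOp A).IsClosed := by
  have hgraph : ((loweringOp A).graph : Set (HSum H × HSum H)) =
      ⋂ n, {p | (p.1 (n + 1), p.2 n) ∈ (A n).graph} := by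
    ext ⟨x, y⟩
    simpa using mem_graph_loweringOp A x y
  rw [LinearPMap.IsClosed, hgraph]
  exact isClosed_iInter fun n => isClosed_setOf_mem_graph (hA n) (n + 1) n

theorem hasTrivialKernel_diagOp (hA : ∀ n, HasTrivialKernel (A n)) :
    HasTrivialKernel (diagOp A) :=
  (hasTrivialKernel_iff _).2 fun _ hx => lp.ext <| funext fun n =>
    (hasTrivialKernel_iff _).1 (hA n) _ ((mem_graph_diagOp _ _ _).1 hx n)

/-! ### Finitely supported vectors -/

/-- The finitely supported sequences in `⨁ₙ H` with entries in `D`, encoded as the span of the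
vectors of `D` placed in a single summand. -/
noncomputable def finSupported (D : Submodule ℂ H) : Submodule ℂ (HSum H) :=
  ⨆ n, D.map (lp.lsingle (𝕜 := ℂ) (E := fun _ : ℕ => H) 2 n)

/-- The relation `G`, usually the graph of an operator, maps `D` into itself: every vector of `D`
is related to one of `D`. -/
def MapsInto (G : Submodule ℂ (H × H)) (D : Submodule ℂ H) : Prop :=
  ∀ d ∈ D, ∃ e ∈ D, (d, e) ∈ G

variable {D : Submodule ℂ H}

theorem single_mem_finSupported (n : ℕ) {x : H} (hx : x ∈ D) : lp.single 2 n x ∈ finSupported D :=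
  Submodule.mem_iSup_of_mem n ⟨x, hx, rfl⟩

theorem finSupported_le {M : Submodule ℂ (HSum H)} (h : ∀ n, ∀ x ∈ D, lp.single 2 n x ∈ M) :
    finSupported D ≤ M :=
  iSup_le fun n => Submodule.map_le_iff_le_comap.2 fun x hx => h n x hx

theorem dense_finSupported (hD : Dense (D : Set H)) : Dense (finSupported D : Set (HSum H)) :=
  dense_of_single_mem (fun _ => hD) fun n _ hx => single_mem_finSupported n hx

theorem mapsInto_finSupported {G : Submodule ℂ (HSum H × HSum H)}
    (h : ∀ n, ∀ x ∈ D, ∃ y ∈ finSupported D, (lp.single 2 n x, y) ∈ G) :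
    MapsInto G (finSupported D) := by
  have hle : finSupported D ≤
      (G ⊓ (finSupported D).comap (LinearMap.snd ℂ _ _)).map (LinearMap.fst ℂ _ _) :=
    finSupported_le fun n x hx =>
      let ⟨y, hy, hxy⟩ := h n x hx
      ⟨(_, y), ⟨hxy, hy⟩, rfl⟩
  intro d hd
  obtain ⟨⟨_, e⟩, ⟨hde, he⟩, rfl⟩ := hle hd
  exact ⟨e, he, hde⟩

theorem mapsInto_graph_diagOp (h : ∀ n, MapsInto (A n).graph D) :
    MapsInto (diagOp A).graph (finSupported D) :=
  mapsInto_finSupported fun n x hx =>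
    let ⟨_, hy, hxy⟩ := h n x hx
    ⟨_, single_mem_finSupported n hy, single_mem_graph_diagOp hxy⟩

theorem mapsInto_comap_swap_graph_diagOp
    (h : ∀ n, MapsInto ((A n).graph.comap (LinearEquiv.prodComm ℂ H H : H × H →ₗ[ℂ] H × H)) D) :
    MapsInto ((diagOp A).graph.comap
      (LinearEquiv.prodComm ℂ (HSum H) (HSum H) : HSum H × HSum H →ₗ[ℂ] HSum H × HSum H))
      (finSupported D) :=
  mapsInto_finSupported fun n x hx =>
    let ⟨_, hy, hxy⟩ := h n x hx
    ⟨_, single_mem_finSupported n hy, single_mem_graph_diagOp hxy⟩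

theorem mapsInto_graph_raisingOp (h : ∀ n, MapsInto (A n).graph D) :
    MapsInto (raisingOp A).graph (finSupported D) :=
  mapsInto_finSupported fun n x hx =>
    let ⟨_, hy, hxy⟩ := h n x hx
    ⟨_, single_mem_finSupported (n + 1) hy, single_mem_graph_raisingOp hxy⟩

theorem mapsInto_graph_loweringOp (h : ∀ n, MapsInto (A n).graph D) :
    MapsInto (loweringOp A).graph (finSupported D) :=
  mapsInto_finSupported fun n x hx => by
    cases n with
    | zero => exact ⟨0, zero_mem _, single_zero_mem_graph_loweringOp x⟩
    | succ n =>
      obtain ⟨y, hy, hxy⟩ := h n x hx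
      exact ⟨_, single_mem_finSupported n hy, single_succ_mem_graph_loweringOp hxy⟩

theorem single_mem_topologicalClosure {A : H →ₗ.[ℂ] H} (hA : A.IsClosed) (hD : A.HasCore D)
    {M : Submodule ℂ (HSum H × HSum H)} {m n : ℕ}
    (h : ∀ x ∈ D, ∀ y, (x, y) ∈ A.graph → (lp.single 2 m x, lp.single 2 n y) ∈ M) {x y : H}
    (hxy : (x, y) ∈ A.graph) : (lp.single 2 m x, lp.single 2 n y) ∈ M.topologicalClosure := by
  have hcont : ∀ n, Continuous fun y : H => (lp.single 2 n y : HSum H) := fun n =>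
    (lp.singleContinuousLinearMap ℂ (fun _ : ℕ => H) 2 n).continuous
  refine map_mem_closure (f := fun p : H × H =>
    ((lp.single 2 m p.1, lp.single 2 n p.2) : HSum H × HSum H))
    (((hcont m).comp continuous_fst).prodMk ((hcont n).comp continuous_snd))
    (((hasCore_iff_of_isClosed hA).1 hD).2 hxy) fun p hp => ?_
  obtain ⟨hpD, hp⟩ := mem_graph_domRestrict.1 hp
  exact h _ hpD _ hp

theorem hasCore_finSupported_diagOp (hA : ∀ n, (A n).IsClosed) (hD : ∀ n, (A n).HasCore D) :
    (diagOp A).HasCore (finSupported D) := by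
  rw [hasCore_iff_of_isClosed (isClosed_diagOp hA)]
  refine ⟨finSupported_le fun n x hx => ?_, fun ⟨x, y⟩ hxy => ?_⟩
  · exact LinearPMap.mem_domain_of_mem_graph
      (single_mem_graph_diagOp ((A n).mem_graph ⟨x, (hD n).le_domain hx⟩))
  · refine mem_of_hasSum (Submodule.isClosed_topologicalClosure _)
      ((hasSum_single x).prodMk (hasSum_single y)) fun n => ?_
    refine single_mem_topologicalClosure (hA n) (hD n) (fun u hu v huv => ?_)
      ((mem_graph_diagOp _ _ _).1 hxy n)
    exact mem_graph_domRestrict.2 ⟨single_mem_finSupported n hu, single_mem_graph_diagOp huv⟩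

theorem hasCore_finSupported_raisingOp (hA : ∀ n, (A n).IsClosed) (hD : ∀ n, (A n).HasCore D) :
    (raisingOp A).HasCore (finSupported D) := by
  rw [hasCore_iff_of_isClosed (isClosed_raisingOp hA)]
  refine ⟨finSupported_le fun n x hx => ?_, fun ⟨x, y⟩ hxy => ?_⟩
  · exact LinearPMap.mem_domain_of_mem_graph
      (single_mem_graph_raisingOp ((A n).mem_graph ⟨x, (hD n).le_domain hx⟩))
  · obtain ⟨hy, hxy⟩ := (mem_graph_raisingOp _ _ _).1 hxy
    have hsum := hasSum_single_succ y
    rw [hy, lp.single_zero, sub_zero] at hsum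
    refine mem_of_hasSum (Submodule.isClosed_topologicalClosure _)
      ((hasSum_single x).prodMk hsum) fun n => ?_
    refine single_mem_topologicalClosure (hA n) (hD n) (fun u hu v huv => ?_) (hxy n)
    exact mem_graph_domRestrict.2 ⟨single_mem_finSupported n hu, single_mem_graph_raisingOp huv⟩

theorem hasCore_finSupported_loweringOp (hA : ∀ n, (A n).IsClosed) (hD : ∀ n, (A n).HasCore D)
    (hdense : Dense (D : Set H)) : (loweringOp A).HasCore (finSupported D) := by
  rw [hasCore_iff_of_isClosed (isClosed_loweringOp hA)]
  refine ⟨finSupported_le fun n x hx => ?_, fun ⟨x, y⟩ hxy => ?_⟩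
  · cases n with
    | zero => exact LinearPMap.mem_domain_of_mem_graph (single_zero_mem_graph_loweringOp x)
    | succ n =>
      exact LinearPMap.mem_domain_of_mem_graph
        (single_succ_mem_graph_loweringOp ((A n).mem_graph ⟨x, (hD n).le_domain hx⟩))
  · have hzero := map_mem_closure (f := fun z : H =>
        ((lp.single (E := fun _ => H) 2 0 z, 0) : HSum H × HSum H))
      ((lp.singleContinuousLinearMap ℂ (fun _ : ℕ => H) 2 0).continuous.prodMk continuous_const)
      (hdense (x 0)) (t := ((loweringOp A).domRestrict (finSupported D)).graph)
      fun z hz => mem_graph_domRestrict.2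
        ⟨single_mem_finSupported 0 hz, single_zero_mem_graph_loweringOp z⟩
    have hsucc : (x - lp.single 2 0 (x 0), y) ∈
        ((loweringOp A).domRestrict (finSupported D)).graph.topologicalClosure := by
      refine mem_of_hasSum (Submodule.isClosed_topologicalClosure _)
        ((hasSum_single_succ x).prodMk (hasSum_single y)) fun n => ?_
      refine single_mem_topologicalClosure (hA n) (hD n) (fun u hu v huv => ?_)
        ((mem_graph_loweringOp _ _ _).1 hxy n)
      exact mem_graph_domRestrict.2
        ⟨single_mem_finSupported _ hu, single_succ_mem_graph_loweringOp huv⟩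
    simpa using Submodule.add_mem _ hsucc hzero

end DirectSum

section Adjoint

variable {H : Type u} [NormedAddCommGroup H] [InnerProductSpace ℂ H] [CompleteSpace H]
  {A : ℕ → H →ₗ.[ℂ] H}

theorem adjoint_diagOp (hA : ∀ n, Dense ((A n).domain : Set H)) :
    (diagOp A)† = diagOp fun n => (A n)† := by
  refine eq_of_forall_mem_graph_iff fun y z => ?_
  refine (mem_graph_adjoint (A := diagOp A) (dense_domain_diagOp hA) y z).trans
    (Iff.trans ?_ (mem_graph_diagOp _ y z).symm)
  constructor
  · refine fun h n => (mem_graph_adjoint (hA n) _ _).2 fun u v huv => ?_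
    have hsingle := h _ _ (single_mem_graph_diagOp huv)
    rwa [lp.inner_single_left, lp.inner_single_left] at hsingle
  · intro h u v huv
    rw [lp.inner_eq_tsum, lp.inner_eq_tsum]
    exact tsum_congr fun n =>
      (mem_graph_adjoint (hA n) _ _).1 (h n) _ _ ((mem_graph_diagOp _ _ _).1 huv n)

theorem adjoint_raisingOp (hA : ∀ n, Dense ((A n).domain : Set H)) :
    (raisingOp A)† = loweringOp fun n => (A n)† := by
  refine eq_of_forall_mem_graph_iff fun y z => ?_
  refine (mem_graph_adjoint (A := raisingOp A) (dense_domain_raisingOp hA) y z).trans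
    (Iff.trans ?_ (mem_graph_loweringOp _ y z).symm)
  constructor
  · refine fun h n => (mem_graph_adjoint (hA n) _ _).2 fun u v huv => ?_
    have hsingle := h _ _ (single_mem_graph_raisingOp huv)
    rwa [lp.inner_single_left, lp.inner_single_left] at hsingle
  · intro h u v huv
    obtain ⟨hv, huv⟩ := (mem_graph_raisingOp A _ _).1 huv
    have hshift : ⟪v, y⟫_ℂ = ∑' n, ⟪v (n + 1), y (n + 1)⟫_ℂ := by
      rw [lp.inner_eq_tsum, (lp.summable_inner (𝕜 := ℂ) v y).tsum_eq_zero_add, hv,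
        inner_zero_left, zero_add]
    rw [hshift, lp.inner_eq_tsum]
    exact tsum_congr fun n => (mem_graph_adjoint (hA n) _ _).1 (h n) _ _ (huv n)

theorem isSelfAdjoint_diagOp (hA : ∀ n, IsSelfAdjoint (A n)) : IsSelfAdjoint (diagOp A) := by
  rw [LinearPMap.isSelfAdjoint_def, adjoint_diagOp fun n => (hA n).dense_domain]
  exact congrArg diagOp (funext fun n => LinearPMap.isSelfAdjoint_def.1 (hA n))

theorem exists_hSum_of_mem_graph_opMul (hA : ∀ n, IsSelfAdjoint (A n)) {x z : HSum H}
    (h : ∀ n, (x n, z n) ∈ (opMul (A n) (A n)).graph) :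
    ∃ y : HSum H, ∀ n, (x n, y n) ∈ (A n).graph ∧ (y n, z n) ∈ (A n).graph := by
  choose f hxf hfz using fun n => (mem_graph_opMul _ _ _ _).1 (h n)
  obtain ⟨y, hy⟩ := exists_hSum_of_inner_self_eq x z fun n =>
    (mem_graph_iff_of_isSelfAdjoint (hA n) _ _).1 (hfz n) _ _ (hxf n)
  exact ⟨y, fun n => by rw [hy]; exact ⟨hxf n, hfz n⟩⟩

theorem opMul_diagOp_self (hA : ∀ n, IsSelfAdjoint (A n)) :
    opMul (diagOp A) (diagOp A) = diagOp fun n => opMul (A n) (A n) := by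
  refine eq_of_forall_mem_graph_iff fun x z => ?_
  simp only [mem_graph_opMul (diagOp A), mem_graph_diagOp]
  constructor
  · rintro ⟨y, hxy, hyz⟩ n
    exact (mem_graph_opMul _ _ _ _).2 ⟨y n, hxy n, hyz n⟩
  · intro h
    obtain ⟨y, hy⟩ := exists_hSum_of_mem_graph_opMul hA h
    exact ⟨y, fun n => (hy n).1, fun n => (hy n).2⟩

theorem opMul_loweringOp_raisingOp (hA : ∀ n, IsSelfAdjoint (A n)) :
    opMul (loweringOp A) (raisingOp A) = diagOp fun n => opMul (A n) (A n) := by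
  refine eq_of_forall_mem_graph_iff fun x z => ?_
  simp only [mem_graph_opMul (loweringOp A), mem_graph_raisingOp, mem_graph_loweringOp,
    mem_graph_diagOp]
  constructor
  · rintro ⟨y, ⟨-, hxy⟩, hyz⟩ n
    exact (mem_graph_opMul _ _ _ _).2 ⟨y (n + 1), hxy n, hyz n⟩
  · intro h
    obtain ⟨y, hy⟩ := exists_hSum_of_mem_graph_opMul hA h
    obtain ⟨y', hy'_zero, hy'_succ⟩ := exists_hSum_cons y
    simp only [← hy'_succ] at hy
    exact ⟨y', ⟨hy'_zero, fun n => (hy n).1⟩, fun n => (hy n).2⟩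

theorem mem_graph_opMul_raisingOp_loweringOp (hA : ∀ n, IsSelfAdjoint (A n)) (x z : HSum H) :
    (x, z) ∈ (opMul (raisingOp A) (loweringOp A)).graph ↔
      z 0 = 0 ∧ ∀ n, (x (n + 1), z (n + 1)) ∈ (opMul (A n) (A n)).graph := by
  simp only [mem_graph_opMul (raisingOp A), mem_graph_raisingOp, mem_graph_loweringOp]
  constructor
  · rintro ⟨y, hxy, hz, hyz⟩
    exact ⟨hz, fun n => (mem_graph_opMul _ _ _ _).2 ⟨y n, hxy n, hyz n⟩⟩
  · rintro ⟨hz, h⟩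
    obtain ⟨x', hx'⟩ := exists_hSum_tail x
    obtain ⟨z', hz'⟩ := exists_hSum_tail z
    simp only [← hx', ← hz'] at h ⊢
    obtain ⟨y, hy⟩ := exists_hSum_of_mem_graph_opMul hA h
    exact ⟨y, fun n => (hy n).1, hz, fun n => (hy n).2⟩

end Adjoint

/-! ### The weights -/

section SqrtNumerator

theorem inner_self_eq_ofReal {H : Type*} [NormedAddCommGroup H] [InnerProductSpace ℂ H] (x : H) :
    ⟪x, x⟫_ℂ = ((‖x‖ ^ 2 : ℝ) : ℂ) := by
  rw [inner_self_eq_norm_sq_to_K, Complex.ofReal_pow]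
  rfl

variable {H : Type u} [NormedAddCommGroup H] [InnerProductSpace ℂ H] [CompleteSpace H]
  {Y : H →ₗ.[ℂ] H} {a b d : H →L[ℂ] H} {r s t : ℝ}

/-- The numerator over `a` of `(r Y² + s)^{1/2}`, where `Y` is the quotient `b a⁻¹` of commuting
self-adjoint operators. -/
noncomputable def sqrtNumerator (a b : H →L[ℂ] H) (r s : ℝ) : H →L[ℂ] H :=
  CFC.sqrt ((r : ℂ) • (b * b) + (s : ℂ) • (a * a))

theorem sqrtNumerator_nonneg : 0 ≤ sqrtNumerator a b r s := CFC.sqrt_nonneg _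

theorem isSelfAdjoint_sqrtNumerator : IsSelfAdjoint (sqrtNumerator a b r s) :=
  .of_nonneg sqrtNumerator_nonneg

theorem commute_sqrtNumerator (ha : Commute a d) (hb : Commute b d) :
    Commute (sqrtNumerator a b r s) d :=
  commute_sqrt (((hb.mul_left hb).smul_left _).add_left ((ha.mul_left ha).smul_left _))

theorem inner_sq_add_sq_apply (ha : IsSelfAdjoint a) (hb : IsSelfAdjoint b) (r s : ℝ) (x : H) :
    ⟪x, ((r : ℂ) • (b * b) + (s : ℂ) • (a * a)) x⟫_ℂ =
      ((r * ‖b x‖ ^ 2 + s * ‖a x‖ ^ 2 : ℝ) : ℂ) := by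
  simp only [add_apply, smul_apply, mul_apply_eq_comp, inner_add_right, inner_smul_right]
  rw [← inner_apply_left ha, ← inner_apply_left hb, inner_self_eq_ofReal,
    inner_self_eq_ofReal]
  push_cast
  rfl

theorem sqrtNumerator_mul_self (ha : IsSelfAdjoint a) (hb : IsSelfAdjoint b) (hr : 0 ≤ r)
    (hs : 0 ≤ s) :
    sqrtNumerator a b r s * sqrtNumerator a b r s = (r : ℂ) • (b * b) + (s : ℂ) • (a * a) := by
  have hsa : IsSelfAdjoint ((r : ℂ) • (b * b) + (s : ℂ) • (a * a)) :=
    (IsSelfAdjoint.smul (Complex.conj_ofReal r) ((hb.commute_iff hb).1 (Commute.refl b))).add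
      (IsSelfAdjoint.smul (Complex.conj_ofReal s) ((ha.commute_iff ha).1 (Commute.refl a)))
  refine CFC.sqrt_mul_sqrt_self _ ((nonneg_iff_re_inner_nonneg hsa).2 fun x => ?_)
  rw [inner_sq_add_sq_apply ha hb, Complex.ofReal_re]
  positivity

theorem norm_sqrtNumerator_sq (ha : IsSelfAdjoint a) (hb : IsSelfAdjoint b) (hr : 0 ≤ r)
    (hs : 0 ≤ s) (x : H) :
    ‖sqrtNumerator a b r s x‖ ^ 2 = r * ‖b x‖ ^ 2 + s * ‖a x‖ ^ 2 := by
  have h := inner_sq_add_sq_apply ha hb r s x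
  rw [← sqrtNumerator_mul_self ha hb hr hs, mul_apply_eq_comp,
    ← inner_apply_left isSelfAdjoint_sqrtNumerator, inner_self_eq_ofReal] at h
  exact Complex.ofReal_injective h

theorem smul_sqrtNumerator (ha : IsSelfAdjoint a) (hb : IsSelfAdjoint b) (hr : 0 ≤ r)
    (hs : 0 ≤ s) (ht : 0 ≤ t) :
    (t : ℂ) • sqrtNumerator a b r s = sqrtNumerator a b (t ^ 2 * r) (t ^ 2 * s) := by
  refine eq_of_mul_self_eq_mul_self ?_ sqrtNumerator_nonneg ?_
  · have hsa : IsSelfAdjoint ((t : ℂ) • sqrtNumerator a b r s) :=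
      IsSelfAdjoint.smul (Complex.conj_ofReal t) isSelfAdjoint_sqrtNumerator
    refine (nonneg_iff_re_inner_nonneg hsa).2 fun x => ?_
    rw [smul_apply, inner_smul_right, Complex.re_ofReal_mul]
    exact mul_nonneg ht
      ((nonneg_iff_re_inner_nonneg isSelfAdjoint_sqrtNumerator).1 sqrtNumerator_nonneg x)
  · rw [smul_mul_smul_comm, sqrtNumerator_mul_self ha hb hr hs,
      sqrtNumerator_mul_self ha hb (by positivity) (by positivity), smul_add, smul_smul, smul_smul]
    push_cast
    ring_nf

namespace IsQuotientPair

theorem commute_sqrtNumerator_left (hp : IsQuotientPair a b) :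
    Commute a (sqrtNumerator a b r s) :=
  (commute_sqrtNumerator (Commute.refl a) hp.commute.symm).symm

theorem commute_sqrtNumerator_right (hp : IsQuotientPair a b) :
    Commute b (sqrtNumerator a b r s) :=
  (commute_sqrtNumerator hp.commute (Commute.refl b)).symm

theorem sqrtNumerator (hp : IsQuotientPair a b) (h : a * a + b * b = 1) (hr : 0 < r) (hs : 0 ≤ s) :
    IsQuotientPair a (sqrtNumerator a b r s) := by
  refine .of_isUnit hp.left isSelfAdjoint_sqrtNumerator hp.commute_sqrtNumerator_left
    hp.injective ?_
  have hmin : 0 < min r 1 := lt_min hr one_pos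
  refine ContinuousLinearMap.isUnit_of_forall_le_norm_inner_map (c := ⟨min r 1, hmin.le⟩) _ hmin
    fun x => ?_
  have hone := inner_sq_add_sq_apply hp.left hp.right 1 1 x
  have hsum := inner_sq_add_sq_apply hp.left hp.right r (1 + s) x
  rw [Complex.ofReal_one, one_smul, one_smul, add_comm (b * b), h, one_apply_eq_self,
    inner_self_eq_ofReal] at hone
  have hnorm : ‖x‖ ^ 2 = 1 * ‖b x‖ ^ 2 + 1 * ‖a x‖ ^ 2 := Complex.ofReal_injective hone
  have hop : a * a + QSphere.sqrtNumerator a b r s * QSphere.sqrtNumerator a b r s =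
      (r : ℂ) • (b * b) + ((1 + s : ℝ) : ℂ) • (a * a) := by
    rw [sqrtNumerator_mul_self hp.left hp.right hr.le hs]
    push_cast
    module
  rw [← inner_conj_symm, RCLike.norm_conj, hop, hsum, Complex.norm_real,
    Real.norm_of_nonneg (by positivity), hnorm]
  change _ * min r 1 ≤ _
  nlinarith [min_le_left r 1, min_le_right r 1, sq_nonneg ‖a x‖, sq_nonneg ‖b x‖,
    mul_nonneg hs (sq_nonneg ‖a x‖)]

end IsQuotientPair

theorem isPosSqrt_of_isQuotient_sqrtNumerator {W : H →ₗ.[ℂ] H} (hY : IsBoundedTransform Y a b)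
    (hp : IsQuotientPair a b) (hr : 0 < r) (hs : 0 ≤ s)
    (hW : IsQuotient W a (sqrtNumerator a b r s)) :
    IsPosSqrt ((r : ℂ) • opMul Y Y + scalarOp H (s : ℂ)) W := by
  have hsq := hY.sq_add
  rw [hp.right.star_eq] at hsq
  refine hW.isPosSqrt (hp.sqrtNumerator hsq hr hs) hY.nonneg sqrtNumerator_nonneg ?_
  rw [sqrtNumerator_mul_self hp.left hp.right hr.le hs]
  exact ((hY.isQuotient.opMul hY.isQuotient hp).smul _).add_scalarOp _

end SqrtNumerator

section Weight

theorem norm_le_norm_add_of_re_inner_nonneg {E : Type*} [NormedAddCommGroup E]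
    [InnerProductSpace ℂ E] {x y : E} (h : 0 ≤ (⟪x, y⟫_ℂ).re) : ‖x‖ ≤ ‖x + y‖ := by
  refine le_of_sq_le_sq ?_ (norm_nonneg _)
  rw [norm_add_sq (𝕜 := ℂ), RCLike.re_eq_complex_re]
  nlinarith [sq_nonneg ‖y‖]

theorem re_inner_nonneg_of_mem_graph_adjoint_mul {E : Type u} [NormedAddCommGroup E]
    [InnerProductSpace ℂ E] [CompleteSpace E] {X : E →ₗ.[ℂ] E} (hX : Dense (X.domain : Set E))
    {x z : E} (h : (x, z) ∈ (opMul X† X).graph) : 0 ≤ (⟪z, x⟫_ℂ).re := by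
  obtain ⟨m, hxm, hmz⟩ := (mem_graph_opMul _ _ _ _).1 h
  rw [← inner_conj_symm, ← (mem_graph_adjoint hX _ _).1 hmz _ _ hxm, inner_self_eq_ofReal,
    Complex.conj_ofReal, Complex.ofReal_re]
  positivity

theorem lam_sq {q : ℝ} (hq₀ : 0 ≤ q) (hq₁ : q ≤ 1) (n : ℕ) : lam q n ^ 2 = 1 - q ^ (2 * n) :=
  Real.sq_sqrt (sub_nonneg.2 (pow_le_one₀ hq₀ hq₁))

variable {H : Type u} [NormedAddCommGroup H] [InnerProductSpace ℂ H] [CompleteSpace H]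
  {q c : ℝ} {Y : H →ₗ.[ℂ] H} {a b : H →L[ℂ] H} (hq₀ : 0 < q) (hq₁ : q < 1) (hc : 0 ≤ c)

include hq₀ hc in
theorem isQuotient_weight (hY : IsBoundedTransform Y a b) (hp : IsQuotientPair a b) (n : ℕ) :
    IsQuotient (weight q c Y n) a
      (sqrtNumerator a b (lam q (n + 1) ^ 2 * q ^ (2 * n)) (lam q (n + 1) ^ 2 * c)) := by
  have hsqrt := isPosSqrt_of_isQuotient_sqrtNumerator hY hp (pow_pos hq₀ (2 * n)) hc
    (isQuotient_quotient hp.injective _)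
  rw [Complex.ofReal_pow] at hsqrt
  rw [weight, hsqrt.posSqrt_eq, ← smul_sqrtNumerator hp.left hp.right (by positivity) hc
    (t := lam q (n + 1)) (Real.sqrt_nonneg _)]
  exact (isQuotient_quotient hp.injective _).smul _

include hq₀ hq₁ in
theorem lam_succ_sq_pos (n : ℕ) : 0 < lam q (n + 1) ^ 2 := by
  rw [lam_sq hq₀.le hq₁.le]
  exact sub_pos.2 (pow_lt_one₀ hq₀.le hq₁ (by simp))

include hq₀ hq₁ hc

theorem isPosSqrt_weight (hY : IsSelfAdjoint Y) (n : ℕ) :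
    IsPosSqrt (((lam q (n + 1) ^ 2 * q ^ (2 * n) : ℝ) : ℂ) • opMul Y Y +
      scalarOp H ((lam q (n + 1) ^ 2 * c : ℝ) : ℂ)) (weight q c Y n) := by
  obtain ⟨a, b, hab, hp⟩ := exists_isBoundedTransform_of_isSelfAdjoint hY
  have hlam := lam_succ_sq_pos hq₀ hq₁ n
  exact isPosSqrt_of_isQuotient_sqrtNumerator hab hp (by positivity) (by positivity)
    (isQuotient_weight hq₀ hc hab hp n)

theorem isSelfAdjoint_weight (hY : IsSelfAdjoint Y) (n : ℕ) : IsSelfAdjoint (weight q c Y n) :=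
  (isPosSqrt_weight hq₀ hq₁ hc hY n).selfAdjoint

theorem mem_graph_opMul_weight (hY : IsSelfAdjoint Y) (n : ℕ) (x z : H) :
    (x, z) ∈ (opMul (weight q c Y n) (weight q c Y n)).graph ↔ ∃ y, (x, y) ∈ (opMul Y Y).graph ∧
      z = (1 - (q : ℂ) ^ (2 * (n + 1))) • ((q : ℂ) ^ (2 * n) • y + (c : ℂ) • x) := by
  rw [(isPosSqrt_weight hq₀ hq₁ hc hY n).sq, mem_graph_add, lam_sq hq₀.le hq₁.le]
  push_cast
  constructor
  · rintro ⟨_, _, hy, hx, rfl⟩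
    obtain ⟨y, hxy, rfl⟩ := (mem_graph_smul _ _ _ _).1 hy
    rw [(mem_graph_scalarOp _ _ _).1 hx]
    exact ⟨y, hxy, by module⟩
  · rintro ⟨y, hxy, rfl⟩
    exact ⟨_, _, (mem_graph_smul _ _ _ _).2 ⟨y, hxy, rfl⟩, (mem_graph_scalarOp _ _ _).2 rfl,
      by module⟩

theorem exists_mem_graph_of_mem_graph_weight (hY : IsSelfAdjoint Y) {n : ℕ} {x m : H}
    (h : (x, m) ∈ (weight q c Y n).graph) :
    ∃ y, (x, y) ∈ Y.graph ∧ ‖(q : ℂ) ^ (2 * n) • y‖ ≤ (1 - q ^ 2)⁻¹ * ‖m‖ := by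
  obtain ⟨a, b, hab, hp⟩ := exists_isBoundedTransform_of_isSelfAdjoint hY
  obtain ⟨u, rfl, rfl⟩ := (isQuotient_weight hq₀ hc hab hp n _ _).1 h
  refine ⟨b u, hab.isQuotient.mem_graph u, ?_⟩
  have hq₂ : 0 < 1 - q ^ 2 := sub_pos.2 (pow_lt_one₀ hq₀.le hq₁ two_ne_zero)
  have hlam : 1 - q ^ 2 ≤ lam q (n + 1) ^ 2 := by
    rw [lam_sq hq₀.le hq₁.le]
    exact sub_le_sub_left (pow_le_pow_of_le_one hq₀.le hq₁.le (by omega)) 1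
  rw [norm_smul, norm_pow, Complex.norm_real, Real.norm_of_nonneg hq₀.le, inv_mul_eq_div,
    le_div_iff₀ hq₂]
  refine le_of_sq_le_sq ?_ (norm_nonneg _)
  rw [norm_sqrtNumerator_sq hp.left hp.right (by positivity) (by positivity)]
  have hqn : q ^ (2 * n) ≤ 1 := pow_le_one₀ hq₀.le hq₁.le
  have hq₂' : 1 - q ^ 2 ≤ 1 := sub_le_self _ (by positivity)
  calc (q ^ (2 * n) * ‖b u‖ * (1 - q ^ 2)) ^ 2
      = (1 - q ^ 2) * (1 - q ^ 2) * (q ^ (2 * n) * q ^ (2 * n)) * ‖b u‖ ^ 2 := by ring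
    _ ≤ lam q (n + 1) ^ 2 * 1 * (q ^ (2 * n) * 1) * ‖b u‖ ^ 2 := by gcongr
    _ ≤ _ := by
      rw [mul_one, mul_one]
      exact le_add_of_nonneg_right (by positivity)

theorem opMul_weight_comm (hY : IsSelfAdjoint Y) (n : ℕ) :
    opMul Y (weight q c Y n) = opMul (weight q c Y n) Y := by
  obtain ⟨a, b, hab, hp⟩ := exists_isBoundedTransform_of_isSelfAdjoint hY
  have hlam := lam_succ_sq_pos hq₀ hq₁ n
  have hsq := hab.sq_add
  rw [hp.right.star_eq] at hsq
  have hW := isQuotient_weight hq₀ hc hab hp n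
  have hWY := hW.opMul hab.isQuotient (hp.sqrtNumerator hsq (by positivity) (by positivity))
  rw [hp.commute_sqrtNumerator_right.eq] at hWY
  exact hWY.eq (hab.isQuotient.opMul hW hp)

theorem norm_smul_le_of_mem_graph_opMul (hY : IsSelfAdjoint Y) {x y : H}
    (h : (x, y) ∈ (opMul Y Y).graph) (n : ℕ) :
    ‖(q : ℂ) ^ (4 * n) • y‖ ≤ (1 - q ^ 2)⁻¹ *
      ‖(1 - (q : ℂ) ^ (2 * (n + 1))) • ((q : ℂ) ^ (2 * n) • y + (c : ℂ) • x)‖ := by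
  have hq₂ : 0 < 1 - q ^ 2 := sub_pos.2 (pow_lt_one₀ hq₀.le hq₁ two_ne_zero)
  have hqn : q ^ (2 * n) ≤ 1 := pow_le_one₀ hq₀.le hq₁.le
  have hlam : 1 - q ^ 2 ≤ 1 - q ^ (2 * (n + 1)) :=
    sub_le_sub_left (pow_le_pow_of_le_one hq₀.le hq₁.le (by omega)) 1
  have hsum : ‖(q : ℂ) ^ (2 * n) • y‖ ≤ ‖(q : ℂ) ^ (2 * n) • y + (c : ℂ) • x‖ := by
    refine norm_le_norm_add_of_re_inner_nonneg ?_
    rw [← Complex.ofReal_pow, inner_smul_left, inner_smul_right, Complex.conj_ofReal,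
      Complex.re_ofReal_mul, Complex.re_ofReal_mul]
    have := re_inner_nonneg_of_mem_graph_adjoint_mul hY.dense_domain
      (by rwa [LinearPMap.isSelfAdjoint_def.1 hY])
    positivity
  have hnorm : ‖1 - (q : ℂ) ^ (2 * (n + 1))‖ = 1 - q ^ (2 * (n + 1)) := by
    rw [← Real.norm_of_nonneg (hq₂.le.trans hlam), ← Complex.norm_real]
    norm_cast
  rw [inv_mul_eq_div, le_div_iff₀ hq₂, norm_smul (1 - (q : ℂ) ^ (2 * (n + 1))), hnorm]
  calc ‖(q : ℂ) ^ (4 * n) • y‖ * (1 - q ^ 2)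
      = q ^ (2 * n) * (‖(q : ℂ) ^ (2 * n) • y‖ * (1 - q ^ 2)) := by
        simp only [norm_smul, norm_pow, Complex.norm_real, Real.norm_of_nonneg hq₀.le]
        ring
    _ ≤ 1 * (‖(q : ℂ) ^ (2 * n) • y + (c : ℂ) • x‖ * (1 - q ^ (2 * (n + 1)))) := by gcongr
    _ = _ := by ring

end Weight

/-! ### The model -/

section Scaled

variable {H : Type u} [NormedAddCommGroup H] [InnerProductSpace ℂ H] {A : H →ₗ.[ℂ] H}

theorem hasTrivialKernel_smul {k : ℂ} (hk : k ≠ 0) (hA : HasTrivialKernel A) :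
    HasTrivialKernel (k • A) :=
  fun x hx => hA x ((smul_eq_zero.1 hx).resolve_left hk)

theorem opMul_smul_smul {k : ℂ} (hk : k ≠ 0) (A B : H →ₗ.[ℂ] H) :
    opMul (k • A) (k • B) = k ^ 2 • opMul A B := by
  refine eq_of_forall_mem_graph_iff fun x z => ?_
  simp only [mem_graph_opMul, mem_graph_smul]
  constructor
  · rintro ⟨_, ⟨y, hxy, rfl⟩, w, hyw, rfl⟩
    refine ⟨k⁻¹ • w, ⟨y, hxy, ?_⟩, ?_⟩
    · simpa only [Prod.smul_mk, inv_smul_smul₀ hk] using A.graph.smul_mem k⁻¹ hyw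
    · rw [smul_smul, pow_two, mul_assoc, mul_inv_cancel₀ hk, mul_one]
  · rintro ⟨w, ⟨y, hxy, hyw⟩, rfl⟩
    exact ⟨_, ⟨y, hxy, rfl⟩, k • w, A.graph.smul_mem k hyw, by rw [smul_smul, pow_two]⟩

theorem isSelfAdjoint_smul [CompleteSpace H] {k : ℝ} (hk : k ≠ 0) (hA : IsSelfAdjoint A) :
    IsSelfAdjoint ((k : ℂ) • A) := by
  have hk' : (k : ℂ) ≠ 0 := Complex.ofReal_ne_zero.2 hk
  refine isSelfAdjoint_of_forall_mem_graph_iff hA.dense_domain fun y z => ?_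
  have hgraph : (y, z) ∈ ((k : ℂ) • A).graph ↔ (y, (k : ℂ)⁻¹ • z) ∈ A.graph := by
    rw [mem_graph_smul]
    constructor
    · rintro ⟨w, hw, rfl⟩
      rwa [inv_smul_smul₀ hk']
    · exact fun h => ⟨_, h, (smul_inv_smul₀ hk' z).symm⟩
  rw [hgraph, mem_graph_iff_of_isSelfAdjoint hA]
  simp only [mem_graph_smul]
  refine forall_congr' fun x => ⟨?_, fun h w hw => ?_⟩
  · rintro h _ ⟨w, hw, rfl⟩
    rw [inner_smul_left, Complex.conj_ofReal, h w hw, inner_smul_right, mul_inv_cancel_left₀ hk']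
  · have := h _ ⟨w, hw, rfl⟩
    rw [inner_smul_left, Complex.conj_ofReal] at this
    rw [inner_smul_right, ← this, inv_mul_cancel_left₀ hk']

end Scaled

section Model

variable {H : Type u} [NormedAddCommGroup H] [InnerProductSpace ℂ H] {q c : ℝ} {Y : H →ₗ.[ℂ] H}

theorem hasTrivialKernel_modelY (hq₀ : q ≠ 0) (hY : HasTrivialKernel Y) :
    HasTrivialKernel (modelY q Y) :=
  hasTrivialKernel_diagOp fun _ =>
    hasTrivialKernel_smul (pow_ne_zero _ (Complex.ofReal_ne_zero.2 hq₀)) hY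

variable [CompleteSpace H]

theorem isSelfAdjoint_qpow_smul (hq₀ : q ≠ 0) (hY : IsSelfAdjoint Y) (n : ℕ) :
    IsSelfAdjoint ((q : ℂ) ^ n • Y) := by
  rw [← Complex.ofReal_pow]
  exact isSelfAdjoint_smul (pow_ne_zero n hq₀) hY

theorem isSelfAdjoint_modelY (hq₀ : q ≠ 0) (hY : IsSelfAdjoint Y) :
    IsSelfAdjoint (modelY q Y) :=
  isSelfAdjoint_diagOp fun n => isSelfAdjoint_qpow_smul hq₀ hY (2 * n)

theorem mem_graph_opMul_modelY (hq₀ : q ≠ 0) (hY : IsSelfAdjoint Y) (x z : HSum H) :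
    (x, z) ∈ (opMul (modelY q Y) (modelY q Y)).graph ↔
      ∀ n, ∃ y, (x n, y) ∈ (opMul Y Y).graph ∧ z n = (q : ℂ) ^ (4 * n) • y := by
  rw [modelY, opMul_diagOp_self fun n => isSelfAdjoint_qpow_smul hq₀ hY (2 * n), mem_graph_diagOp]
  refine forall_congr' fun n => ?_
  rw [opMul_smul_smul (pow_ne_zero _ (Complex.ofReal_ne_zero.2 hq₀)), mem_graph_smul, ← pow_mul,
    show 2 * n * 2 = 4 * n by ring]

variable (hq₀ : 0 < q) (hq₁ : q < 1) (hc : 0 ≤ c)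
include hq₀ hq₁ hc

theorem dense_domain_modelX (hY : IsSelfAdjoint Y) :
    Dense ((modelX q c Y).domain : Set (HSum H)) :=
  dense_domain_raisingOp fun n => (isSelfAdjoint_weight hq₀ hq₁ hc hY n).dense_domain

theorem isClosed_modelX (hY : IsSelfAdjoint Y) : (modelX q c Y).IsClosed :=
  isClosed_raisingOp fun n => (isSelfAdjoint_weight hq₀ hq₁ hc hY n).isClosed

theorem adjoint_modelX (hY : IsSelfAdjoint Y) : (modelX q c Y)† = modelXstar q c Y := by
  rw [modelX, adjoint_raisingOp fun n => (isSelfAdjoint_weight hq₀ hq₁ hc hY n).dense_domain,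
    modelXstar]
  exact congrArg loweringOp (funext fun n => isSelfAdjoint_weight hq₀ hq₁ hc hY n)

theorem opMul_modelY_modelX_le (hY : IsSelfAdjoint Y) :
    opMul (modelY q Y) (modelX q c Y) ≤ (q : ℂ) ^ 2 • opMul (modelX q c Y) (modelY q Y) := by
  refine le_of_forall_mem_graph fun x z hxz => ?_
  have hq : (q : ℂ) ≠ 0 := Complex.ofReal_ne_zero.2 hq₀.ne'
  obtain ⟨m, hX, hm⟩ := (mem_graph_opMul _ _ _ _).1 hxz
  obtain ⟨hm₀, hX⟩ := (mem_graph_raisingOp _ _ _).1 hX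
  have hz := fun n => (mem_graph_smul _ _ _ _).1 ((mem_graph_diagOp _ _ _).1 hm n)
  choose y hy hbound using fun n => exists_mem_graph_of_mem_graph_weight hq₀ hq₁ hc hY (hX n)
  obtain ⟨m', hm'⟩ := exists_hSum_tail m
  obtain ⟨p, hp⟩ := exists_hSum_of_norm_le m' (1 - q ^ 2)⁻¹ fun n => by
    rw [hm']
    exact hbound n
  refine (mem_graph_smul _ _ _ _).2 ⟨((q : ℂ) ^ 2)⁻¹ • z, (mem_graph_opMul _ _ _ _).2 ⟨p,
    (mem_graph_diagOp _ _ _).2 fun n => (mem_graph_smul _ _ _ _).2 ⟨y n, hy n, hp n⟩,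
    (mem_graph_raisingOp _ _ _).2 ⟨?_, fun n => ?_⟩⟩, (smul_inv_smul₀ (pow_ne_zero 2 hq) z).symm⟩
  · obtain ⟨w, hw, hz₀⟩ := hz 0
    rw [hm₀] at hw
    rw [lp.coeFn_smul, Pi.smul_apply, hz₀, eq_of_mem_graph hw (Submodule.zero_mem _), smul_zero,
      smul_zero]
  · obtain ⟨w, hw, hzn⟩ := hz (n + 1)
    have hcomm : (x n, w) ∈ (opMul (weight q c Y n) Y).graph := by
      rw [← opMul_weight_comm hq₀ hq₁ hc hY n]
      exact (mem_graph_opMul _ _ _ _).2 ⟨_, hX n, hw⟩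
    obtain ⟨y', hy', hw'⟩ := (mem_graph_opMul _ _ _ _).1 hcomm
    rw [lp.coeFn_smul, Pi.smul_apply, hp, hzn, smul_smul,
      show ((q : ℂ) ^ 2)⁻¹ * (q : ℂ) ^ (2 * (n + 1)) = (q : ℂ) ^ (2 * n) by field_simp; ring,
      eq_of_mem_graph (hy n) hy']
    exact (weight q c Y n).graph.smul_mem _ hw'

theorem mem_graph_opMul_modelXstar_modelX (hY : IsSelfAdjoint Y) (x z : HSum H) :
    (x, z) ∈ (opMul (modelXstar q c Y) (modelX q c Y)).graph ↔
      ∀ n, ∃ y, (x n, y) ∈ (opMul Y Y).graph ∧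
        z n = (1 - (q : ℂ) ^ (2 * (n + 1))) • ((q : ℂ) ^ (2 * n) • y + (c : ℂ) • x n) := by
  rw [modelX, modelXstar, opMul_loweringOp_raisingOp (isSelfAdjoint_weight hq₀ hq₁ hc hY),
    mem_graph_diagOp]
  exact forall_congr' fun n => mem_graph_opMul_weight hq₀ hq₁ hc hY n _ _

theorem mem_graph_opMul_modelX_modelXstar (hY : IsSelfAdjoint Y) (x z : HSum H) :
    (x, z) ∈ (opMul (modelX q c Y) (modelXstar q c Y)).graph ↔
      z 0 = 0 ∧ ∀ n, ∃ y, (x (n + 1), y) ∈ (opMul Y Y).graph ∧ z (n + 1) =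
        (1 - (q : ℂ) ^ (2 * (n + 1))) • ((q : ℂ) ^ (2 * n) • y + (c : ℂ) • x (n + 1)) := by
  rw [modelX, modelXstar, mem_graph_opMul_raisingOp_loweringOp
    (isSelfAdjoint_weight hq₀ hq₁ hc hY)]
  exact and_congr_right fun _ =>
    forall_congr' fun n => mem_graph_opMul_weight hq₀ hq₁ hc hY n _ _

theorem mem_graph_relation_of_mem_graph_opMul_modelXstar_modelX (hY : IsSelfAdjoint Y)
    {x z : HSum H} (h : (x, z) ∈ (opMul (modelXstar q c Y) (modelX q c Y)).graph) :
    (x, z) ∈ ((q : ℂ) ^ 2 • opMul (modelX q c Y) (modelXstar q c Y) +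
      (1 - (q : ℂ) ^ 2) • (opMul (modelY q Y) (modelY q Y) + scalarOp (HSum H) (c : ℂ))).graph := by
  have hq : (q : ℂ) ^ 2 ≠ 0 := pow_ne_zero 2 (Complex.ofReal_ne_zero.2 hq₀.ne')
  simp only [mem_graph_add, mem_graph_smul, mem_graph_scalarOp]
  choose y hy hz using (mem_graph_opMul_modelXstar_modelX hq₀ hq₁ hc hY x z).1 h
  obtain ⟨p, hp⟩ := exists_hSum_of_norm_le z (1 - q ^ 2)⁻¹ fun n => by
    rw [hz]
    exact norm_smul_le_of_mem_graph_opMul hq₀ hq₁ hc hY (hy n) n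
  refine ⟨_, _, ⟨((q : ℂ) ^ 2)⁻¹ • (z - (1 - (q : ℂ) ^ 2) • (p + (c : ℂ) • x)), ?_, rfl⟩,
    ⟨_, ⟨p, (c : ℂ) • x, ?_, rfl, rfl⟩, rfl⟩, ?_⟩
  · refine (mem_graph_opMul_modelX_modelXstar hq₀ hq₁ hc hY _ _).2
      ⟨?_, fun n => ⟨y (n + 1), hy _, ?_⟩⟩
    · change ((q : ℂ) ^ 2)⁻¹ • (z 0 - (1 - (q : ℂ) ^ 2) • (p 0 + (c : ℂ) • x 0)) = 0
      rw [hz, hp]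
      simp
    · change ((q : ℂ) ^ 2)⁻¹ •
        (z (n + 1) - (1 - (q : ℂ) ^ 2) • (p (n + 1) + (c : ℂ) • x (n + 1))) = _
      rw [inv_smul_eq_iff₀ hq, hz, hp]
      match_scalars <;> ring
  · exact (mem_graph_opMul_modelY hq₀.ne' hY _ _).2 fun n => ⟨y n, hy n, hp n⟩
  · rw [smul_inv_smul₀ hq, sub_add_cancel]

theorem mem_graph_opMul_modelXstar_modelX_of_mem_graph_relation (hY : IsSelfAdjoint Y)
    {x z : HSum H} (h : (x, z) ∈ ((q : ℂ) ^ 2 • opMul (modelX q c Y) (modelXstar q c Y) +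
      (1 - (q : ℂ) ^ 2) • (opMul (modelY q Y) (modelY q Y) + scalarOp (HSum H) (c : ℂ))).graph) :
    (x, z) ∈ (opMul (modelXstar q c Y) (modelX q c Y)).graph := by
  simp only [mem_graph_add, mem_graph_smul, mem_graph_scalarOp] at h
  obtain ⟨_, _, ⟨z₁, h₁, rfl⟩, ⟨_, ⟨z₂, _, h₂, rfl, rfl⟩, rfl⟩, rfl⟩ := h
  obtain ⟨h₀, h₁⟩ := (mem_graph_opMul_modelX_modelXstar hq₀ hq₁ hc hY _ _).1 h₁
  refine (mem_graph_opMul_modelXstar_modelX hq₀ hq₁ hc hY _ _).2 fun n => ?_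
  obtain ⟨y, hy, hz₂⟩ := (mem_graph_opMul_modelY hq₀.ne' hY _ _).1 h₂ n
  refine ⟨y, hy, ?_⟩
  change (q : ℂ) ^ 2 • z₁ n + (1 - (q : ℂ) ^ 2) • (z₂ n + (c : ℂ) • x n) = _
  cases n with
  | zero =>
    rw [h₀, hz₂]
    simp
  | succ n =>
    obtain ⟨y', hy', hz₁⟩ := h₁ n
    rw [hz₁, hz₂, eq_of_mem_graph hy' hy]
    match_scalars <;> ring

theorem isRepresentation_model (hY : IsSelfAdjoint Y) (hker : HasTrivialKernel Y) :
    IsRepresentation q c (modelX q c Y) (modelY q Y) where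
  dense := dense_domain_modelX hq₀ hq₁ hc hY
  closed := isClosed_modelX hq₀ hq₁ hc hY
  selfAdjoint := isSelfAdjoint_modelY hq₀.ne' hY
  kernel := hasTrivialKernel_modelY hq₀.ne' hker
  rel_YX := opMul_modelY_modelX_le hq₀ hq₁ hc hY
  rel_XX := by
    rw [adjoint_modelX hq₀ hq₁ hc hY]
    exact eq_of_forall_mem_graph_iff fun _ _ =>
      ⟨mem_graph_relation_of_mem_graph_opMul_modelXstar_modelX hq₀ hq₁ hc hY,
        mem_graph_opMul_modelXstar_modelX_of_mem_graph_relation hq₀ hq₁ hc hY⟩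

end Model

/-! ### The representation on a common core -/

section RangesOfPowers

theorem norm_pow_apply_le {𝕜 E : Type*} [NontriviallyNormedField 𝕜] [SeminormedAddCommGroup E]
    [NormedSpace 𝕜 E] (s : E →L[𝕜] E) (n : ℕ) (x : E) : ‖(s ^ n) x‖ ≤ ‖s‖ ^ n * ‖x‖ := by
  induction n with
  | zero => rw [pow_zero, pow_zero, one_mul, one_apply_eq_self]
  | succ n ih =>
    rw [pow_succ', pow_succ', mul_apply_eq_comp, mul_assoc]
    exact s.le_opNorm_of_le ih

theorem dense_iInter_range_pow {𝕜 E : Type*} [NontriviallyNormedField 𝕜] [NormedAddCommGroup E]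
    [NormedSpace 𝕜 E] [CompleteSpace E] {s : E →L[𝕜] E} (hs : DenseRange s) :
    Dense (⋂ n : ℕ, Set.range (s ^ n : E →L[𝕜] E)) := by
  -- Mittag-Leffler: correct `x` to the first term of a sequence `z` with `s (z (k + 1)) = z k`.
  refine fun x => Metric.mem_closure_iff.2 fun ε hε => ?_
  have hstep (n : ℕ) (y : E) : ∃ y', dist y (s y') < ε / 2 / 2 / (2 * max ‖s‖ 1) ^ n :=
    hs.exists_dist_lt y (by positivity)
  choose next hnext using hstep
  let y : ℕ → E := fun n => n.rec x next
  let u : ℕ → ℕ → E := fun k m => (s ^ m) (y (k + m))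
  have hdist (k m : ℕ) : dist (u k m) (u k (m + 1)) ≤ ε / 2 / 2 / 2 ^ m := by
    calc dist (u k m) (u k (m + 1))
        = ‖(s ^ m) (y (k + m) - s (y (k + m + 1)))‖ := by
          rw [map_sub, ← mul_apply_eq_comp, ← pow_succ, ← dist_eq_norm, add_assoc]
      _ ≤ max ‖s‖ 1 ^ m * (ε / 2 / 2 / (2 * max ‖s‖ 1) ^ (k + m)) := by
          refine (norm_pow_apply_le s m _).trans ?_
          gcongr
          · exact le_max_left _ _
          · rw [← dist_eq_norm]
            exact (hnext _ _).le
      _ ≤ max ‖s‖ 1 ^ m * (ε / 2 / 2 / (2 * max ‖s‖ 1) ^ m) := by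
          gcongr
          · exact one_le_mul_of_one_le_of_one_le one_le_two (le_max_right _ _)
          · exact Nat.le_add_left m k
      _ = ε / 2 / 2 / 2 ^ m := by
          rw [mul_pow]
          field_simp
  choose z hz using fun k => cauchySeq_tendsto_of_complete (cauchySeq_of_le_geometric_two (hdist k))
  have hsz (k : ℕ) : s (z (k + 1)) = z k := by
    refine tendsto_nhds_unique (((s.continuous.tendsto _).comp (hz (k + 1))).congr fun m => ?_)
      ((hz k).comp (Filter.tendsto_add_atTop_nat 1))
    change s ((s ^ m) (y (k + 1 + m))) = (s ^ (m + 1)) (y (k + (m + 1)))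
    rw [pow_succ', mul_apply_eq_comp, add_assoc, add_comm 1 m]
  have hpow (n k : ℕ) : (s ^ n) (z (k + n)) = z k := by
    induction n with
    | zero => rfl
    | succ n ih => rw [pow_succ, mul_apply_eq_comp, ← add_assoc, hsz, ih]
  refine ⟨z 0, Set.mem_iInter.2 fun n => ⟨z (0 + n), hpow n 0⟩, ?_⟩
  exact (dist_le_of_le_geometric_two_of_tendsto₀ (hdist 0) (hz 0)).trans_lt (half_lt_self hε)

variable {H : Type u} [NormedAddCommGroup H] [InnerProductSpace ℂ H] {r s : H →L[ℂ] H} {x : H}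

theorem mem_unitaryPart : x ∈ unitaryPart s ↔ ∀ n : ℕ, ∃ y, (s ^ n) y = x :=
  Submodule.mem_iInf _

theorem dense_unitaryPart [CompleteSpace H] (hs : DenseRange s) :
    Dense (unitaryPart s : Set H) := by
  convert dense_iInter_range_pow hs
  ext x
  simp only [SetLike.mem_coe, mem_unitaryPart, Set.mem_iInter, Set.mem_range]

theorem apply_mem_unitaryPart (h : Commute r s) (hx : x ∈ unitaryPart s) :
    r x ∈ unitaryPart s := by
  refine mem_unitaryPart.2 fun n => ?_
  obtain ⟨y, rfl⟩ := mem_unitaryPart.1 hx n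
  exact ⟨r y, (commute_apply (h.pow_right n) y).symm⟩

theorem exists_mem_unitaryPart_apply_eq (hs : Function.Injective s) (hx : x ∈ unitaryPart s) :
    ∃ y ∈ unitaryPart s, s y = x := by
  obtain ⟨y, hy⟩ := mem_unitaryPart.1 hx 1
  rw [pow_one] at hy
  refine ⟨y, mem_unitaryPart.2 fun n => ?_, hy⟩
  obtain ⟨w, hw⟩ := mem_unitaryPart.1 hx (n + 1)
  rw [pow_succ', mul_apply_eq_comp] at hw
  exact ⟨w, hs (hw.trans hy.symm)⟩

theorem map_unitaryPart_mul {a b : H →L[ℂ] H} (hab : Commute a b)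
    (hinj : Function.Injective (a * b)) :
    (unitaryPart (a * b)).map (a : H →ₗ[ℂ] H) = unitaryPart (a * b) := by
  refine le_antisymm (Submodule.map_le_iff_le_comap.2 fun x hx =>
    apply_mem_unitaryPart ((Commute.refl a).mul_right hab) hx) fun x hx => ?_
  obtain ⟨y, hy, rfl⟩ := exists_mem_unitaryPart_apply_eq hinj hx
  exact ⟨b y, apply_mem_unitaryPart (hab.symm.mul_right (Commute.refl b)) hy, rfl⟩

end RangesOfPowers

section StarRepresentation

variable {H : Type u} [NormedAddCommGroup H] [InnerProductSpace ℂ H] {D : Submodule ℂ H}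

theorem exists_end_of_mapsInto {G : Submodule ℂ (H × H)} (hG : ∀ y, ((0 : H), y) ∈ G → y = 0)
    (h : MapsInto G D) : ∃ x : Module.End ℂ D, ∀ d : D, ((d : H), (x d : H)) ∈ G := by
  have huniq {x y z : H} (hy : (x, y) ∈ G) (hz : (x, z) ∈ G) : y = z := by
    have := G.sub_mem hy hz
    rw [Prod.mk_sub_mk, sub_self] at this
    exact sub_eq_zero.1 (hG _ this)
  choose! f hfD hf using h
  exact ⟨{ toFun := fun d => ⟨f d, hfD d d.2⟩
           map_add' := fun d e => Subtype.ext <|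
            huniq (hf _ (d + e).2) (G.add_mem (hf d d.2) (hf e e.2))
           map_smul' := fun k d => Subtype.ext <|
            huniq (hf _ (k • d).2) (G.smul_mem k (hf d d.2)) }, fun d => hf d d.2⟩

theorem IsQuotient.mapsInto {A : H →ₗ.[ℂ] H} {a g : H →L[ℂ] H} (h : IsQuotient A a g)
    (ha : D ≤ D.map (a : H →ₗ[ℂ] H)) (hg : ∀ u ∈ D, g u ∈ D) : MapsInto A.graph D := by
  intro d hd
  obtain ⟨u, hu, rfl⟩ := ha hd
  exact ⟨g u, hg u hu, h.mem_graph u⟩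

theorem IsQuotient.mapsInto_comap_swap {A : H →ₗ.[ℂ] H} {a g : H →L[ℂ] H} (h : IsQuotient A a g)
    (ha : ∀ u ∈ D, a u ∈ D) (hg : D ≤ D.map (g : H →ₗ[ℂ] H)) :
    MapsInto (A.graph.comap (LinearEquiv.prodComm ℂ H H : H × H →ₗ[ℂ] H × H)) D := by
  intro d hd
  obtain ⟨u, hu, rfl⟩ := hg hd
  exact ⟨a u, ha u hu, h.mem_graph u⟩

variable [CompleteSpace H] {q c : ℝ} {X Y : H →ₗ.[ℂ] H} {x x' y y' : Module.End ℂ D}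

namespace IsRepresentation

theorem mul_eq_smul_mul (h : IsRepresentation q c X Y)
    (hx : ∀ d : D, ((d : H), (x d : H)) ∈ X.graph) (hy : ∀ d : D, ((d : H), (y d : H)) ∈ Y.graph) :
    y * x = (q : ℂ) ^ 2 • (x * y) := by
  ext d
  obtain ⟨w, hw, hyx⟩ := (mem_graph_smul _ _ _ _).1 (LinearPMap.le_graph_of_le h.rel_YX
    ((mem_graph_opMul _ _ _ _).2 ⟨_, hx d, hy (x d)⟩))
  rwa [eq_of_mem_graph hw ((mem_graph_opMul _ _ _ _).2 ⟨_, hy d, hx (y d)⟩)] at hyx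

theorem mul_adjoint_eq_smul_mul (h : IsRepresentation q c X Y) (hq : q ≠ 0)
    (hD : Dense (D : Set H)) (hx : ∀ d : D, ((d : H), (x d : H)) ∈ X.graph)
    (hx' : ∀ d : D, ((d : H), (x' d : H)) ∈ X†.graph)
    (hy : ∀ d : D, ((d : H), (y d : H)) ∈ Y.graph) :
    y * x' = ((q : ℂ) ^ 2)⁻¹ • (x' * y) := by
  have hq₂ : (q : ℂ) ^ 2 ≠ 0 := pow_ne_zero 2 (Complex.ofReal_ne_zero.2 hq)
  have hadj (d e : D) : ⟪(e : H), x' d⟫_ℂ = ⟪(x e : H), d⟫_ℂ :=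
    ((mem_graph_adjoint h.dense _ _).1 (hx' d) _ _ (hx e)).symm
  have hsym (d e : D) : ⟪(e : H), y d⟫_ℂ = ⟪(y e : H), d⟫_ℂ :=
    ((mem_graph_iff_of_isSelfAdjoint h.selfAdjoint _ _).1 (hy d) _ _ (hy e)).symm
  have hyx (e : D) : (y (x e) : H) = (q : ℂ) ^ 2 • (x (y e) : H) :=
    congrArg Subtype.val (DFunLike.congr_fun (h.mul_eq_smul_mul hx hy) e)
  ext d
  refine hD.eq_of_inner_right ℂ fun e he => ?_
  change ⟪e, (y (x' d) : H)⟫_ℂ = ⟪e, ((q : ℂ) ^ 2)⁻¹ • (x' (y d) : H)⟫_ℂ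
  rw [inner_smul_right, eq_inv_mul_iff_mul_eq₀ hq₂]
  calc (q : ℂ) ^ 2 * ⟪e, (y (x' d) : H)⟫_ℂ
      = (q : ℂ) ^ 2 * ⟪(x (y ⟨e, he⟩) : H), d⟫_ℂ := by rw [hsym (x' d) ⟨e, he⟩, hadj]
    _ = ⟪(y (x ⟨e, he⟩) : H), d⟫_ℂ := by
        rw [hyx, inner_smul_left, map_pow, Complex.conj_ofReal]
    _ = ⟪e, (x' (y d) : H)⟫_ℂ := by rw [← hsym, ← hadj]

theorem adjoint_mul_sub_eq (h : IsRepresentation q c X Y)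
    (hx : ∀ d : D, ((d : H), (x d : H)) ∈ X.graph)
    (hx' : ∀ d : D, ((d : H), (x' d : H)) ∈ X†.graph)
    (hy : ∀ d : D, ((d : H), (y d : H)) ∈ Y.graph) :
    x' * x - (q : ℂ) ^ 2 • (x * x') = (1 - (q : ℂ) ^ 2) • (y ^ 2 + (c : ℂ) • 1) := by
  rw [sub_eq_iff_eq_add', pow_two y]
  ext d
  have hx'x := (mem_graph_opMul X† X _ _).2 ⟨_, hx d, hx' (x d)⟩
  have hxx' := (mem_graph_opMul X X† _ _).2 ⟨_, hx' d, hx (x' d)⟩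
  have hyy := (mem_graph_opMul Y Y _ _).2 ⟨_, hy d, hy (y d)⟩
  rw [h.rel_XX] at hx'x
  refine eq_of_mem_graph hx'x ?_
  simp only [mem_graph_add, mem_graph_smul, mem_graph_scalarOp]
  exact ⟨_, _, ⟨_, hxx', rfl⟩, ⟨_, ⟨_, _, hyy, rfl, rfl⟩, rfl⟩, rfl⟩

theorem inducesStarRepresentation (h : IsRepresentation q c X Y) (hq : q ≠ 0)
    (hD : Dense (D : Set H)) (hX : X.HasCore D) (hX' : X†.HasCore D) (hY : Y.HasCore D)
    (hDX : MapsInto X.graph D) (hDX' : MapsInto X†.graph D) (hDY : MapsInto Y.graph D)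
    (hDYinv : MapsInto
      (Y.graph.comap (LinearEquiv.prodComm ℂ H H : H × H →ₗ[ℂ] H × H)) D) :
    InducesStarRepresentation q c X Y := by
  have hker := (hasTrivialKernel_iff Y).1 h.kernel
  obtain ⟨x, hx⟩ := exists_end_of_mapsInto (fun _ => (LinearPMap.graph_fst_eq_zero_snd _ · rfl)) hDX
  obtain ⟨x', hx'⟩ :=
    exists_end_of_mapsInto (fun _ => (LinearPMap.graph_fst_eq_zero_snd _ · rfl)) hDX'
  obtain ⟨y, hy⟩ := exists_end_of_mapsInto (fun _ => (LinearPMap.graph_fst_eq_zero_snd _ · rfl)) hDY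
  obtain ⟨y', hy'⟩ := exists_end_of_mapsInto hker hDYinv
  replace hy' : ∀ d : D, ((y' d : H), (d : H)) ∈ Y.graph := hy'
  have hyy' : y * y' = 1 := by
    ext d
    exact eq_of_mem_graph (hy (y' d)) (hy' d)
  have hy'y : y' * y = 1 := by
    ext d
    have := Y.graph.sub_mem (hy' (y d)) (hy d)
    rw [Prod.mk_sub_mk, sub_self] at this
    exact sub_eq_zero.1 (hker _ this)
  exact ⟨D, x, x', y, y', hD, hX, hX', hY, hx, hx', hy, hyy', hy'y, h.mul_eq_smul_mul hx hy,
    h.mul_adjoint_eq_smul_mul hq hD hx hx' hy, h.adjoint_mul_sub_eq hx hx' hy⟩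

end IsRepresentation

theorem exists_common_core (hq₀ : 0 < q) (hq₁ : q < 1) (hc : 0 ≤ c) (hY : IsSelfAdjoint Y)
    (hker : HasTrivialKernel Y) :
    ∃ D : Submodule ℂ H, Dense (D : Set H) ∧
      (∀ n, (weight q c Y n).HasCore D ∧ MapsInto (weight q c Y n).graph D) ∧
      ∀ n : ℕ, ((q : ℂ) ^ n • Y).HasCore D ∧ MapsInto ((q : ℂ) ^ n • Y).graph D ∧ MapsInto
        (((q : ℂ) ^ n • Y).graph.comap (LinearEquiv.prodComm ℂ H H : H × H →ₗ[ℂ] H × H)) D := by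
  obtain ⟨a, b, hab, hp⟩ := exists_isBoundedTransform_of_isSelfAdjoint hY
  have hbinj : Function.Injective b := (injective_iff_map_eq_zero b).2 fun u hu => by
    have := hab.isQuotient.mem_graph u
    rw [hu] at this
    exact (map_eq_zero_iff a hp.injective).1 ((hasTrivialKernel_iff Y).1 hker _ this)
  have hinj : Function.Injective (a * b) := hp.injective.comp hbinj
  have hD : Dense (unitaryPart (a * b) : Set H) :=
    dense_unitaryPart (denseRange_of_injective ((hp.left.commute_iff hp.right).1 hp.commute) hinj)
  have ha := map_unitaryPart_mul hp.commute hinj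
  have hb := map_unitaryPart_mul hp.commute.symm (hp.commute.eq ▸ hinj)
  rw [← hp.commute.eq] at hb
  refine ⟨unitaryPart (a * b), hD, fun n => ?_, fun n => ?_⟩
  · have hW := isQuotient_weight hq₀ hc hab hp n
    refine ⟨hW.hasCore (isSelfAdjoint_weight hq₀ hq₁ hc hY n).isClosed hD ha,
      hW.mapsInto ha.ge fun u => apply_mem_unitaryPart ?_⟩
    exact hp.commute_sqrtNumerator_left.symm.mul_right hp.commute_sqrtNumerator_right.symm
  · have hqn : (q : ℂ) ^ n ≠ 0 := pow_ne_zero n (Complex.ofReal_ne_zero.2 hq₀.ne')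
    have hqY := hab.isQuotient.smul ((q : ℂ) ^ n)
    have hqb : (unitaryPart (a * b)).map (((q : ℂ) ^ n • b : H →L[ℂ] H) : H →ₗ[ℂ] H) =
        unitaryPart (a * b) := by
      rw [ContinuousLinearMap.toLinearMap_smul, Submodule.map_smul _ _ _ hqn, hb]
    exact ⟨hqY.hasCore (isSelfAdjoint_qpow_smul hq₀.ne' hY n).isClosed hD ha,
      hqY.mapsInto ha.ge fun u hu => hqb.le (Submodule.mem_map_of_mem hu),
      hqY.mapsInto_comap_swap (fun u hu => ha.le (Submodule.mem_map_of_mem hu)) hqb.ge⟩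

theorem inducesStarRepresentation_model (hq₀ : 0 < q) (hq₁ : q < 1) (hc : 0 ≤ c)
    (hY : IsSelfAdjoint Y) (hker : HasTrivialKernel Y) :
    InducesStarRepresentation q c (modelX q c Y) (modelY q Y) := by
  obtain ⟨D, hD, hW, hqY⟩ := exists_common_core hq₀ hq₁ hc hY hker
  have hWcl (n : ℕ) := (isSelfAdjoint_weight hq₀ hq₁ hc hY n).isClosed
  have hYcl (n : ℕ) := (isSelfAdjoint_qpow_smul hq₀.ne' hY (2 * n)).isClosed
  refine (isRepresentation_model hq₀ hq₁ hc hY hker).inducesStarRepresentation hq₀.ne'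
    (dense_finSupported hD) (hasCore_finSupported_raisingOp hWcl fun n => (hW n).1) ?_
    (hasCore_finSupported_diagOp hYcl fun n => (hqY (2 * n)).1)
    (mapsInto_graph_raisingOp fun n => (hW n).2) ?_
    (mapsInto_graph_diagOp fun n => (hqY (2 * n)).2.1)
    (mapsInto_comap_swap_graph_diagOp fun n => (hqY (2 * n)).2.2) <;>
  rw [adjoint_modelX hq₀ hq₁ hc hY]
  · exact hasCore_finSupported_loweringOp hWcl (fun n => (hW n).1) hD
  · exact mapsInto_graph_loweringOp fun n => (hW n).2

end StarRepresentation

/-! ### Commuting bounded transforms -/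

section Resolvent

theorem isUnit_one_sub_I_smul {A : Type*} [CStarAlgebra A] {T : A} (hT : IsSelfAdjoint T) :
    IsUnit (1 - Complex.I • T) := by
  have hspec : -Complex.I ∉ spectrum ℂ T := fun h => by
    simpa using congrArg Complex.im (hT.mem_spectrum_eq_re h)
  have hunit := (IsUnit.mk0 Complex.I Complex.I_ne_zero).map (algebraMap ℂ A)
  rw [show 1 - Complex.I • T = algebraMap ℂ A Complex.I * (algebraMap ℂ A (-Complex.I) - T) by
    rw [mul_sub, ← map_mul, mul_neg, Complex.I_mul_I, neg_neg, map_one, Algebra.smul_def]]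
  exact hunit.mul (spectrum.notMem_iff.1 hspec)

theorem commute_of_commute_mul_inv {A : Type*} [Ring A] [Algebra ℂ A] {J T : A} {k : Aˣ} {z : ℂ}
    (hk : (k : A) = 1 - z • T) (h : Commute J (T * ↑k⁻¹)) : Commute J T := by
  have hinv : (↑k⁻¹ : A) = 1 + z • (T * ↑k⁻¹) := by
    rw [← k.mul_inv, hk, sub_mul, one_mul, smul_mul_assoc, sub_add_cancel]
  have hJk : Commute J (k : A) := by
    rw [← Commute.units_inv_right_iff, hinv]
    exact (Commute.one_right J).add_right (h.smul_right z)
  rw [← mul_one T, ← k.inv_mul, ← mul_assoc]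
  exact h.mul_right hJk

theorem commute_mul_of_commute_mul_add_I_smul {A : Type*} [Ring A] [StarRing A] [Algebra ℂ A]
    [StarModule ℂ A] {a b T : A} (ha : IsSelfAdjoint a) (hb : IsSelfAdjoint b) (hab : Commute a b)
    (hT : IsSelfAdjoint T) (h : Commute (a * (b + Complex.I • a)) T) :
    Commute (a * a) T ∧ Commute (a * b) T := by
  have hJ : a * (b + Complex.I • a) = a * b + Complex.I • (a * a) := by
    rw [mul_add, mul_smul_comm]
  have hstar : star (a * b + Complex.I • (a * a)) = a * b - Complex.I • (a * a) := by
    rw [star_add, star_smul, star_mul, star_mul, ha.star_eq, hb.star_eq, ← hab.eq, Complex.star_def,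
      Complex.conj_I, neg_smul, sub_eq_add_neg]
  rw [hJ] at h
  have h' := h.star_star
  rw [hT.star_eq, hstar] at h'
  have haa : Commute (a * a) T := by
    have hdiff := (h.sub_left h').smul_left (2 * Complex.I)⁻¹
    rwa [add_sub_sub_cancel, ← two_smul ℂ, smul_smul, smul_smul, mul_assoc,
      inv_mul_cancel₀ (by simp), one_smul] at hdiff
  refine ⟨haa, ?_⟩
  simpa only [add_sub_cancel_right] using h.sub_left (haa.smul_left Complex.I)

variable {H : Type u} [NormedAddCommGroup H] [InnerProductSpace ℂ H] {A Y : H →ₗ.[ℂ] H}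
  {a g n s t S T : H →L[ℂ] H} {z : ℂ}

theorem IsQuotient.isResolventAt (h : IsQuotient A a g) (hleft : n * (g - z • a) = 1)
    (hright : (g - z • a) * n = 1) : IsResolventAt A z (a * n) := by
  constructor
  · intro y
    obtain ⟨x, hx, hAx⟩ := (LinearPMap.mem_graph_iff A).1 (h.mem_graph (n y))
    dsimp only at hx hAx
    have hy : (a * n) y = x := by rw [mul_apply_eq_comp, hx]
    refine ⟨hy ▸ x.2, ?_⟩
    rw [show (⟨(a * n) y, hy ▸ x.2⟩ : A.domain) = x from Subtype.ext hy, hAx]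
    exact DFunLike.congr_fun hright y
  · intro x
    obtain ⟨u, hu, hAu⟩ := (h _ _).1 (A.mem_graph x)
    rw [← hu, ← hAu]
    exact congrArg a (DFunLike.congr_fun hleft u)

theorem IsQuotient.isResolventAt_I (h : IsQuotient A a g) (hag : Commute a g)
    (hadd : a * a + g * g = 1) : IsResolventAt A Complex.I (a * (g + Complex.I • a)) := by
  have hcomm : Commute g (Complex.I • a) := hag.symm.smul_right _
  have hone : g * g - Complex.I • a * Complex.I • a = 1 := by
    rw [smul_mul_smul_comm, Complex.I_mul_I, neg_one_smul, sub_neg_eq_add, add_comm, hadd]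
  exact h.isResolventAt (by rw [← hcomm.mul_self_sub_mul_self_eq, hone])
    (by rw [← hcomm.mul_self_sub_mul_self_eq', hone])

variable [CompleteSpace H]

theorem StronglyCommute.commute (h : StronglyCommute Y A) (hY : IsBoundedTransform Y s t)
    (hst : IsQuotientPair s t) (hA : IsQuotient A T S) (hT : IsSelfAdjoint T) (hTS : T + S = 1) :
    Commute T s ∧ Commute T t := by
  have hone : s * s + t * t = 1 := by
    rw [← hY.sq_add, hst.right.star_eq]
  obtain ⟨k, hk⟩ := isUnit_one_sub_I_smul hT
  have hSk : S - (-1 + Complex.I) • T = k := by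
    rw [hk, ← hTS, add_smul, neg_one_smul]
    abel
  have hresA : IsResolventAt A (-1 + Complex.I) (T * ↑k⁻¹) :=
    hA.isResolventAt (by rw [hSk, k.inv_mul]) (by rw [hSk, k.mul_inv])
  have hres : Commute (s * (t + Complex.I • s)) (T * ↑k⁻¹) :=
    h _ _ _ _ (by simp) (by simp) (hY.isQuotient.isResolventAt_I hst.commute hone) hresA
  obtain ⟨hss, hs_t⟩ := commute_mul_of_commute_mul_add_I_smul hst.left hst.right hst.commute hT
    (commute_of_commute_mul_inv hk hres)
  have hs : Commute s T := commute_of_mul_self_commute hY.nonneg hss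
  refine ⟨hs.symm, ContinuousLinearMap.ext fun x => hst.injective ?_⟩
  rw [mul_apply_eq_comp, mul_apply_eq_comp, commute_apply hs]
  exact (commute_apply hs_t x).symm

end Resolvent

section JointTransform

variable {K : Type u} [NormedAddCommGroup K] [InnerProductSpace ℂ K] [CompleteSpace K]
  {X Y : K →ₗ.[ℂ] K}

/-- Joint bounded transforms of the two operators of a well-behaved representation: `X = v |X|`
with `|X| = b a⁻¹`, and `Y = t s⁻¹`. Strong commutativity of `Y` and `X^* X` takes the form that
the bounded operators `a`, `b` commute with `s`, `t`. -/
structure IsJointTransform (X Y : K →ₗ.[ℂ] K) (a b v s t : K →L[ℂ] K) : Prop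
    extends IsPolarTransform X a b v where
  isQuotient_Y : IsQuotient Y s t
  isQuotientPair_Y : IsQuotientPair s t
  commute_a_s : Commute a s
  commute_a_t : Commute a t
  commute_b_s : Commute b s
  commute_b_t : Commute b t

theorem exists_isJointTransform (hd : Dense (X.domain : Set K)) (hX : X.IsClosed)
    (hker : HasTrivialKernel X) (hY : IsSelfAdjoint Y)
    (hcomm : StronglyCommute Y (opMul X† X)) :
    ∃ a b v s t : K →L[ℂ] K, IsJointTransform X Y a b v s t := by
  obtain ⟨a, b, v, hp⟩ := exists_isPolarTransform hd hX hker
  obtain ⟨s, t, hs, hst⟩ := exists_isBoundedTransform_of_isSelfAdjoint hY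
  have haa : IsSelfAdjoint (a * a) :=
    (hp.isSelfAdjoint_left.commute_iff hp.isSelfAdjoint_left).1 (Commute.refl a)
  have hb {r : K →L[ℂ] K} (hr : Commute (a * a) r) : Commute b r := by
    refine commute_of_mul_self_commute hp.nonneg_right ?_
    rw [eq_sub_of_add_eq' hp.sq_add_sq]
    exact (Commute.one_left r).sub_left hr
  obtain ⟨hcs, hct⟩ := hcomm.commute hs hst hp.isQuotient_adjoint_mul_self haa hp.sq_add_sq
  exact ⟨a, b, v, s, t, hp, hs.isQuotient, hst, commute_of_mul_self_commute hp.nonneg_left hcs,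
    commute_of_mul_self_commute hp.nonneg_left hct, hb hcs, hb hct⟩

end JointTransform

/-! ### The polar decomposition of `X` and the operator `Y` -/

section Scaling

variable {K : Type u} [NormedAddCommGroup K] [InnerProductSpace ℂ K] [CompleteSpace K]
  {q c : ℝ} {X Y : K →ₗ.[ℂ] K} {a b v s t r : K →L[ℂ] K} {x y w z : K}

namespace IsRepresentation

theorem exists_relation (h : IsRepresentation q c X Y) (hxz : (x, z) ∈ (opMul X† X).graph) :
    ∃ z' y y', (x, z') ∈ (opMul X X†).graph ∧ (x, y) ∈ Y.graph ∧ (y, y') ∈ Y.graph ∧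
      z = (q : ℂ) ^ 2 • z' + (1 - (q : ℂ) ^ 2) • (y' + (c : ℂ) • x) := by
  rw [h.rel_XX, mem_graph_add] at hxz
  obtain ⟨_, _, h₁, h₂, rfl⟩ := hxz
  obtain ⟨z', hz', rfl⟩ := (mem_graph_smul _ _ _ _).1 h₁
  obtain ⟨_, h₃, rfl⟩ := (mem_graph_smul _ _ _ _).1 h₂
  obtain ⟨y', _, hy', hcx, rfl⟩ := (mem_graph_add _ _ _ _).1 h₃
  obtain ⟨y, hy, hyy'⟩ := (mem_graph_opMul _ _ _ _).1 hy'
  rw [mem_graph_scalarOp] at hcx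
  subst hcx
  exact ⟨z', y, y', hz', hy, hyy', rfl⟩

theorem hasTrivialKernel_X (h : IsRepresentation q c X Y) (hq : q ^ 2 < 1) (hc : 0 ≤ c) :
    HasTrivialKernel X := by
  refine (hasTrivialKernel_iff X).2 fun x hx => (hasTrivialKernel_iff Y).1 h.kernel x ?_
  obtain ⟨z', y, y', hz', hy, hyy', hrel⟩ :=
    h.exists_relation ((mem_graph_opMul _ _ _ _).2 ⟨0, hx, X†.graph.zero_mem⟩)
  obtain ⟨m, hm, hmz⟩ := (mem_graph_opMul _ _ _ _).1 hz'
  have hinner := congrArg (fun w => ⟪w, x⟫_ℂ) hrel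
  simp only [inner_zero_left, inner_add_left, inner_smul_left, map_sub, map_pow, map_one,
    Complex.conj_ofReal, (mem_graph_adjoint h.dense _ _).1 hm _ _ hmz,
    (mem_graph_iff_of_isSelfAdjoint h.selfAdjoint _ _).1 hy _ _ hyy',
    inner_self_eq_ofReal] at hinner
  have hsum : 0 = q ^ 2 * ‖m‖ ^ 2 + (1 - q ^ 2) * (‖y‖ ^ 2 + c * ‖x‖ ^ 2) := by
    exact_mod_cast hinner
  have hy0 : y = 0 := by
    by_contra hne
    have hpos : 0 < (1 - q ^ 2) * (‖y‖ ^ 2 + c * ‖x‖ ^ 2) :=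
      mul_pos (sub_pos.2 hq) (by positivity)
    have hnonneg : 0 ≤ q ^ 2 * ‖m‖ ^ 2 := by positivity
    linarith
  rwa [hy0] at hy

theorem map_mem_graph_mul_adjoint (h : IsRepresentation q c X Y) (hq : q ≠ 0)
    (hX : ∀ x z, (x, z) ∈ (opMul X† X).graph → (r x, r z) ∈ (opMul X† X).graph)
    (hY : ∀ x y, (x, y) ∈ Y.graph → (r x, r y) ∈ Y.graph) (hxz : (x, z) ∈ (opMul X† X).graph)
    (hw : (x, w) ∈ (opMul X X†).graph) : (r x, r w) ∈ (opMul X X†).graph := by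
  obtain ⟨_, y, y', hw', hy, hyy', rfl⟩ := h.exists_relation hxz
  obtain ⟨w', η, η', hrw, hη, hηη', hrel⟩ := h.exists_relation (hX _ _ hxz)
  obtain rfl := eq_of_mem_graph hw hw'
  obtain rfl := eq_of_mem_graph hη (hY _ _ hy)
  obtain rfl := eq_of_mem_graph hηη' (hY _ _ hyy')
  simp only [map_add, map_smul] at hrel
  have hq2 : (q : ℂ) ^ 2 ≠ 0 := pow_ne_zero _ (Complex.ofReal_ne_zero.2 hq)
  rwa [smul_right_injective K hq2 (add_right_cancel hrel)]

end IsRepresentation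

namespace IsJointTransform

theorem exists_mem_graph_adjoint (hj : IsJointTransform X Y a b v s t)
    (h : IsRepresentation q c X Y) (hq : q ≠ 0) (hker : HasTrivialKernel X)
    (hxz : (x, z) ∈ (opMul X† X).graph) :
    ∃ m n, (s x, m) ∈ X†.graph ∧ (t x, n) ∈ X†.graph ∧ (m, ((q : ℂ) ^ 2)⁻¹ • n) ∈ Y.graph := by
  have hq2 : (q : ℂ) ^ 2 ≠ 0 := pow_ne_zero _ (Complex.ofReal_ne_zero.2 hq)
  obtain ⟨w, -, -, hw, -, -, -⟩ := h.exists_relation hxz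
  have hmap {r : K →L[ℂ] K} (hra : Commute a r) (hrb : Commute b r) (hrs : Commute r s)
      (hrt : Commute r t) : (r x, r w) ∈ (opMul X X†).graph :=
    h.map_mem_graph_mul_adjoint hq
      (fun _ _ => hj.isQuotient_adjoint_mul_self.map_mem_graph (hra.mul_left hra).symm
        (hrb.mul_left hrb).symm)
      (fun _ _ => hj.isQuotient_Y.map_mem_graph hrs hrt) hxz hw
  have hst := hj.isQuotientPair_Y.commute
  obtain ⟨m, hm, hmw⟩ := (mem_graph_opMul _ _ _ _).1
    (hmap hj.commute_a_s hj.commute_b_s (Commute.refl s) hst)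
  obtain ⟨n, hn, hnw⟩ := (mem_graph_opMul _ _ _ _).1
    (hmap hj.commute_a_t hj.commute_b_t hst.symm (Commute.refl t))
  have hYX : (m, t w) ∈ (opMul Y X).graph :=
    (mem_graph_opMul _ _ _ _).2 ⟨s w, hmw, hj.isQuotient_Y.mem_graph w⟩
  obtain ⟨_, hXY, htw⟩ := (mem_graph_smul _ _ _ _).1 (LinearPMap.le_graph_of_le h.rel_YX hYX)
  obtain ⟨l, hml, hl⟩ := (mem_graph_opMul _ _ _ _).1 hXY
  have hln : ((q : ℂ) ^ 2 • l - n, 0) ∈ X.graph := by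
    have hsub := X.graph.sub_mem (X.graph.smul_mem ((q : ℂ) ^ 2) hl) hnw
    rwa [Prod.smul_mk, ← htw, Prod.mk_sub_mk, sub_self] at hsub
  refine ⟨m, n, hm, hn, ?_⟩
  rwa [← sub_eq_zero.1 ((hasTrivialKernel_iff X).1 hker _ hln), inv_smul_smul₀ hq2]

theorem smul_mul_star_mul (hj : IsJointTransform X Y a b v s t) (h : IsRepresentation q c X Y)
    (hq : q ≠ 0) (hker : HasTrivialKernel X) :
    (q : ℂ) ^ 2 • (t * star v * s) = s * star v * t := by
  have hq2 : (q : ℂ) ^ 2 ≠ 0 := pow_ne_zero _ (Complex.ofReal_ne_zero.2 hq)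
  have haa : DenseRange (a * a) := hj.denseRange.comp hj.denseRange a.continuous
  refine eq_of_mul_eq_mul_of_denseRange haa
    (ContinuousLinearMap.ext fun p => hj.injective_right ?_)
  obtain ⟨m, n, hm, hn, hmn⟩ :=
    hj.exists_mem_graph_adjoint h hq hker (hj.isQuotient_adjoint_mul_self.mem_graph p)
  rw [hj.mem_graph_adjoint_iff] at hm hn
  have hY := hj.isQuotient_Y.map_mem_graph hj.commute_a_s hj.commute_a_t hmn
  rw [hj.isQuotient_Y.mem_graph_iff hj.isQuotientPair_Y, map_smul, map_smul,
    eq_inv_smul_iff₀ hq2, ← hm, ← hn] at hY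
  simp only [mul_apply_eq_comp, smul_apply, map_smul] at hY ⊢
  rw [commute_apply hj.commute_b_t, commute_apply hj.commute_b_s, hY]

end IsJointTransform

/-- The operator inclusions `r v Y ⊆ Y v` and `r⁻¹ v^* Y ⊆ Y v^*`: the bounded operator `v`
multiplies `Y` by `r`. For a partial isometry `v` both are needed in order that the range of `v`
reduces `Y`. -/
structure IsScaledBy (Y : K →ₗ.[ℂ] K) (v : K →L[ℂ] K) (r : ℂ) : Prop where
  map_mem_graph : ∀ {x y}, (x, y) ∈ Y.graph → (v x, r • v y) ∈ Y.graph
  star_map_mem_graph : ∀ {x y}, (x, y) ∈ Y.graph → (star v x, r⁻¹ • star v y) ∈ Y.graph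

theorem IsJointTransform.isScaledBy (hj : IsJointTransform X Y a b v s t)
    (h : IsRepresentation q c X Y) (hq : q ≠ 0) (hker : HasTrivialKernel X) :
    IsScaledBy Y v ((q : ℂ) ^ 2) where
  star_map_mem_graph hxy := by
    obtain ⟨u, rfl, rfl⟩ := (hj.isQuotient_Y _ _).1 hxy
    rw [hj.isQuotient_Y.mem_graph_iff hj.isQuotientPair_Y, map_smul,
      eq_inv_smul_iff₀ (pow_ne_zero _ (Complex.ofReal_ne_zero.2 hq))]
    exact DFunLike.congr_fun (hj.smul_mul_star_mul h hq hker) u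
  map_mem_graph hxy := by
    obtain ⟨u, rfl, rfl⟩ := (hj.isQuotient_Y _ _).1 hxy
    rw [hj.isQuotient_Y.mem_graph_iff hj.isQuotientPair_Y, map_smul]
    have hstar := congrArg star (hj.smul_mul_star_mul h hq hker)
    simp only [star_smul, star_mul, star_star, hj.isQuotientPair_Y.left.star_eq,
      hj.isQuotientPair_Y.right.star_eq, star_pow, Complex.star_def, Complex.conj_ofReal,
      ← mul_assoc] at hstar
    exact (DFunLike.congr_fun hstar u).symm

end Scaling

/-! ### The unitary part -/

section UnitaryPart

variable {K : Type u} [NormedAddCommGroup K] [InnerProductSpace ℂ K]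

theorem eq_bot_of_reduces {M : Submodule ℂ K} {A : K →ₗ.[ℂ] K} (hA : Dense (A.domain : Set K))
    (hred : Reduces M A) (h : ∀ x : A.domain, (x : K) ∈ M → (x : K) = 0) : M = ⊥ := by
  have hmem (x : A.domain) : (x : K) ∈ Mᗮ := by
    obtain ⟨y, z, hxyz, hy, -, hz, -⟩ := hred x
    rwa [hxyz, h y hy, zero_add]
  have htop : Mᗮ = ⊤ := by
    rw [← (Submodule.isClosed_orthogonal M).submodule_topologicalClosure_eq,
      ← Submodule.dense_iff_topologicalClosure_eq_top]
    exact hA.mono fun x hx => hmem ⟨x, hx⟩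
  exact (Submodule.eq_bot_iff M).2 fun x hx =>
    inner_self_eq_zero.1 ((htop ▸ Submodule.mem_top : x ∈ Mᗮ) x hx)

variable [CompleteSpace K] {q c : ℝ} {X Y : K →ₗ.[ℂ] K} {a b v : K →L[ℂ] K} {x y z : K}

theorem inner_map_left (v : K →L[ℂ] K) (x y : K) : ⟪v x, y⟫_ℂ = ⟪x, star v y⟫_ℂ := by
  rw [ContinuousLinearMap.star_eq_adjoint, ContinuousLinearMap.adjoint_inner_right]

namespace IsPolarTransform

theorem exists_mem_graph_adjoint_mul (hp : IsPolarTransform X a b v)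
    (h : (x, z) ∈ (opMul X X†).graph) :
    ∃ w, (star v x, w) ∈ (QSphere.opMul X† X).graph ∧ v w = z := by
  obtain ⟨m, hxm, hmz⟩ := (mem_graph_opMul _ _ _ _).1 h
  obtain ⟨u, rfl, rfl⟩ := (hp.isQuotient _ _).1 hmz
  obtain ⟨p, hpx, hpu⟩ := hp.isQuotientPair.exists_of_eq ((hp.mem_graph_adjoint_iff _ _).1 hxm)
  obtain ⟨r, rfl, rfl⟩ := hp.isQuotientPair.exists_of_eq hpu
  refine ⟨b (b r), ?_, rfl⟩
  rw [← hpx]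
  exact hp.isQuotient_adjoint_mul_self.mem_graph r

theorem exists_relation (hp : IsPolarTransform X a b v) (h : IsRepresentation q c X Y)
    (hxz : (x, z) ∈ (QSphere.opMul X† X).graph) :
    ∃ w y y', (star v x, w) ∈ (QSphere.opMul X† X).graph ∧ (x, y) ∈ Y.graph ∧ (y, y') ∈ Y.graph ∧
      z = (q : ℂ) ^ 2 • v w + (1 - (q : ℂ) ^ 2) • (y' + (c : ℂ) • x) := by
  obtain ⟨z', y, y', hz', hy, hyy', rfl⟩ := h.exists_relation hxz
  obtain ⟨w, hw, rfl⟩ := hp.exists_mem_graph_adjoint_mul hz'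
  exact ⟨w, y, y', hw, hy, hyy', rfl⟩

theorem exists_re_inner_eq (hp : IsPolarTransform X a b v) (h : IsRepresentation q c X Y)
    (hxz : (x, z) ∈ (QSphere.opMul X† X).graph) :
    ∃ w y, (star v x, w) ∈ (QSphere.opMul X† X).graph ∧ (x, y) ∈ Y.graph ∧
      (⟪z, x⟫_ℂ).re =
        q ^ 2 * (⟪w, star v x⟫_ℂ).re + (1 - q ^ 2) * (‖y‖ ^ 2 + c * ‖x‖ ^ 2) := by
  obtain ⟨w, y, y', hw, hy, hyy', rfl⟩ := hp.exists_relation h hxz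
  refine ⟨w, y, hw, hy, ?_⟩
  have hinner : ⟪y', x⟫_ℂ = ⟪y, y⟫_ℂ :=
    (mem_graph_iff_of_isSelfAdjoint h.selfAdjoint _ _).1 hy _ _ hyy'
  have hone : 1 - (q : ℂ) ^ 2 = ((1 - q ^ 2 : ℝ) : ℂ) := by norm_cast
  rw [hone, ← Complex.ofReal_pow]
  simp only [inner_add_left, inner_smul_left, Complex.conj_ofReal, inner_map_left, hinner,
    inner_self_eq_ofReal, Complex.add_re, Complex.re_ofReal_mul, Complex.ofReal_re]

theorem mul_norm_sq_le_re_inner (hp : IsPolarTransform X a b v) (h : IsRepresentation q c X Y)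
    (hs : IsScaledBy Y v ((q : ℂ) ^ 2)) (hq₁ : q ^ 2 ≤ 1) (hc : 0 ≤ c)
    (hxz : (x, z) ∈ (QSphere.opMul X† X).graph) (hxy : (x, y) ∈ Y.graph)
    (hx : x ∈ unitaryPart v) (n : ℕ) :
    n * ((1 - q ^ 2) * ‖y‖ ^ 2) ≤ (⟪z, x⟫_ℂ).re := by
  induction n generalizing x y z with
  | zero => simpa using re_inner_nonneg_of_mem_graph_adjoint_mul h.dense hxz
  | succ n ih =>
    obtain ⟨w, y', hw, hy', henergy⟩ := hp.exists_re_inner_eq h hxz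
    obtain rfl := eq_of_mem_graph hy' hxy
    have hinj : Function.Injective v := Function.LeftInverse.injective hp.star_apply_apply
    obtain ⟨x₁, hx₁, rfl⟩ := exists_mem_unitaryPart_apply_eq hinj hx
    rw [hp.star_apply_apply] at hw henergy
    have hy₁ := hs.star_map_mem_graph hy'
    rw [hp.star_apply_apply] at hy₁
    set y₁ := ((q : ℂ) ^ 2)⁻¹ • star v y'
    have hnorm : ‖y'‖ = q ^ 2 * ‖y₁‖ := by
      rw [eq_of_mem_graph hy' (hs.map_mem_graph hy₁), norm_smul, hp.norm_apply, norm_pow,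
        Complex.norm_real, Real.norm_eq_abs, sq_abs]
    have hle : ‖y'‖ ^ 2 ≤ q ^ 2 * ‖y₁‖ ^ 2 := by
      rw [hnorm, mul_pow, pow_two (q ^ 2), mul_assoc]
      exact mul_le_of_le_one_left (by positivity) hq₁
    have := sub_nonneg.2 hq₁
    calc ((n + 1 : ℕ) : ℝ) * ((1 - q ^ 2) * ‖y'‖ ^ 2)
        = n * ((1 - q ^ 2) * ‖y'‖ ^ 2) + (1 - q ^ 2) * ‖y'‖ ^ 2 := by push_cast; ring
      _ ≤ n * ((1 - q ^ 2) * (q ^ 2 * ‖y₁‖ ^ 2)) +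
          (1 - q ^ 2) * (‖y'‖ ^ 2 + c * ‖v x₁‖ ^ 2) := by
        gcongr
        exact le_add_of_nonneg_right (by positivity)
      _ = q ^ 2 * (n * ((1 - q ^ 2) * ‖y₁‖ ^ 2)) +
          (1 - q ^ 2) * (‖y'‖ ^ 2 + c * ‖v x₁‖ ^ 2) := by ring
      _ ≤ (⟪z, v x₁⟫_ℂ).re := by
        rw [henergy]
        gcongr
        exact ih hw hy₁ hx₁

theorem eq_zero_of_mem_unitaryPart (hp : IsPolarTransform X a b v) (h : IsRepresentation q c X Y)
    (hs : IsScaledBy Y v ((q : ℂ) ^ 2)) (hq₁ : q ^ 2 < 1) (hc : 0 ≤ c)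
    (hxz : (x, z) ∈ (QSphere.opMul X† X).graph) (hx : x ∈ unitaryPart v) : x = 0 := by
  obtain ⟨_, y, -, hxy, -⟩ := hp.exists_re_inner_eq h hxz
  refine (hasTrivialKernel_iff Y).1 h.kernel x ?_
  suffices y = 0 by rwa [this] at hxy
  by_contra hy
  have hpos : 0 < (1 - q ^ 2) * ‖y‖ ^ 2 := mul_pos (sub_pos.2 hq₁) (by positivity)
  obtain ⟨n, hn⟩ := exists_lt_nsmul hpos (⟪z, x⟫_ℂ).re
  rw [nsmul_eq_mul] at hn
  exact hn.not_ge (hp.mul_norm_sq_le_re_inner h hs hq₁.le hc hxz hxy hx n)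

end IsPolarTransform

theorem IsPolarTransform.unitaryPart_eq_bot (hp : IsPolarTransform X a b v)
    (h : IsRepresentation q c X Y) (hs : IsScaledBy Y v ((q : ℂ) ^ 2))
    (hred : Reduces (unitaryPart v) (QSphere.opMul X† X)) (hq₁ : q ^ 2 < 1) (hc : 0 ≤ c) :
    unitaryPart v = ⊥ :=
  eq_bot_of_reduces
    (hp.isQuotient_adjoint_mul_self.dense_domain (hp.denseRange.comp hp.denseRange a.continuous))
    hred fun x hx => hp.eq_zero_of_mem_unitaryPart h hs hq₁ hc (LinearPMap.mem_graph _ x) hx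

end UnitaryPart

/-! ### The Wold decomposition -/

section Wold

variable {K : Type u} [NormedAddCommGroup K] [InnerProductSpace ℂ K] [CompleteSpace K]
  {v : K →L[ℂ] K}

/-- The wandering subspace `ker v*` of an isometry `v`, the initial summand of its Wold
decomposition. -/
noncomputable abbrev wandering (v : K →L[ℂ] K) : Submodule ℂ K :=
  LinearMap.ker (star v : K →L[ℂ] K).toLinearMap

theorem map_mem_orthogonal_wandering (v : K →L[ℂ] K) (x : K) : v x ∈ (wandering v)ᗮ :=
  (Submodule.mem_orthogonal' _ _).2 fun w hw => by
    rw [inner_map_left, show star v w = 0 from hw, inner_zero_right]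

theorem star_pow_apply_pow_apply (hv : star v * v = 1) (n : ℕ) (x : K) :
    (star v ^ n) ((v ^ n) x) = x :=
  DFunLike.congr_fun (pow_mul_pow_eq_one n hv) x

theorem inner_pow_apply_left (v : K →L[ℂ] K) (n : ℕ) (x y : K) :
    ⟪(v ^ n) x, y⟫_ℂ = ⟪x, (star v ^ n) y⟫_ℂ := by
  rw [inner_map_left, star_pow]

theorem norm_pow_apply (hv : star v * v = 1) (n : ℕ) (x : K) : ‖(v ^ n) x‖ = ‖x‖ :=
  norm_apply_eq_of_star_mul_self_eq (b := 1)
    (by rw [star_pow, pow_mul_pow_eq_one n hv, star_one, one_mul]) x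

theorem starProjection_wandering (hv : star v * v = 1) (x : K) :
    (wandering v).starProjection x = x - v (star v x) := by
  refine Submodule.eq_starProjection_of_mem_orthogonal ?_ ?_
  · change star v (x - v (star v x)) = 0
    rw [map_sub, sub_eq_zero]
    exact (DFunLike.congr_fun hv (star v x)).symm
  · rw [sub_sub_cancel]
    exact map_mem_orthogonal_wandering v _

/-- The embedding of the wandering subspace of an isometry `v` as the summand `vⁿ ker v*`. -/
noncomputable def wanderingEmbedding (hv : star v * v = 1) (n : ℕ) : wandering v →ₗᵢ[ℂ] K where
  toLinearMap := (v ^ n).toLinearMap ∘ₗ (wandering v).subtype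
  norm_map' w := norm_pow_apply hv n (w : K)

theorem wanderingEmbedding_apply (hv : star v * v = 1) (n : ℕ) (w : wandering v) :
    wanderingEmbedding hv n w = (v ^ n) (w : K) := rfl

theorem inner_wanderingEmbedding_of_lt (hv : star v * v = 1) {m n : ℕ} (h : m < n)
    (w w' : wandering v) : ⟪wanderingEmbedding hv m w, wanderingEmbedding hv n w'⟫_ℂ = 0 := by
  obtain ⟨k, rfl⟩ := Nat.exists_eq_add_of_lt h
  rw [wanderingEmbedding_apply, wanderingEmbedding_apply, inner_pow_apply_left, add_assoc, pow_add,
    mul_apply_eq_comp, star_pow_apply_pow_apply hv, pow_succ', mul_apply_eq_comp]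
  exact map_mem_orthogonal_wandering v _ w w.2

theorem orthogonalFamily_wanderingEmbedding (hv : star v * v = 1) :
    OrthogonalFamily ℂ (fun _ : ℕ => wandering v) (wanderingEmbedding hv) := fun m n hmn w w' => by
  rcases lt_or_gt_of_ne hmn with h | h
  · exact inner_wanderingEmbedding_of_lt hv h w w'
  · exact inner_eq_zero_symm.1 (inner_wanderingEmbedding_of_lt hv h w' w)

theorem mem_unitaryPart_of_forall_mem_orthogonal (hv : star v * v = 1) {x : K}
    (h : ∀ n, (star v ^ n) x ∈ (wandering v)ᗮ) : x ∈ unitaryPart v := by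
  have hstep (n : ℕ) : v ((star v ^ (n + 1)) x) = (star v ^ n) x := by
    have hproj := (Submodule.starProjection_apply_eq_zero_iff (wandering v)).2 (h n)
    rw [starProjection_wandering hv, sub_eq_zero] at hproj
    rw [pow_succ', mul_apply_eq_comp, ← hproj]
  refine mem_unitaryPart.2 fun n => ⟨(star v ^ n) x, ?_⟩
  induction n with
  | zero => rfl
  | succ n ih => rw [pow_succ v, mul_apply_eq_comp, hstep, ih]

theorem isHilbertSum_wanderingEmbedding (hv : star v * v = 1) (h : unitaryPart v = ⊥) :
    IsHilbertSum ℂ (fun _ : ℕ => wandering v) (wanderingEmbedding hv) := by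
  refine .mk (orthogonalFamily_wanderingEmbedding hv) ?_
  rw [top_le_iff, Submodule.topologicalClosure_eq_top_iff, Submodule.eq_bot_iff]
  intro x hx
  rw [← Submodule.mem_bot ℂ, ← h]
  refine mem_unitaryPart_of_forall_mem_orthogonal hv fun n => (Submodule.mem_orthogonal _ _).2
    fun w hw => ?_
  rw [← inner_pow_apply_left]
  exact hx _ (Submodule.mem_iSup_of_mem n ⟨⟨w, hw⟩, rfl⟩)

variable (hv : star v * v = 1) (h : unitaryPart v = ⊥)

/-- The unitary of the Wold decomposition of an isometry `v` without unitary part: it carries `v`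
to the unilateral shift on `⨁ₙ ker v*`. -/
noncomputable def woldEquiv : K ≃ₗᵢ[ℂ] HSum (wandering v) :=
  (isHilbertSum_wanderingEmbedding hv h).linearIsometryEquiv

theorem woldEquiv_apply (x : K) (n : ℕ) :
    woldEquiv hv h x n = (wandering v).orthogonalProjectionOnto ((star v ^ n) x) := by
  refine ext_inner_left ℂ fun w =>
    (lp.inner_single_left (𝕜 := ℂ) n w (woldEquiv hv h x)).symm.trans ?_
  rw [Submodule.inner_orthogonalProjectionOnto_eq_of_mem_left, ← inner_pow_apply_left,
    ← wanderingEmbedding_apply hv,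
    ← IsHilbertSum.linearIsometryEquiv_symm_apply_single (isHilbertSum_wanderingEmbedding hv h)]
  exact ((woldEquiv hv h).symm.inner_map_eq_flip _ _).symm

theorem woldEquiv_apply_zero (x : K) :
    woldEquiv hv h x 0 = (wandering v).orthogonalProjectionOnto x :=
  woldEquiv_apply hv h x 0

theorem woldEquiv_map_zero (x : K) : woldEquiv hv h (v x) 0 = 0 := by
  rw [woldEquiv_apply_zero, Submodule.orthogonalProjectionOnto_eq_zero_iff]
  exact map_mem_orthogonal_wandering v x

theorem woldEquiv_star_apply (x : K) (n : ℕ) :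
    woldEquiv hv h (star v x) n = woldEquiv hv h x (n + 1) := by
  rw [woldEquiv_apply, woldEquiv_apply, pow_succ, mul_apply_eq_comp]

theorem woldEquiv_map_succ (x : K) (n : ℕ) :
    woldEquiv hv h (v x) (n + 1) = woldEquiv hv h x n := by
  rw [← woldEquiv_star_apply]
  exact congrArg (fun y => woldEquiv hv h y n) (DFunLike.congr_fun hv x)

theorem map_star_apply_of_woldEquiv_zero {x : K} (hx : woldEquiv hv h x 0 = 0) :
    v (star v x) = x := by
  rw [woldEquiv_apply_zero, ← Submodule.coe_eq_zero, ← Submodule.starProjection_apply,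
    starProjection_wandering hv, sub_eq_zero] at hx
  exact hx.symm

end Wold

/-! ### The part of `Y` in the wandering subspace -/

section Part

variable {K : Type u} [NormedAddCommGroup K] [InnerProductSpace ℂ K] {M : Submodule ℂ K}
  {Y : K →ₗ.[ℂ] K}

/-- The part of `Y` in the subspace `M`: the restriction of `Y` to the vectors `x ∈ M ∩ D(Y)` with
`Y x ∈ M`, as an operator on `M`. -/
noncomputable def partIn (M : Submodule ℂ K) (Y : K →ₗ.[ℂ] K) : M →ₗ.[ℂ] M :=
  (Y.graph.comap (M.subtype.prodMap M.subtype)).toLinearPMap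

theorem mem_graph_partIn {x y : M} :
    (x, y) ∈ (partIn M Y).graph ↔ ((x : K), (y : K)) ∈ Y.graph := by
  rw [partIn, Submodule.toLinearPMap_graph_eq]
  · rfl
  · rintro ⟨x, y⟩ hxy (rfl : x = 0)
    exact Subtype.ext (Y.graph_fst_eq_zero_snd (x := (0 : K)) hxy rfl)

theorem hasTrivialKernel_partIn (hY : HasTrivialKernel Y) : HasTrivialKernel (partIn M Y) :=
  (hasTrivialKernel_iff _).2 fun x hx =>
    Subtype.ext ((hasTrivialKernel_iff Y).1 hY x (mem_graph_partIn.1 hx))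

variable [CompleteSpace K] [CompleteSpace M] {v : K →L[ℂ] K} {r : ℂ}

theorem isSelfAdjoint_partIn (hY : IsSelfAdjoint Y)
    (hM : ∀ x y, (x, y) ∈ Y.graph → (M.starProjection x, M.starProjection y) ∈ Y.graph) :
    IsSelfAdjoint (partIn M Y) := by
  have hmem {x y : K} (hxy : (x, y) ∈ Y.graph) :
      (M.orthogonalProjectionOnto x, M.orthogonalProjectionOnto y) ∈ (partIn M Y).graph :=
    mem_graph_partIn.2 (hM x y hxy)
  refine isSelfAdjoint_of_forall_mem_graph_iff ?_ fun y z => ⟨fun hyz p r hpr => ?_, fun hyz => ?_⟩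
  · have hsurj : Function.Surjective M.orthogonalProjectionOnto := fun w =>
      ⟨w, M.orthogonalProjectionOnto_mem_subspace_eq_self w⟩
    refine (hsurj.denseRange.dense_image M.orthogonalProjectionOnto.continuous
      hY.dense_domain).mono ?_
    rintro _ ⟨x, hx, rfl⟩
    obtain ⟨y, hy⟩ := LinearPMap.mem_domain_iff.1 hx
    exact LinearPMap.mem_domain_of_mem_graph (hmem hy)
  · exact (mem_graph_iff_of_isSelfAdjoint hY _ _).1 (mem_graph_partIn.1 hyz) _ _
      (mem_graph_partIn.1 hpr)
  · rw [mem_graph_partIn, mem_graph_iff_of_isSelfAdjoint hY]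
    intro p r hpr
    rw [← Submodule.inner_orthogonalProjectionOnto_eq_of_mem_right,
      ← Submodule.inner_orthogonalProjectionOnto_eq_of_mem_right]
    exact hyz _ _ (hmem hpr)

namespace IsScaledBy

theorem map_star_mem_graph (hs : IsScaledBy Y v r) (hr : r ≠ 0) {x y : K}
    (hxy : (x, y) ∈ Y.graph) : (v (star v x), v (star v y)) ∈ Y.graph := by
  simpa only [map_smul, smul_inv_smul₀ hr] using hs.map_mem_graph (hs.star_map_mem_graph hxy)

theorem starProjection_mem_graph (hs : IsScaledBy Y v r) (hr : r ≠ 0) (hv : star v * v = 1)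
    {x y : K} (hxy : (x, y) ∈ Y.graph) :
    ((wandering v).starProjection x, (wandering v).starProjection y) ∈ Y.graph := by
  rw [starProjection_wandering hv, starProjection_wandering hv]
  exact Y.graph.sub_mem hxy (hs.map_star_mem_graph hr hxy)

theorem isSelfAdjoint_partIn_wandering (hs : IsScaledBy Y v r) (hr : r ≠ 0) (hv : star v * v = 1)
    (hY : IsSelfAdjoint Y) : IsSelfAdjoint (partIn (wandering v) Y) :=
  isSelfAdjoint_partIn hY fun _ _ => hs.starProjection_mem_graph hr hv

theorem woldEquiv_mem_graph_partIn (hs : IsScaledBy Y v r) (hr : r ≠ 0) (hv : star v * v = 1)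
    (h : unitaryPart v = ⊥) {x y : K} (hxy : (x, y) ∈ Y.graph) (n : ℕ) :
    (woldEquiv hv h x n, r⁻¹ ^ n • woldEquiv hv h y n) ∈ (partIn (wandering v) Y).graph := by
  induction n generalizing x y with
  | zero =>
    rw [pow_zero, one_smul, woldEquiv_apply_zero, woldEquiv_apply_zero]
    exact mem_graph_partIn.2 (hs.starProjection_mem_graph hr hv hxy)
  | succ n ih =>
    have hstar := ih (hs.star_map_mem_graph hxy)
    rwa [map_smul, lp.coeFn_smul, Pi.smul_apply, smul_smul, ← pow_succ, woldEquiv_star_apply,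
      woldEquiv_star_apply] at hstar

theorem intertwines_woldEquiv {q : ℝ} (hs : IsScaledBy Y v ((q : ℂ) ^ 2)) (hq : q ≠ 0)
    (hv : star v * v = 1) (h : unitaryPart v = ⊥) (hY : IsSelfAdjoint Y) :
    Intertwines (woldEquiv hv h) Y (modelY q (partIn (wandering v) Y)) := by
  have hq2 : (q : ℂ) ^ 2 ≠ 0 := pow_ne_zero _ (Complex.ofReal_ne_zero.2 hq)
  refine intertwines_of_isSelfAdjoint hY
    (isSelfAdjoint_modelY hq (hs.isSelfAdjoint_partIn_wandering hq2 hv hY)) fun x y hxy =>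
      (mem_graph_diagOp _ _ _).2 fun n => (mem_graph_smul _ _ _ _).2
        ⟨_, hs.woldEquiv_mem_graph_partIn hq2 hv h hxy n, ?_⟩
  rw [pow_mul, inv_pow, smul_inv_smul₀ (pow_ne_zero n hq2)]

theorem woldEquiv_mem_graph_opMul_partIn {q : ℝ} (hs : IsScaledBy Y v ((q : ℂ) ^ 2)) (hq : q ≠ 0)
    (hv : star v * v = 1) (h : unitaryPart v = ⊥) (hY : IsSelfAdjoint Y) {x y y' : K}
    (hxy : (x, y) ∈ Y.graph) (hyy' : (y, y') ∈ Y.graph) (n : ℕ) :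
    ∃ η, (woldEquiv hv h x n, η) ∈
        (opMul (partIn (wandering v) Y) (partIn (wandering v) Y)).graph ∧
      woldEquiv hv h y' n = (q : ℂ) ^ (4 * n) • η := by
  have hq2 : (q : ℂ) ^ 2 ≠ 0 := pow_ne_zero _ (Complex.ofReal_ne_zero.2 hq)
  have hU := hs.intertwines_woldEquiv hq hv h hY
  exact (mem_graph_opMul_modelY hq (hs.isSelfAdjoint_partIn_wandering hq2 hv hY) _ _).1
    ((mem_graph_opMul _ _ _ _).2 ⟨_, (hU x y).1 hxy, (hU y y').1 hyy'⟩) n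

end IsScaledBy

end Part

/-! ### Well-behaved representations are models -/

section Classification

variable {K : Type u} [NormedAddCommGroup K] [InnerProductSpace ℂ K] [CompleteSpace K]
  {q c : ℝ} {X Y : K →ₗ.[ℂ] K} {a b v : K →L[ℂ] K}

theorem isPosSqrt_diagOp {A B : ℕ → K →ₗ.[ℂ] K} (h : ∀ n, IsPosSqrt (A n) (B n)) :
    IsPosSqrt (diagOp A) (diagOp B) where
  selfAdjoint := isSelfAdjoint_diagOp fun n => (h n).selfAdjoint
  nonneg x := by
    exact (Complex.hasSum_re (lp.hasSum_inner (𝕜 := ℂ) (x : HSum K) (diagOp B x))).nonneg fun n =>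
      (h n).re_inner_nonneg ((mem_graph_diagOp _ _ _).1 ((diagOp B).mem_graph x) n)
  sq := by
    rw [opMul_diagOp_self fun n => (h n).selfAdjoint]
    exact congrArg diagOp (funext fun n => (h n).sq)

theorem isPosSqrt_diagOp_weight (hq₀ : 0 < q) (hq₁ : q < 1) (hc : 0 ≤ c) (hY : IsSelfAdjoint Y) :
    IsPosSqrt (opMul (modelXstar q c Y) (modelX q c Y)) (diagOp (weight q c Y)) := by
  rw [modelXstar, modelX, opMul_loweringOp_raisingOp (isSelfAdjoint_weight hq₀ hq₁ hc hY)]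
  refine isPosSqrt_diagOp fun n => ?_
  rw [(isPosSqrt_weight hq₀ hq₁ hc hY n).sq]
  exact isPosSqrt_weight hq₀ hq₁ hc hY n

namespace IsPolarTransform

variable (hp : IsPolarTransform X a b v) (h : IsRepresentation q c X Y)
  (hs : IsScaledBy Y v ((q : ℂ) ^ 2)) (hbot : unitaryPart v = ⊥)

include h hs

/-- The induction rests on the relation, which expresses `X*X` at `x` through `X*X` at `v*x`, and
on `(U v* x)ₙ = (U x)ₙ₊₁` for the unitary `U` of the Wold decomposition. -/
theorem woldEquiv_of_mem_graph_adjoint_mul (hq : q ≠ 0) {x z : K}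
    (hxz : (x, z) ∈ (QSphere.opMul X† X).graph) (n : ℕ) :
    ∃ η, (woldEquiv hp.isometry hbot x n, η) ∈
        (QSphere.opMul (partIn (wandering v) Y) (partIn (wandering v) Y)).graph ∧
      woldEquiv hp.isometry hbot z n = (1 - (q : ℂ) ^ (2 * (n + 1))) •
        ((q : ℂ) ^ (2 * n) • η + (c : ℂ) • woldEquiv hp.isometry hbot x n) := by
  induction n generalizing x z with
  | zero =>
    obtain ⟨w, y, y', -, hxy, hyy', rfl⟩ := hp.exists_relation h hxz
    obtain ⟨η, hη, hy'⟩ := hs.woldEquiv_mem_graph_opMul_partIn hq hp.isometry hbot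
      h.selfAdjoint hxy hyy' 0
    refine ⟨η, hη, ?_⟩
    simp only [map_add, map_smul, lp.coeFn_add, lp.coeFn_smul, Pi.add_apply, Pi.smul_apply, hy',
      woldEquiv_map_zero]
    module
  | succ n ih =>
    obtain ⟨w, y, y', hw, hxy, hyy', rfl⟩ := hp.exists_relation h hxz
    obtain ⟨η, hη, hy'⟩ := hs.woldEquiv_mem_graph_opMul_partIn hq hp.isometry hbot
      h.selfAdjoint hxy hyy' (n + 1)
    obtain ⟨η', hη', hw'⟩ := ih hw
    rw [woldEquiv_star_apply] at hη' hw'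
    obtain rfl := eq_of_mem_graph hη hη'
    refine ⟨η, hη, ?_⟩
    simp only [map_add, map_smul, lp.coeFn_add, lp.coeFn_smul, Pi.add_apply, Pi.smul_apply, hy',
      woldEquiv_map_succ, hw']
    module

variable (hq₀ : 0 < q) (hq₁ : q < 1) (hc : 0 ≤ c)

include hq₀ hq₁ hc

theorem intertwines_adjoint_mul_self : Intertwines (woldEquiv hp.isometry hbot)
    (QSphere.opMul X† X) (QSphere.opMul (modelXstar q c (partIn (wandering v) Y))
      (modelX q c (partIn (wandering v) Y))) := by
  have hq2 : (q : ℂ) ^ 2 ≠ 0 := pow_ne_zero _ (Complex.ofReal_ne_zero.2 hq₀.ne')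
  have hY₀ := hs.isSelfAdjoint_partIn_wandering hq2 hp.isometry h.selfAdjoint
  exact intertwines_of_isSelfAdjoint
    (hp.isPosSqrt hp.isQuotient_modulus hp.isQuotient_adjoint_mul_self).isSelfAdjoint
    (isPosSqrt_diagOp_weight hq₀ hq₁ hc hY₀).isSelfAdjoint fun x z hxz =>
      (mem_graph_opMul_modelXstar_modelX hq₀ hq₁ hc hY₀ _ _).2
        (hp.woldEquiv_of_mem_graph_adjoint_mul h hs hbot hq₀.ne' hxz)

theorem intertwines_modulus : Intertwines (woldEquiv hp.isometry hbot) (modulus X)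
    (diagOp (weight q c (partIn (wandering v) Y))) :=
  (hp.intertwines_adjoint_mul_self h hs hbot hq₀ hq₁ hc).isPosSqrt
    (hp.isPosSqrt hp.isQuotient_modulus hp.isQuotient_adjoint_mul_self)
    (isPosSqrt_diagOp_weight hq₀ hq₁ hc (hs.isSelfAdjoint_partIn_wandering
      (pow_ne_zero _ (Complex.ofReal_ne_zero.2 hq₀.ne')) hp.isometry h.selfAdjoint))

theorem intertwines_modelX :
    Intertwines (woldEquiv hp.isometry hbot) X (modelX q c (partIn (wandering v) Y)) := by
  have hmod := hp.intertwines_modulus h hs hbot hq₀ hq₁ hc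
  intro x y
  rw [modelX, mem_graph_raisingOp]
  constructor
  · intro hxy
    obtain ⟨u, rfl, rfl⟩ := (hp.isQuotient _ _).1 hxy
    refine ⟨woldEquiv_map_zero _ _ _, fun n => ?_⟩
    rw [mul_apply_eq_comp, woldEquiv_map_succ]
    exact (mem_graph_diagOp _ _ _).1 ((hmod _ _).1 (hp.isQuotient_modulus.mem_graph u)) n
  · rintro ⟨hzero, hsucc⟩
    have hmem : (x, star v y) ∈ (modulus X).graph :=
      (hmod _ _).2 ((mem_graph_diagOp _ _ _).2 fun n => by
        rw [woldEquiv_star_apply]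
        exact hsucc n)
    obtain ⟨u, rfl, hu⟩ := (hp.isQuotient_modulus _ _).1 hmem
    refine (hp.isQuotient _ _).2 ⟨u, rfl, ?_⟩
    rw [mul_apply_eq_comp, hu, map_star_apply_of_woldEquiv_zero hp.isometry hbot hzero]

end IsPolarTransform

theorem IsRepresentation.exists_model (h : IsRepresentation q c X Y) (hwb : IsWellBehaved X Y)
    (hq₀ : 0 < q) (hq₁ : q < 1) (hc : 0 ≤ c) :
    ∃ (K₀ : Type u) (_ : NormedAddCommGroup K₀) (_ : InnerProductSpace ℂ K₀)
      (_ : CompleteSpace K₀) (Y₀ : K₀ →ₗ.[ℂ] K₀) (U : K ≃ₗᵢ[ℂ] HSum K₀),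
      IsSelfAdjoint Y₀ ∧ HasTrivialKernel Y₀ ∧ Intertwines U X (modelX q c Y₀) ∧
      Intertwines U X† (modelXstar q c Y₀) ∧ Intertwines U Y (modelY q Y₀) := by
  have hq_sq : q ^ 2 < 1 := pow_lt_one₀ hq₀.le hq₁ two_ne_zero
  have hq2 : (q : ℂ) ^ 2 ≠ 0 := pow_ne_zero _ (Complex.ofReal_ne_zero.2 hq₀.ne')
  have hker := h.hasTrivialKernel_X hq_sq hc
  obtain ⟨a, b, v, s, t, hj⟩ :=
    exists_isJointTransform h.dense h.closed hker h.selfAdjoint hwb.strongly_commute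
  have hp := hj.toIsPolarTransform
  have hs := hj.isScaledBy h hq₀.ne' hker
  have hbot := hp.unitaryPart_eq_bot h hs (hwb.reduces v hp.isPolarDecomposition) hq_sq hc
  have hY₀ := hs.isSelfAdjoint_partIn_wandering hq2 hp.isometry h.selfAdjoint
  have hX := hp.intertwines_modelX h hs hbot hq₀ hq₁ hc
  have hX' := hX.adjoint h.dense (dense_domain_modelX hq₀ hq₁ hc hY₀)
  rw [adjoint_modelX hq₀ hq₁ hc hY₀] at hX'
  exact ⟨wandering v, inferInstance, inferInstance, inferInstance, partIn (wandering v) Y,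
    woldEquiv hp.isometry hbot, hY₀, hasTrivialKernel_partIn h.kernel, hX, hX',
    hs.intertwines_woldEquiv hq₀.ne' hp.isometry hbot h.selfAdjoint⟩

end Classification

end QSphere

theorem mainTheorem2 (q c : ℝ) (hq₀ : 0 < q) (hq₁ : q < 1) (hc : 0 ≤ c) :
    (∀ (K : Type u) [NormedAddCommGroup K] [InnerProductSpace ℂ K] [CompleteSpace K]
        (X Y : K →ₗ.[ℂ] K),
        QSphere.IsRepresentation q c X Y → QSphere.IsWellBehaved X Y →
        ∃ (K₀ : Type u) (_ : NormedAddCommGroup K₀) (_ : InnerProductSpace ℂ K₀)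
          (_ : CompleteSpace K₀) (Y₀ : K₀ →ₗ.[ℂ] K₀) (U : K ≃ₗᵢ[ℂ] QSphere.HSum K₀),
          IsSelfAdjoint Y₀ ∧ QSphere.HasTrivialKernel Y₀ ∧
          QSphere.Intertwines U X (QSphere.modelX q c Y₀) ∧
          QSphere.Intertwines U X† (QSphere.modelXstar q c Y₀) ∧
          QSphere.Intertwines U Y (QSphere.modelY q Y₀)) ∧
    (∀ (K₀ : Type u) [NormedAddCommGroup K₀] [InnerProductSpace ℂ K₀] [CompleteSpace K₀]
        (Y₀ : K₀ →ₗ.[ℂ] K₀), IsSelfAdjoint Y₀ → QSphere.HasTrivialKernel Y₀ →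
        (QSphere.modelX q c Y₀)† = QSphere.modelXstar q c Y₀ ∧
        QSphere.IsRepresentation q c (QSphere.modelX q c Y₀) (QSphere.modelY q Y₀) ∧
        QSphere.InducesStarRepresentation q c (QSphere.modelX q c Y₀)
          (QSphere.modelY q Y₀)) := by
  refine ⟨fun K _ _ _ X Y hrep hwb => hrep.exists_model hwb hq₀ hq₁ hc,
    fun K₀ _ _ _ Y₀ hY₀ hker => ⟨?_, ?_, ?_⟩⟩
  · exact QSphere.adjoint_modelX hq₀ hq₁ hc hY₀
  · exact QSphere.isRepresentation_model hq₀ hq₁ hc hY₀ hker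
  · exact QSphere.inducesStarRepresentation_model hq₀ hq₁ hc hY₀ hker
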